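/- Let $L_x,L_y>0$ and $\Omega=(0,L_x)\times(0,L_y)$, and write $\|\cdot\|_2$ for the norm of $L^2(\Omega;\mathbb R^2)$. Consider the two-dimensional Kuramoto–Sivashinsky equation $$\vec u_t=-\Delta^2\vec u-\Delta\vec u+\nabla(\vec u\cdot\vec u),\qquad \nabla^\perp\cdot\vec u=0,$$ with periodic boundary conditions on $\Omega$. A weak solution on a time interval $I=[0,T]$ or $I=[0,\infty)$ with initial value $\vec u_0$ is a function $\vec u\in C(I;L^2(\Omega;\mathbb R^2))$ with $\vec u(0)=\vec u_0$ such that, for every $t\in I$, one has $\nabla^\perp\cdot\vec u(t)=0$ in the sense of periodic distributions, and, for $i=1,2$ and every smooth $\eta:\mathbb R^2\to\mathbb R$ that is $L_x$-periodic in $x$ and $L_y$-periodic in $y$, $$\int_\Omega u_i(t)\,\eta=\int_\Omega u_{0,i}\,\eta+\int_0^t\!\!\int_\Omega\bigl(-u_i\,\Delta^2\eta-u_i\,\Delta\eta-|\vec u|^2\,\partial_i\eta\bigr)\,dx\,dy\,ds .$$ There are absolute constants $c,C>0$ such that the following holds. Let $L_x\ge1$ and $$0<L_y\le c\,L_x^{-13/7},$$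 and let $\vec u_0\in L^2(\Omega;\mathbb R^2)$ have mean zero (in both components), satisfy $\nabla^\perp\cdot\vec u_0=0$ in the sense of periodic distributions, and satisfy $$\|\vec u_0\|_2\le c\,L_y^{-2}.$$ Then there is a weak solution $\vec u$ on $[0,\infty)$ with initial value $\vec u_0$; it is unique, in the sense that for each $T>0$ every weak solution on $[0,T]$ with initial value $\vec u_0$ coincides with $\vec u$ on $[0,T]$; it is bounded, $\sup_{t\ge0}\|\vec u(t)\|_2<\infty$; and $$\limsup_{t\to\infty}\|\vec u(t)\|_2\le C\,L_x^{3/2}L_y^{1/2}.$$ -/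

import Mathlib

open Set Filter MeasureTheory
open scoped ContDiff

noncomputable section

namespace ThinKS

/-- The open rectangle `(0, Lx) × (0, Ly)`. -/
def rect (Lx Ly : ℝ) : Set (ℝ × ℝ) := Ioo 0 Lx ×ˢ Ioo 0 Ly

/-- The space `L²((0, Lx) × (0, Ly); ℝ²)` of square integrable planar vector fields, with its
usual norm (the values carry the Euclidean norm, the measure is Lebesgue measure). -/
abbrev L2Field (Lx Ly : ℝ) : Type :=
  Lp (EuclideanSpace ℝ (Fin 2)) 2 ((volume : Measure (ℝ × ℝ)).restrict (rect Lx Ly))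

/-- The partial derivatives: index `0` is `∂/∂x`, index `1` is `∂/∂y`. -/
def pderiv (i : Fin 2) (f : ℝ × ℝ → ℝ) (p : ℝ × ℝ) : ℝ :=
  if i = 0 then deriv (fun s => f (s, p.2)) p.1 else deriv (fun s => f (p.1, s)) p.2

/-- The Laplacian of a scalar function on the plane. -/
def lap (f : ℝ × ℝ → ℝ) (p : ℝ × ℝ) : ℝ :=
  pderiv 0 (pderiv 0 f) p + pderiv 1 (pderiv 1 f) p

/-- Test functions: smooth functions on the plane that are `Lx`-periodic in `x` and
`Ly`-periodic in `y`. Testing against all of them encodes the periodic boundary conditions. -/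
structure IsTest (Lx Ly : ℝ) (η : ℝ × ℝ → ℝ) : Prop where
  smooth : ContDiff ℝ ∞ η
  periodic_x : ∀ x y, η (x + Lx, y) = η (x, y)
  periodic_y : ∀ x y, η (x, y + Ly) = η (x, y)

variable {Lx Ly : ℝ}

/-- Both components of the field have mean zero over the rectangle. -/
def MeanZero (u : L2Field Lx Ly) : Prop :=
  ∀ i : Fin 2, ∫ p in rect Lx Ly, u p i = 0

/-- `∂u₂/∂x - ∂u₁/∂y = 0` in the sense of periodic distributions. -/
def CurlFree (u : L2Field Lx Ly) : Prop :=
  ∀ η : ℝ × ℝ → ℝ, IsTest Lx Ly η →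
    ∫ p in rect Lx Ly, (u p 1 * pderiv 0 η p - u p 0 * pderiv 1 η p) = 0

/-- `u : I → L²` (with `I = [0, T]` or `I = [0, ∞)`) is a weak solution, with initial value `u₀`,
of the two-dimensional Kuramoto-Sivashinsky equation with periodic boundary conditions
`∂u/∂t = -Δ²u - Δu + ∇(u · u)`, `∇^⊥ · u = 0`. -/
structure IsWeakSolution (I : Set ℝ) (u₀ : L2Field Lx Ly) (u : ℝ → L2Field Lx Ly) : Prop where
  continuousOn : ContinuousOn u I
  initial : u 0 = u₀
  curlFree : ∀ t ∈ I, CurlFree (u t)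
  weak : ∀ t ∈ I, ∀ i : Fin 2, ∀ η : ℝ × ℝ → ℝ, IsTest Lx Ly η →
    ∫ p in rect Lx Ly, u t p i * η p =
      (∫ p in rect Lx Ly, u₀ p i * η p) +
        ∫ s in (0 : ℝ)..t, ∫ p in rect Lx Ly,
          (-(u s p i * lap (lap η) p) - u s p i * lap η p - ‖u s p‖ ^ 2 * pderiv i η p)

end ThinKS

end

/-!
The equation is written in the orthonormal basis of gradient modes `gradBasis`: a mean-zero
curl-free field is determined by its coefficients `c k`, and being a weak solution amounts to the
integrated equations `c' = -λ c - q` for these coefficients, where `λ` is the eigenvalue of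
`Δ² + Δ` and `q` the tested nonlinearity (`IsWeakSolution.gradCoeff_eq`,
`isWeakSolution_of_gradCoeff`).

*Uniqueness and convergence.* On `L²` the tested nonlinearity is Lipschitz with a constant of order
`|κ|`, whereas the linear evolution, weighted by `exp (-α t)`, gains `1 / (λ + α)`. As `λ` grows
like `|κ| ^ 4`, the gains are square summable on a planar lattice, with a sum that tends to zero as
`α → ∞`. The equation is therefore a contraction in a weighted supremum norm of `L²`-valued curves
(`norm_sub_sq_le_of_coeffEq`). This gives uniqueness (`IsWeakSolution.eqOn`), and it shows that
uniformly bounded Galerkin approximations form a Cauchy sequence whose limit is a weak solution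
(`exists_weakSolution_of_truncations`).

*The a priori bound.* What is missing is a bound for the Galerkin approximations that is uniform in
time and in the truncation. The squared norm itself is not a Lyapunov function, because the modes
with `|κ| < 1` are amplified. Instead, one uses the distance of `u` to a family of gauge fields
`φ_b`, `b ∈ [0, Lx]`, which depend on `x` only and are translates of one another. In the evolution
of `‖u - φ_b‖ ^ 2` the nonlinearity contributes `∫ |u|² div φ_b`, and `div φ_b` is a density of
mean `4` concentrated near `b`, minus `4`. The constant damps all modes. The concentrated part is
harmless where `u` has mean zero against the density, because the density is a rescaled profile of
negative second moment, so that `∫ bump * w ^ 2` is controlled by the second derivative of `w`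
(`integral_bump_mul_sq_le`, `integral_gaugeSum_mul_sq_le`). This mean vanishes when `b` minimises
the distance (`integral_bump_mul_axisSum`), which is the reason for using the whole family.

In one dimension the cubic term `∫ |u|² div u` vanishes. Here it does not, but every surviving
contribution has two factors that oscillate in the thin direction, where the dissipation is
strong, so that it is bounded by `Ly ^ 2 ‖u‖` times the dissipation
(`abs_integral_fieldSq_mul_divSum_le`). Hence, as long as `Ly ^ 2 ‖u‖` is small, the squared
distance decays at rate `1` up to a source of order `Lx ^ 3 * Ly` (`sum_sub_gaugeVec_mul_le`). The
minimal distance is not differentiable in time, but freezing the optimal centre bounds its upper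
right derivative, and a comparison with an exponentially decaying barrier shows that the smallness
persists (`sum_sq_le_of_flow`). Initially it is ensured by the hypothesis on the data, and for the
absorbing ball by the thinness of the rectangle.
-/

noncomputable section

namespace ThinKS

section

/-! ### The real Fourier modes -/

/-- The function `cos + sin`. The functions `cas (κ · p)`, with `κ` in the dual lattice of the
rectangle, form a real orthogonal basis indexed by the whole lattice. -/
def cas (θ : ℝ) : ℝ := Real.cos θ + Real.sin θ

lemma cas_neg (θ : ℝ) : cas (-θ) = Real.cos θ - Real.sin θ := by
  simp [cas, sub_eq_add_neg]

/-- The sharp bound is `√2`; the value `3 / 2` is used throughout. -/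
lemma abs_cas_le (θ : ℝ) : |cas θ| ≤ 3 / 2 := by
  apply abs_le_of_sq_le_sq _ (by norm_num)
  unfold cas
  nlinarith [Real.sin_sq_add_cos_sq θ, sq_nonneg (Real.cos θ - Real.sin θ)]

lemma cas_sq_add_cas_neg_sq (θ : ℝ) : cas θ ^ 2 + cas (-θ) ^ 2 = 2 := by
  rw [cas_neg]
  unfold cas
  nlinarith [Real.sin_sq_add_cos_sq θ]

lemma contDiff_cas {n : WithTop ℕ∞} : ContDiff ℝ n cas := Real.contDiff_cos.add Real.contDiff_sin

lemma continuous_cas : Continuous cas := Real.continuous_cos.add Real.continuous_sin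

lemma hasDerivAt_cas (θ : ℝ) : HasDerivAt cas (cas (-θ)) θ := by
  rw [cas_neg]
  have h := (Real.hasDerivAt_cos θ).add (Real.hasDerivAt_sin θ)
  convert! h using 1
  ring

/-- The angular frequencies `2πk₁/Lx` and `2πk₂/Ly` belonging to a lattice point `k`. -/
def wave (Lx Ly : ℝ) (k : ℤ × ℤ) (i : Fin 2) : ℝ :=
  if i = 0 then 2 * Real.pi * k.1 / Lx else 2 * Real.pi * k.2 / Ly

/-- The squared length of the wave vector. -/
def waveSq (Lx Ly : ℝ) (k : ℤ × ℤ) : ℝ := wave Lx Ly k 0 ^ 2 + wave Lx Ly k 1 ^ 2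

/-- The real Fourier mode `cas (κ · p)` with wave vector `κ`. -/
def mode (Lx Ly : ℝ) (k : ℤ × ℤ) (p : ℝ × ℝ) : ℝ :=
  cas (wave Lx Ly k 0 * p.1 + wave Lx Ly k 1 * p.2)

variable {Lx Ly : ℝ}

lemma wave_neg (k : ℤ × ℤ) (i : Fin 2) : wave Lx Ly (-k) i = -wave Lx Ly k i := by
  fin_cases i <;> simp [wave] <;> ring

lemma wave_add (k l : ℤ × ℤ) (i : Fin 2) :
    wave Lx Ly (k + l) i = wave Lx Ly k i + wave Lx Ly l i := by
  fin_cases i <;> simp [wave] <;> ring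

lemma waveSq_nonneg (k : ℤ × ℤ) : 0 ≤ waveSq Lx Ly k := by unfold waveSq; positivity

lemma waveSq_pos (hx : 0 < Lx) (hy : 0 < Ly) {k : ℤ × ℤ} (hk : k ≠ 0) : 0 < waveSq Lx Ly k := by
  unfold waveSq wave
  by_cases h : k.1 = 0
  · have h2 : k.2 ≠ 0 := fun h' => hk (Prod.ext h h')
    have : 0 < (2 * Real.pi * (k.2 : ℝ) / Ly) ^ 2 := by positivity
    simp only [Fin.isValue, if_true, one_ne_zero, if_false]
    positivity
  · simp only [Fin.isValue, if_true, one_ne_zero, if_false]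
    have : 0 < (2 * Real.pi * (k.1 : ℝ) / Lx) ^ 2 := by positivity
    positivity

lemma mode_zero (p : ℝ × ℝ) : mode Lx Ly 0 p = 1 := by simp [mode, wave, cas]

lemma mode_neg (k : ℤ × ℤ) (p : ℝ × ℝ) :
    mode Lx Ly (-k) p = cas (-(wave Lx Ly k 0 * p.1 + wave Lx Ly k 1 * p.2)) := by
  unfold mode
  rw [wave_neg, wave_neg]
  congr 1; ring

lemma abs_mode_le (k : ℤ × ℤ) (p : ℝ × ℝ) : |mode Lx Ly k p| ≤ 3 / 2 := abs_cas_le _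

lemma contDiff_mode (k : ℤ × ℤ) {n : WithTop ℕ∞} : ContDiff ℝ n (mode Lx Ly k) :=
  contDiff_cas.comp ((contDiff_const.mul contDiff_fst).add (contDiff_const.mul contDiff_snd))

@[fun_prop]
lemma continuous_mode (k : ℤ × ℤ) : Continuous (mode Lx Ly k) :=
  (contDiff_mode k (n := 0)).continuous

lemma cas_add_int_mul_two_pi (θ : ℝ) (n : ℤ) : cas (θ + n * (2 * Real.pi)) = cas θ := by
  simp [cas, Real.cos_add_int_mul_two_pi, Real.sin_add_int_mul_two_pi]

lemma mode_add_x (hx : Lx ≠ 0) (k : ℤ × ℤ) (x y : ℝ) :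
    mode Lx Ly k (x + Lx, y) = mode Lx Ly k (x, y) := by
  have h : wave Lx Ly k 0 * (x + Lx, y).1 + wave Lx Ly k 1 * (x + Lx, y).2 =
      wave Lx Ly k 0 * (x, y).1 + wave Lx Ly k 1 * (x, y).2 + k.1 * (2 * Real.pi) := by
    simp [wave]
    field_simp
    ring
  rw [mode, h, cas_add_int_mul_two_pi, mode]

lemma mode_add_y (hy : Ly ≠ 0) (k : ℤ × ℤ) (x y : ℝ) :
    mode Lx Ly k (x, y + Ly) = mode Lx Ly k (x, y) := by
  have h : wave Lx Ly k 0 * (x, y + Ly).1 + wave Lx Ly k 1 * (x, y + Ly).2 =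
      wave Lx Ly k 0 * (x, y).1 + wave Lx Ly k 1 * (x, y).2 + k.2 * (2 * Real.pi) := by
    simp [wave]
    field_simp
    ring
  rw [mode, h, cas_add_int_mul_two_pi, mode]

lemma isTest_mode (hx : Lx ≠ 0) (hy : Ly ≠ 0) (k : ℤ × ℤ) : IsTest Lx Ly (mode Lx Ly k) :=
  ⟨contDiff_mode k, mode_add_x hx k, mode_add_y hy k⟩

lemma pderiv_mode (i : Fin 2) (k : ℤ × ℤ) :
    pderiv i (mode Lx Ly k) = fun p => wave Lx Ly k i * mode Lx Ly (-k) p := by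
  funext p
  rw [mode_neg]
  fin_cases i
  · have h : HasDerivAt (fun s => mode Lx Ly k (s, p.2)) _ p.1 :=
      (hasDerivAt_cas (wave Lx Ly k 0 * p.1 + wave Lx Ly k 1 * p.2)).comp p.1
        (((hasDerivAt_id p.1).const_mul (wave Lx Ly k 0)).add_const (wave Lx Ly k 1 * p.2))
    simp only [pderiv, Fin.zero_eta, if_true]
    rw [h.deriv]; ring
  · have h : HasDerivAt (fun s => mode Lx Ly k (p.1, s)) _ p.2 :=
      (hasDerivAt_cas (wave Lx Ly k 0 * p.1 + wave Lx Ly k 1 * p.2)).comp p.2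
        (((hasDerivAt_id p.2).const_mul (wave Lx Ly k 1)).const_add (wave Lx Ly k 0 * p.1))
    simp only [pderiv, Fin.mk_one, one_ne_zero, if_false]
    rw [h.deriv]; ring

lemma pderiv_const_mul (i : Fin 2) (c : ℝ) (f : ℝ × ℝ → ℝ) :
    pderiv i (fun p => c * f p) = fun p => c * pderiv i f p := by
  funext p
  unfold pderiv
  split_ifs <;> simp

lemma lap_const_mul (c : ℝ) (f : ℝ × ℝ → ℝ) :
    lap (fun p => c * f p) = fun p => c * lap f p := by
  funext p
  simp only [lap, pderiv_const_mul]
  ring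

lemma lap_mode (k : ℤ × ℤ) :
    lap (mode Lx Ly k) = fun p => -waveSq Lx Ly k * mode Lx Ly k p := by
  funext p
  simp only [lap, pderiv_mode, pderiv_const_mul, wave_neg, neg_neg, waveSq]
  ring

lemma lap_lap_mode (k : ℤ × ℤ) :
    lap (lap (mode Lx Ly k)) = fun p => waveSq Lx Ly k ^ 2 * mode Lx Ly k p := by
  rw [lap_mode, lap_const_mul, lap_mode]
  funext p
  ring

/-! ### Integrals over the rectangle -/

lemma measurableSet_rect : MeasurableSet (rect Lx Ly) :=
  (isOpen_Ioo.prod isOpen_Ioo).measurableSet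

lemma restrict_rect :
    (volume : Measure (ℝ × ℝ)).restrict (rect Lx Ly) =
      ((volume : Measure ℝ).restrict (Ioo 0 Lx)).prod
        ((volume : Measure ℝ).restrict (Ioo 0 Ly)) := by
  rw [Measure.prod_restrict]; rfl

instance : IsFiniteMeasure ((volume : Measure (ℝ × ℝ)).restrict (rect Lx Ly)) := by
  rw [restrict_rect]; infer_instance

lemma memLp_of_continuous {E : Type*} [NormedAddCommGroup E] [SecondCountableTopology E]
    {f : ℝ × ℝ → E} (hf : Continuous f)
    (q : ENNReal) : MemLp f q ((volume : Measure (ℝ × ℝ)).restrict (rect Lx Ly)) := by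
  obtain ⟨C, hC⟩ := (isCompact_Icc.prod isCompact_Icc :
    IsCompact (Icc (0 : ℝ) Lx ×ˢ Icc (0 : ℝ) Ly)).exists_bound_of_continuousOn hf.continuousOn
  refine MemLp.of_bound hf.aestronglyMeasurable C ?_
  refine (ae_restrict_mem measurableSet_rect).mono fun p hp => hC p ?_
  exact ⟨Ioo_subset_Icc_self hp.1, Ioo_subset_Icc_self hp.2⟩

lemma integrable_of_continuous {E : Type*} [NormedAddCommGroup E] [SecondCountableTopology E]
    {f : ℝ × ℝ → E} (hf : Continuous f) :
    Integrable f ((volume : Measure (ℝ × ℝ)).restrict (rect Lx Ly)) :=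
  memLp_one_iff_integrable.1 (memLp_of_continuous hf 1)

lemma integral_rect (hx : 0 ≤ Lx) (hy : 0 ≤ Ly) {f : ℝ × ℝ → ℝ} (hf : Continuous f) :
    ∫ p in rect Lx Ly, f p = ∫ x in (0 : ℝ)..Lx, ∫ y in (0 : ℝ)..Ly, f (x, y) := by
  rw [intervalIntegral.integral_of_le hx, integral_Ioc_eq_integral_Ioo]
  simp_rw [intervalIntegral.integral_of_le hy, integral_Ioc_eq_integral_Ioo]
  have h := integrable_of_continuous (Lx := Lx) (Ly := Ly) hf
  rw [restrict_rect] at h ⊢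
  exact integral_prod _ h

lemma integral_cas {L : ℝ} (hL : 0 < L) (a : ℝ) (n : ℤ) :
    ∫ x in (0 : ℝ)..L, cas (a + 2 * Real.pi * n / L * x) = if n = 0 then L * cas a else 0 := by
  split_ifs with hn
  · simp [hn]
  · have hn' : (n : ℝ) ≠ 0 := by exact_mod_cast hn
    set w : ℝ := 2 * Real.pi * n / L with hw
    have hw0 : w ≠ 0 := by positivity
    have hd : ∀ x ∈ uIcc 0 L, HasDerivAt (fun x => -(w⁻¹) * cas (-(a + w * x)))
        (cas (a + w * x)) x := by
      intro x _
      have h1 : HasDerivAt (fun x => -(a + w * x)) (-w) x := by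
        simpa using (((hasDerivAt_id x).const_mul w).const_add a).fun_neg
      have h := ((hasDerivAt_cas (-(a + w * x))).comp x h1).const_mul (-(w⁻¹))
      convert! h using 1
      rw [neg_neg]; field_simp
    rw [intervalIntegral.integral_eq_sub_of_hasDerivAt hd
      ((continuous_cas.comp (by fun_prop)).intervalIntegrable _ _)]
    have : -(a + w * 0) = -(a + w * L) + n * (2 * Real.pi) := by
      rw [hw]; field_simp; ring
    rw [this, cas_add_int_mul_two_pi]; ring

lemma integral_mode (hx : 0 < Lx) (hy : 0 < Ly) (k : ℤ × ℤ) :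
    ∫ p in rect Lx Ly, mode Lx Ly k p = if k = 0 then Lx * Ly else 0 := by
  rw [integral_rect hx.le hy.le (continuous_mode k)]
  have h1 : ∀ x, ∫ y in (0 : ℝ)..Ly, mode Lx Ly k (x, y) =
      if k.2 = 0 then Ly * cas (0 + 2 * Real.pi * k.1 / Lx * x) else 0 := fun x => by
    rw [zero_add, ← integral_cas hy]; simp [mode, wave]
  simp_rw [h1]
  by_cases h2 : k.2 = 0
  · simp only [h2, if_true, intervalIntegral.integral_const_mul, integral_cas hx]
    by_cases h3 : k.1 = 0
    · have : k = 0 := Prod.ext h3 h2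
      simp [this, cas, mul_comm]
    · have : k ≠ 0 := fun h => h3 (by simp [h])
      simp [this, h3]
  · have : k ≠ 0 := fun h => h2 (by simp [h])
    simp [h2, this]

lemma mode_mul_mode (k l : ℤ × ℤ) (p : ℝ × ℝ) :
    mode Lx Ly k p * mode Lx Ly l p =
      (mode Lx Ly (k - l) p + mode Lx Ly (-(k - l)) p) / 2 +
        (mode Lx Ly (k + l) p - mode Lx Ly (-(k + l)) p) / 2 := by
  rw [mode_neg, mode_neg]
  unfold mode
  rw [cas_neg, cas_neg]
  have e1 : wave Lx Ly (k - l) 0 * p.1 + wave Lx Ly (k - l) 1 * p.2 =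
      (wave Lx Ly k 0 * p.1 + wave Lx Ly k 1 * p.2) -
        (wave Lx Ly l 0 * p.1 + wave Lx Ly l 1 * p.2) := by
    simp only [sub_eq_add_neg, wave_add, wave_neg]; ring
  have e2 : wave Lx Ly (k + l) 0 * p.1 + wave Lx Ly (k + l) 1 * p.2 =
      (wave Lx Ly k 0 * p.1 + wave Lx Ly k 1 * p.2) +
        (wave Lx Ly l 0 * p.1 + wave Lx Ly l 1 * p.2) := by
    simp only [wave_add]; ring
  rw [e1, e2]
  generalize wave Lx Ly k 0 * p.1 + wave Lx Ly k 1 * p.2 = A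
  generalize wave Lx Ly l 0 * p.1 + wave Lx Ly l 1 * p.2 = B
  unfold cas
  rw [Real.cos_sub, Real.sin_sub, Real.cos_add, Real.sin_add]
  ring

/-- The modes are orthogonal, each of squared norm `Lx * Ly`. -/
lemma integral_mode_mul_mode (hx : 0 < Lx) (hy : 0 < Ly) (k l : ℤ × ℤ) :
    ∫ p in rect Lx Ly, mode Lx Ly k p * mode Lx Ly l p = if k = l then Lx * Ly else 0 := by
  have hi : ∀ k, IntegrableOn (mode Lx Ly k) (rect Lx Ly) :=
    fun k => integrable_of_continuous (continuous_mode k)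
  simp_rw [mode_mul_mode]
  have h1 := integral_add (((hi (k - l)).add (hi (-(k - l)))).div_const 2)
    (((hi (k + l)).sub (hi (-(k + l)))).div_const 2)
  simp only [Pi.add_apply, Pi.sub_apply] at h1
  rw [h1, integral_div, integral_div, integral_add (hi _) (hi _), integral_sub (hi _) (hi _)]
  simp only [integral_mode hx hy, neg_eq_zero, sub_eq_zero]
  split_ifs <;> ring

end

section

variable {Lx Ly : ℝ}

/-! ### Completeness of the modes -/

/-- The projection of the plane onto the unit torus which rescales the rectangle to a unit cell. -/
def toTorus (Lx Ly : ℝ) (p : ℝ × ℝ) : UnitAddTorus (Fin 2) :=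
  ![((p.1 / Lx : ℝ) : UnitAddCircle), ((p.2 / Ly : ℝ) : UnitAddCircle)]

/-- The section of `toTorus` with values in the half-open rectangle `(0, Lx] × (0, Ly]`. -/
def ofTorus (Lx Ly : ℝ) (z : UnitAddTorus (Fin 2)) : ℝ × ℝ :=
  (Lx * (AddCircle.equivIoc (1 : ℝ) 0 (z 0)).1, Ly * (AddCircle.equivIoc (1 : ℝ) 0 (z 1)).1)

lemma continuous_toTorus : Continuous (toTorus Lx Ly) := by
  unfold toTorus
  refine continuous_pi fun i => ?_
  fin_cases i
  · exact (AddCircle.continuous_mk' (1 : ℝ)).comp (continuous_fst.div_const Lx)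
  · exact (AddCircle.continuous_mk' (1 : ℝ)).comp (continuous_snd.div_const Ly)

lemma measurable_ofTorus : Measurable (ofTorus Lx Ly) := by
  have h : Measurable fun z : UnitAddCircle => (AddCircle.equivIoc (1 : ℝ) 0 z).1 :=
    measurable_subtype_coe.comp (AddCircle.measurableEquivIoc (1 : ℝ) 0).measurable
  have h' : ∀ i : Fin 2, Measurable fun z : UnitAddTorus (Fin 2) =>
      (AddCircle.equivIoc (1 : ℝ) 0 (z i)).1 := fun i => h.comp (measurable_pi_apply i)
  exact ((h' 0).const_mul Lx).prodMk ((h' 1).const_mul Ly)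

lemma ofTorus_toTorus {p : ℝ × ℝ} (hp : p ∈ rect Lx Ly) :
    ofTorus Lx Ly (toTorus Lx Ly p) = p := by
  have h : ∀ L s : ℝ, s ∈ Ioo 0 L →
      L * (AddCircle.equivIoc (1 : ℝ) 0 ((s / L : ℝ) : UnitAddCircle)).1 = s := by
    intro L s hs
    have hL : 0 < L := hs.1.trans hs.2
    rw [AddCircle.equivIoc_coe_of_mem]
    · field_simp
    · exact ⟨div_pos hs.1 hL, by rw [zero_add]; exact ((div_lt_one hL).2 hs.2).le⟩
  exact Prod.ext (h Lx p.1 hp.1) (h Ly p.2 hp.2)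

lemma mFourier_toTorus (n : Fin 2 → ℤ) (p : ℝ × ℝ) :
    UnitAddTorus.mFourier n (toTorus Lx Ly p) =
      ((mode Lx Ly (n 0, n 1) p + mode Lx Ly (-(n 0, n 1)) p) / 2 : ℝ) +
      ((mode Lx Ly (n 0, n 1) p - mode Lx Ly (-(n 0, n 1)) p) / 2 : ℝ) * Complex.I := by
  rw [mode_neg]
  unfold mode
  set θ := wave Lx Ly (n 0, n 1) 0 * p.1 + wave Lx Ly (n 0, n 1) 1 * p.2 with hθ
  rw [cas_neg]
  unfold cas
  have e1 : (Real.cos θ + Real.sin θ + (Real.cos θ - Real.sin θ)) / 2 = Real.cos θ := by ring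
  have e2 : (Real.cos θ + Real.sin θ - (Real.cos θ - Real.sin θ)) / 2 = Real.sin θ := by ring
  rw [e1, e2, Complex.ofReal_cos, Complex.ofReal_sin, ← Complex.exp_mul_I]
  simp only [UnitAddTorus.mFourier, ContinuousMap.coe_mk, Fin.prod_univ_two, toTorus,
    Matrix.cons_val_zero, Matrix.cons_val_one, fourier_coe_apply, ← Complex.exp_add]
  congr 1
  rw [hθ]
  simp only [wave, Fin.isValue, if_true, one_ne_zero, if_false]
  push_cast
  ring

/-- An integrable function on the rectangle which is orthogonal to all modes vanishes: its positive
and negative parts define measures on the torus against which trigonometric polynomials, hence all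
continuous functions, have the same integral. -/
theorem ae_eq_zero_of_integral_mul_mode {f : ℝ × ℝ → ℝ}
    (hf : Integrable f ((volume : Measure (ℝ × ℝ)).restrict (rect Lx Ly)))
    (h : ∀ k, ∫ p in rect Lx Ly, f p * mode Lx Ly k p = 0) :
    f =ᵐ[(volume : Measure (ℝ × ℝ)).restrict (rect Lx Ly)] 0 := by
  set μ := (volume : Measure (ℝ × ℝ)).restrict (rect Lx Ly) with hμ
  have hint : ∀ H : C(UnitAddTorus (Fin 2), ℂ),
      Integrable (fun p => (f p : ℂ) * H (toTorus Lx Ly p)) μ := fun H =>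
    (hf.ofReal (𝕜 := ℂ)).mul_bdd (c := ‖H‖)
      (H.continuous.comp continuous_toTorus).aestronglyMeasurable
      (Eventually.of_forall fun p => H.norm_coe_le_norm _)
  let Λ₀ : C(UnitAddTorus (Fin 2), ℂ) →ₗ[ℂ] ℂ :=
    { toFun := fun H => ∫ p, (f p : ℂ) * H (toTorus Lx Ly p) ∂μ
      map_add' := fun H K => by
        simp only [ContinuousMap.add_apply, mul_add]
        exact integral_add (hint H) (hint K)
      map_smul' := fun c H => by
        simp only [ContinuousMap.smul_apply, smul_eq_mul, RingHom.id_apply]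
        rw [← integral_const_mul]
        congr 1; funext p; ring }
  let Λ : C(UnitAddTorus (Fin 2), ℂ) →L[ℂ] ℂ := Λ₀.mkContinuous (∫ p, |f p| ∂μ) fun H => by
    change ‖∫ p, (f p : ℂ) * H (toTorus Lx Ly p) ∂μ‖ ≤ _
    rw [← integral_mul_const]
    refine (norm_integral_le_integral_norm _).trans
      (integral_mono (hint H).norm (hf.abs.mul_const _) fun p => ?_)
    simp only [norm_mul, Complex.norm_real, Real.norm_eq_abs]
    exact mul_le_mul_of_nonneg_left (H.norm_coe_le_norm _) (abs_nonneg _)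
  have hmode : ∀ k, Integrable (fun p => f p * mode Lx Ly k p) μ := fun k =>
    hf.mul_bdd (c := 3 / 2) (continuous_mode k).aestronglyMeasurable
      (Eventually.of_forall fun p => abs_mode_le k p)
  -- the functional vanishes on trigonometric polynomials, which are dense
  have hΛ : ∀ H, Λ H = 0 := by
    intro H
    have hle : Submodule.span ℂ (range (UnitAddTorus.mFourier (d := Fin 2))) ≤
        LinearMap.ker Λ.toLinearMap := by
      rw [Submodule.span_le]
      rintro _ ⟨n, rfl⟩
      change ∫ p, (f p : ℂ) * UnitAddTorus.mFourier n (toTorus Lx Ly p) ∂μ = 0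
      simp_rw [mFourier_toTorus]
      have : ∀ p, (f p : ℂ) *
          (((mode Lx Ly (n 0, n 1) p + mode Lx Ly (-(n 0, n 1)) p) / 2 : ℝ) +
          ((mode Lx Ly (n 0, n 1) p - mode Lx Ly (-(n 0, n 1)) p) / 2 : ℝ) * Complex.I) =
          (((f p * mode Lx Ly (n 0, n 1) p + f p * mode Lx Ly (-(n 0, n 1)) p) / 2 : ℝ) : ℂ) +
          (((f p * mode Lx Ly (n 0, n 1) p - f p * mode Lx Ly (-(n 0, n 1)) p) / 2 : ℝ) : ℂ)
            * Complex.I := by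
        intro p; push_cast; ring
      simp_rw [this]
      rw [integral_add, integral_mul_const, integral_complex_ofReal, integral_complex_ofReal,
        integral_div, integral_div, integral_add (hmode _) (hmode _),
        integral_sub (hmode _) (hmode _), h, h]
      · simp
      · exact (((hmode _).add (hmode _)).div_const 2).ofReal
      · exact ((((hmode _).sub (hmode _)).div_const 2).ofReal).mul_const _
    have hcl : IsClosed (LinearMap.ker Λ.toLinearMap : Set C(UnitAddTorus (Fin 2), ℂ)) :=
      Λ.isClosed_ker
    have h2 := Submodule.topologicalClosure_minimal _ hle hcl
    rw [UnitAddTorus.span_mFourier_closure_eq_top] at h2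
    exact h2 (Submodule.mem_top (x := H))
  -- the positive and the negative part of `f` as densities
  have hfin : ∀ g : ℝ × ℝ → ℝ, Integrable g μ →
      IsFiniteMeasure (μ.withDensity fun p => ENNReal.ofReal (g p)) := fun g hg =>
    isFiniteMeasure_withDensity_ofReal hg.2
  have := hfin f hf
  have := hfin _ hf.neg
  have hπ : Measurable (toTorus Lx Ly) := continuous_toTorus.measurable
  have hme : ∀ g : ℝ × ℝ → ℝ, Integrable g μ → ∀ H : BoundedContinuousFunction
      (UnitAddTorus (Fin 2)) ℝ,
      ∫ z, H z ∂(Measure.map (toTorus Lx Ly) (μ.withDensity fun p => ENNReal.ofReal (g p))) =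
      ∫ p, max (g p) 0 * H (toTorus Lx Ly p) ∂μ := by
    intro g hg H
    rw [integral_map hπ.aemeasurable H.continuous.aestronglyMeasurable,
      integral_withDensity_eq_integral_toReal_smul₀ hg.1.aemeasurable.ennreal_ofReal
        (Eventually.of_forall fun p => ENNReal.ofReal_lt_top)]
    simp only [ENNReal.toReal_ofReal', smul_eq_mul]
  -- their images on the torus agree, and `ofTorus` carries this back to the rectangle
  have heq : Measure.map (toTorus Lx Ly) (μ.withDensity fun p => ENNReal.ofReal (f p)) =
      Measure.map (toTorus Lx Ly) (μ.withDensity fun p => ENNReal.ofReal ((-f) p)) := by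
    refine ext_of_forall_integral_eq_of_IsFiniteMeasure fun H => ?_
    rw [hme f hf, hme _ hf.neg, ← sub_eq_zero]
    have hb : ∀ g : ℝ × ℝ → ℝ, Integrable g μ →
        Integrable (fun p => max (g p) 0 * H (toTorus Lx Ly p)) μ := fun g hg =>
      hg.pos_part.mul_bdd (c := ‖H‖) (H.continuous.comp continuous_toTorus).aestronglyMeasurable
        (Eventually.of_forall fun p => H.norm_coe_le_norm _)
    rw [← integral_sub (hb f hf) (hb _ hf.neg)]
    have h3 := hΛ ⟨fun z => (H z : ℂ), Complex.continuous_ofReal.comp H.continuous⟩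
    change ∫ p, (f p : ℂ) * ((H (toTorus Lx Ly p) : ℝ) : ℂ) ∂μ = 0 at h3
    simp_rw [← Complex.ofReal_mul] at h3
    rw [integral_complex_ofReal, Complex.ofReal_eq_zero] at h3
    refine Eq.trans ?_ h3
    congr 1; funext p
    rw [← sub_mul, Pi.neg_apply]
    congr 1
    rcases le_total 0 (f p) with h0 | h0
    · rw [max_eq_left h0, max_eq_right (by linarith)]; ring
    · rw [max_eq_right h0, max_eq_left (by linarith)]; ring
  have hback : ∀ g : ℝ × ℝ → ℝ,
      Measure.map (ofTorus Lx Ly) (Measure.map (toTorus Lx Ly)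
        (μ.withDensity fun p => ENNReal.ofReal (g p))) =
        μ.withDensity fun p => ENNReal.ofReal (g p) := by
    intro g
    rw [Measure.map_map measurable_ofTorus hπ]
    have : (ofTorus Lx Ly ∘ toTorus Lx Ly) =ᵐ[μ.withDensity fun p => ENNReal.ofReal (g p)] id := by
      refine (withDensity_absolutelyContinuous _ _).ae_le ?_
      exact (ae_restrict_mem measurableSet_rect).mono fun p hp => ofTorus_toTorus hp
    rw [Measure.map_congr this, Measure.map_id]
  have h4 := congrArg (Measure.map (ofTorus Lx Ly)) heq
  rw [hback, hback] at h4
  have hlt : ∫⁻ p, ENNReal.ofReal (f p) ∂μ < ⊤ := hf.lintegral_lt_top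
  have h5 := (withDensity_eq_iff hf.1.aemeasurable.ennreal_ofReal
    hf.neg.1.aemeasurable.ennreal_ofReal
    hlt.ne).1 h4
  filter_upwards [h5] with p hp
  have h6 := congrArg ENNReal.toReal hp
  simp only [ENNReal.toReal_ofReal', Pi.neg_apply] at h6
  change f p = 0
  rcases le_total 0 (f p) with h0 | h0
  · rwa [max_eq_left h0, max_eq_right (by linarith)] at h6
  · rw [max_eq_right h0, max_eq_left (by linarith)] at h6
    linarith

end

section

variable {Lx Ly : ℝ}

/-! ### Test functions -/

lemma pderiv_eq_fderiv {η : ℝ × ℝ → ℝ} (h : Differentiable ℝ η) (i : Fin 2) (p : ℝ × ℝ) :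
    pderiv i η p = fderiv ℝ η p (if i = 0 then (1, 0) else (0, 1)) := by
  have hp := (h p).hasFDerivAt
  unfold pderiv
  split_ifs
  · have h1 : HasDerivAt (fun s : ℝ => (s, p.2)) (1, 0) p.1 :=
      (hasDerivAt_id p.1).prodMk (hasDerivAt_const _ _)
    exact (hp.comp_hasDerivAt (f := fun s : ℝ => (s, p.2)) p.1 h1).deriv
  · have h1 : HasDerivAt (fun s : ℝ => (p.1, s)) (0, 1) p.2 :=
      (hasDerivAt_const _ _).prodMk (hasDerivAt_id p.2)
    exact (hp.comp_hasDerivAt (f := fun s : ℝ => (p.1, s)) p.2 h1).deriv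

namespace IsTest

variable {η ξ : ℝ × ℝ → ℝ}

lemma continuous (h : IsTest Lx Ly η) : Continuous η := h.smooth.continuous

lemma differentiable (h : IsTest Lx Ly η) : Differentiable ℝ η :=
  h.smooth.differentiable (by simp)

lemma pderiv (h : IsTest Lx Ly η) (i : Fin 2) : IsTest Lx Ly (pderiv i η) := by
  refine ⟨?_, fun x y => ?_, fun x y => ?_⟩
  · have : ThinKS.pderiv i η =
        fun p => fderiv ℝ η p (if i = 0 then (1, 0) else (0, 1)) :=
      funext fun p => pderiv_eq_fderiv h.differentiable i p
    rw [this]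
    exact (h.smooth.fderiv_right (m := ∞) (by simp)).clm_apply contDiff_const
  · unfold ThinKS.pderiv
    split_ifs
    · simp only
      rw [← deriv_comp_add_const (f := fun s => η (s, y))]
      simp only [h.periodic_x]
    · simp only [h.periodic_x]
  · unfold ThinKS.pderiv
    split_ifs
    · simp only [h.periodic_y]
    · simp only
      rw [← deriv_comp_add_const (f := fun s => η (x, s))]
      simp only [h.periodic_y]

lemma add (h : IsTest Lx Ly η) (h' : IsTest Lx Ly ξ) : IsTest Lx Ly (fun p => η p + ξ p) :=
  ⟨h.smooth.add h'.smooth, fun x y => by simp only [h.periodic_x, h'.periodic_x],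
    fun x y => by simp only [h.periodic_y, h'.periodic_y]⟩

lemma const_mul (h : IsTest Lx Ly η) (c : ℝ) : IsTest Lx Ly (fun p => c * η p) :=
  ⟨contDiff_const.mul h.smooth, fun x y => by simp only [h.periodic_x],
    fun x y => by simp only [h.periodic_y]⟩

lemma lap (h : IsTest Lx Ly η) : IsTest Lx Ly (lap η) :=
  ((h.pderiv 0).pderiv 0).add ((h.pderiv 1).pderiv 1)

end IsTest

/-! ### Square integrable fields -/

/-- Lebesgue measure on the rectangle. -/
abbrev rectMeasure (Lx Ly : ℝ) : Measure (ℝ × ℝ) := volume.restrict (rect Lx Ly)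

/-- A continuous planar vector field, as an element of `L²` of the rectangle. -/
def fieldLp (Lx Ly : ℝ) (ζ : ℝ × ℝ → EuclideanSpace ℝ (Fin 2)) (hζ : Continuous ζ) :
    L2Field Lx Ly :=
  (memLp_of_continuous hζ 2).toLp ζ

lemma coeFn_fieldLp {ζ : ℝ × ℝ → EuclideanSpace ℝ (Fin 2)} (hζ : Continuous ζ) :
    (fieldLp Lx Ly ζ hζ : ℝ × ℝ → EuclideanSpace ℝ (Fin 2)) =ᵐ[rectMeasure Lx Ly] ζ :=
  MemLp.coeFn_toLp _

lemma memLp_comp (u : L2Field Lx Ly) (i : Fin 2) : MemLp (fun p => u p i) 2 (rectMeasure Lx Ly) :=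
  (Lp.memLp u).continuousLinearMap_comp (EuclideanSpace.proj (𝕜 := ℝ) i)

lemma integrable_comp (u : L2Field Lx Ly) (i : Fin 2) :
    Integrable (fun p => u p i) (rectMeasure Lx Ly) :=
  (memLp_comp u i).integrable one_le_two

lemma integrable_comp_mul (u : L2Field Lx Ly) (i : Fin 2) {η : ℝ × ℝ → ℝ} (hη : Continuous η) :
    Integrable (fun p => u p i * η p) (rectMeasure Lx Ly) :=
  (memLp_comp u i).integrable_mul (memLp_of_continuous hη 2)

lemma inner_fieldLp {ζ : ℝ × ℝ → EuclideanSpace ℝ (Fin 2)} (hζ : Continuous ζ)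
    (u : L2Field Lx Ly) :
    inner ℝ (fieldLp Lx Ly ζ hζ) u = ∫ p in rect Lx Ly, (u p 0 * ζ p 0 + u p 1 * ζ p 1) := by
  rw [L2.inner_def]
  refine integral_congr_ae ?_
  filter_upwards [coeFn_fieldLp hζ] with p hp
  rw [hp]
  simp [PiLp.inner_apply]

lemma integrable_normSq (u : L2Field Lx Ly) : Integrable (fun p => ‖u p‖ ^ 2) (rectMeasure Lx Ly) :=
  (Lp.memLp u).integrable_norm_pow (by norm_num)

lemma integral_normSq (u : L2Field Lx Ly) : ∫ p in rect Lx Ly, ‖u p‖ ^ 2 = ‖u‖ ^ 2 := by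
  rw [← real_inner_self_eq_norm_sq u, L2.inner_def]
  simp only [real_inner_self_eq_norm_sq]

lemma integrable_normSq_mul (u : L2Field Lx Ly) {d : ℝ × ℝ → ℝ} (hd : Continuous d) :
    Integrable (fun p => ‖u p‖ ^ 2 * d p) (rectMeasure Lx Ly) := by
  obtain ⟨C, hC⟩ := (isCompact_Icc.prod isCompact_Icc :
    IsCompact (Icc (0 : ℝ) Lx ×ˢ Icc (0 : ℝ) Ly)).exists_bound_of_continuousOn hd.continuousOn
  refine (integrable_normSq u).mul_bdd (c := C) hd.aestronglyMeasurable ?_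
  refine (ae_restrict_mem measurableSet_rect).mono fun p hp => hC p ?_
  exact ⟨Ioo_subset_Icc_self hp.1, Ioo_subset_Icc_self hp.2⟩

/-- The quadratic nonlinearity, tested against a bounded function, is locally Lipschitz on `L²`. -/
lemma abs_integral_normSq_mul_sub_le (u v : L2Field Lx Ly) {d : ℝ × ℝ → ℝ} (hd : Continuous d)
    {M : ℝ} (hM : ∀ p, |d p| ≤ M) :
    |(∫ p in rect Lx Ly, ‖u p‖ ^ 2 * d p) - ∫ p in rect Lx Ly, ‖v p‖ ^ 2 * d p| ≤
      M * (‖u - v‖ * (‖u‖ + ‖v‖)) := by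
  have hM0 : 0 ≤ M := (abs_nonneg _).trans (hM 0)
  rw [← integral_sub (integrable_normSq_mul u hd) (integrable_normSq_mul v hd)]
  have h1 : ∀ᵐ p ∂rectMeasure Lx Ly, ‖‖u p‖ ^ 2 * d p - ‖v p‖ ^ 2 * d p‖ ≤
      M * (‖(u - v) p‖ * ‖u p‖ + ‖(u - v) p‖ * ‖v p‖) := by
    filter_upwards [Lp.coeFn_sub u v] with p hp
    rw [hp, Pi.sub_apply, ← sub_mul, norm_mul, Real.norm_eq_abs, Real.norm_eq_abs, mul_comm]
    refine mul_le_mul (hM p) ?_ (abs_nonneg _) hM0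
    have : ‖u p‖ ^ 2 - ‖v p‖ ^ 2 = (‖u p‖ - ‖v p‖) * (‖u p‖ + ‖v p‖) := by ring
    rw [this, abs_mul, abs_of_nonneg (add_nonneg (norm_nonneg (u p)) (norm_nonneg (v p))),
      ← mul_add]
    exact mul_le_mul_of_nonneg_right (abs_norm_sub_norm_le _ _) (by positivity)
  have hmul : ∀ w z : L2Field Lx Ly, Integrable (fun p => ‖w p‖ * ‖z p‖) (rectMeasure Lx Ly) :=
    fun w z => (Lp.memLp w).norm.integrable_mul (Lp.memLp z).norm
  have hcs : ∀ w z : L2Field Lx Ly, ∫ p in rect Lx Ly, ‖w p‖ * ‖z p‖ ≤ ‖w‖ * ‖z‖ := by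
    intro w z
    have h := integral_mul_le_Lp_mul_Lq_of_nonneg (μ := rectMeasure Lx Ly) (p := 2) (q := 2)
      Real.HolderConjugate.two_two (f := fun p => ‖w p‖) (g := fun p => ‖z p‖)
      (Eventually.of_forall fun _ => norm_nonneg _) (Eventually.of_forall fun _ => norm_nonneg _)
      (by simpa using (Lp.memLp w).norm) (by simpa using (Lp.memLp z).norm)
    simp only [Real.rpow_two, integral_normSq, ← Real.sqrt_eq_rpow,
      Real.sqrt_sq (norm_nonneg _)] at h
    exact h
  calc |∫ p in rect Lx Ly, (‖u p‖ ^ 2 * d p - ‖v p‖ ^ 2 * d p)|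
      ≤ ∫ p in rect Lx Ly, M * (‖(u - v) p‖ * ‖u p‖ + ‖(u - v) p‖ * ‖v p‖) :=
        norm_integral_le_of_norm_le (((hmul _ _).add (hmul _ _)).const_mul M) h1
    _ = M * ((∫ p in rect Lx Ly, ‖(u - v) p‖ * ‖u p‖) +
          ∫ p in rect Lx Ly, ‖(u - v) p‖ * ‖v p‖) := by
        rw [integral_const_mul, integral_add (hmul _ _) (hmul _ _)]
    _ ≤ M * (‖u - v‖ * (‖u‖ + ‖v‖)) := by
        rw [mul_add ‖u - v‖]
        exact mul_le_mul_of_nonneg_left (add_le_add (hcs _ _) (hcs _ _)) hM0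

lemma continuous_integral_normSq_mul {d : ℝ × ℝ → ℝ} (hd : Continuous d)
    {M : ℝ} (hM : ∀ p, |d p| ≤ M) :
    Continuous fun u : L2Field Lx Ly => ∫ p in rect Lx Ly, ‖u p‖ ^ 2 * d p := by
  rw [continuous_iff_continuousAt]
  intro u
  rw [ContinuousAt, tendsto_iff_norm_sub_tendsto_zero]
  have h : Tendsto (fun v : L2Field Lx Ly => M * (‖v - u‖ * (‖v‖ + ‖u‖))) (nhds u)
      (nhds (M * (‖u - u‖ * (‖u‖ + ‖u‖)))) := by
    apply Continuous.tendsto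
    fun_prop
  rw [sub_self, norm_zero, zero_mul, mul_zero] at h
  exact squeeze_zero (fun _ => norm_nonneg _)
    (fun v => abs_integral_normSq_mul_sub_le v u hd hM) h

lemma abs_integral_normSq_mul_le (u : L2Field Lx Ly) {d : ℝ × ℝ → ℝ} (hd : Continuous d)
    {M : ℝ} (hM : ∀ p, |d p| ≤ M) :
    |∫ p in rect Lx Ly, ‖u p‖ ^ 2 * d p| ≤ M * ‖u‖ ^ 2 := by
  have h := abs_integral_normSq_mul_sub_le u 0 hd hM
  have h0 : ∫ p in rect Lx Ly, ‖(0 : L2Field Lx Ly) p‖ ^ 2 * d p = 0 := by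
    refine integral_eq_zero_of_ae ?_
    filter_upwards [Lp.coeFn_zero (EuclideanSpace ℝ (Fin 2)) 2 (rectMeasure Lx Ly)] with p hp
    rw [hp]
    simp
  rw [h0] at h
  simpa [sq] using h

lemma continuous_integral_comp_mul (i : Fin 2) {η : ℝ × ℝ → ℝ} (hη : Continuous η) :
    Continuous fun u : L2Field Lx Ly => ∫ p in rect Lx Ly, u p i * η p := by
  have hc : Continuous fun p => EuclideanSpace.single i (η p) :=
    (PiLp.continuous_toLp 2 _).comp (continuous_pi fun j => by
      by_cases h : j = i
      · subst h; simpa using hη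
      · simpa [Pi.single_apply, h] using continuous_const)
  have : (fun u : L2Field Lx Ly => ∫ p in rect Lx Ly, u p i * η p) =
      fun u => inner ℝ (fieldLp Lx Ly _ hc) u := by
    funext u
    rw [inner_fieldLp]
    congr 1; funext p
    fin_cases i <;> simp
  rw [this]
  fun_prop

end

section

variable {Lx Ly : ℝ}

/-! ### Integration by parts -/

lemma integral_rect_swap (hx : 0 ≤ Lx) (hy : 0 ≤ Ly) {f : ℝ × ℝ → ℝ} (hf : Continuous f) :
    ∫ p in rect Lx Ly, f p = ∫ y in (0 : ℝ)..Ly, ∫ x in (0 : ℝ)..Lx, f (x, y) := by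
  rw [intervalIntegral.integral_of_le hy, integral_Ioc_eq_integral_Ioo]
  simp_rw [intervalIntegral.integral_of_le hx, integral_Ioc_eq_integral_Ioo]
  have h := integrable_of_continuous (Lx := Lx) (Ly := Ly) hf
  rw [restrict_rect] at h ⊢
  exact integral_prod_symm _ h

/-- There are no boundary terms: the opposite sides of the rectangle cancel by periodicity. -/
lemma IsTest.integral_pderiv {η : ℝ × ℝ → ℝ} (hx : 0 ≤ Lx) (hy : 0 ≤ Ly) (h : IsTest Lx Ly η)
    (i : Fin 2) : ∫ p in rect Lx Ly, ThinKS.pderiv i η p = 0 := by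
  have hc := (h.pderiv i).continuous
  by_cases hi : i = 0
  · subst hi
    rw [integral_rect_swap hx hy hc]
    have : ∀ y : ℝ, ∫ x in (0 : ℝ)..Lx, ThinKS.pderiv 0 η (x, y) = 0 := by
      intro y
      have hd : ∀ x ∈ uIcc 0 Lx,
          HasDerivAt (fun s => η (s, y)) (ThinKS.pderiv 0 η (x, y)) x := by
        intro x _
        have : DifferentiableAt ℝ (fun s => η (s, y)) x :=
          (h.differentiable (x, y)).comp (f := fun s : ℝ => (s, y)) x
            (differentiableAt_id.prodMk (differentiableAt_const _))
        simpa [ThinKS.pderiv] using this.hasDerivAt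
      rw [intervalIntegral.integral_eq_sub_of_hasDerivAt hd
        ((hc.comp (by fun_prop : Continuous fun x : ℝ => (x, y))).intervalIntegrable _ _)]
      have := h.periodic_x 0 y
      rw [zero_add] at this
      simp [this]
    simp [this]
  · have hi : i = 1 := by omega
    subst hi
    rw [integral_rect hx hy hc]
    have : ∀ x : ℝ, ∫ y in (0 : ℝ)..Ly, ThinKS.pderiv 1 η (x, y) = 0 := by
      intro x
      have hd : ∀ y ∈ uIcc 0 Ly,
          HasDerivAt (fun s => η (x, s)) (ThinKS.pderiv 1 η (x, y)) y := by
        intro y _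
        have : DifferentiableAt ℝ (fun s => η (x, s)) y :=
          (h.differentiable (x, y)).comp (f := fun s : ℝ => (x, s)) y
            ((differentiableAt_const _).prodMk differentiableAt_id)
        simpa [ThinKS.pderiv] using this.hasDerivAt
      rw [intervalIntegral.integral_eq_sub_of_hasDerivAt hd
        ((hc.comp (by fun_prop : Continuous fun y : ℝ => (x, y))).intervalIntegrable _ _)]
      have := h.periodic_y x 0
      rw [zero_add] at this
      simp [this]
    simp [this]

lemma IsTest.mul {η ξ : ℝ × ℝ → ℝ} (h : IsTest Lx Ly η) (h' : IsTest Lx Ly ξ) :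
    IsTest Lx Ly (fun p => η p * ξ p) :=
  ⟨h.smooth.mul h'.smooth, fun x y => by simp only [h.periodic_x, h'.periodic_x],
    fun x y => by simp only [h.periodic_y, h'.periodic_y]⟩

lemma IsTest.pderiv_mul {η ξ : ℝ × ℝ → ℝ} (h : IsTest Lx Ly η) (h' : IsTest Lx Ly ξ)
    (i : Fin 2) (p : ℝ × ℝ) : ThinKS.pderiv i (fun p => η p * ξ p) p =
      ThinKS.pderiv i η p * ξ p + η p * ThinKS.pderiv i ξ p := by
  rw [pderiv_eq_fderiv (h.mul h').differentiable, pderiv_eq_fderiv h.differentiable,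
    pderiv_eq_fderiv h'.differentiable, fderiv_fun_mul (h.differentiable p) (h'.differentiable p)]
  simp
  ring

lemma IsTest.integral_mul_pderiv {η ξ : ℝ × ℝ → ℝ} (hx : 0 ≤ Lx) (hy : 0 ≤ Ly)
    (h : IsTest Lx Ly η) (h' : IsTest Lx Ly ξ) (i : Fin 2) :
    ∫ p in rect Lx Ly, η p * ThinKS.pderiv i ξ p =
      -∫ p in rect Lx Ly, ThinKS.pderiv i η p * ξ p := by
  have h0 := (h.mul h').integral_pderiv hx hy i
  simp_rw [h.pderiv_mul h'] at h0
  rw [integral_add (integrable_of_continuous ((h.pderiv i).mul h').continuous)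
    (integrable_of_continuous (h.mul (h'.pderiv i)).continuous)] at h0
  linarith

/-! ### The gradient modes -/

/-- The coefficients of the unit vector along the wave vector, divided by the square root of the
area. -/
def dirCoeff (Lx Ly : ℝ) (k : ℤ × ℤ) (i : Fin 2) : ℝ :=
  wave Lx Ly k i / (√(waveSq Lx Ly k) * √(Lx * Ly))

/-- The normalised gradient field with wave vector `κ`. For `k ≠ 0` these fields are an
orthonormal basis of the mean-zero curl-free square integrable fields, and eigenfunctions of the
linear part of the equation. -/
def gradMode (Lx Ly : ℝ) (k : ℤ × ℤ) (p : ℝ × ℝ) : EuclideanSpace ℝ (Fin 2) :=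
  WithLp.toLp 2 fun i => dirCoeff Lx Ly k i * mode Lx Ly k p

/-- The divergence of `gradMode`; differentiation reflects the mode. -/
def divMode (Lx Ly : ℝ) (k : ℤ × ℤ) (p : ℝ × ℝ) : ℝ :=
  √(waveSq Lx Ly k) / √(Lx * Ly) * mode Lx Ly (-k) p

lemma continuous_gradMode (k : ℤ × ℤ) : Continuous (gradMode Lx Ly k) :=
  (PiLp.continuous_toLp 2 _).comp (continuous_pi fun _ => by fun_prop)

@[fun_prop]
lemma continuous_divMode (k : ℤ × ℤ) : Continuous (divMode Lx Ly k) := by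
  unfold divMode; fun_prop

/-- The gradient mode as an element of `L²`. -/
def gradModeLp (Lx Ly : ℝ) (k : ℤ × ℤ) : L2Field Lx Ly :=
  fieldLp Lx Ly (gradMode Lx Ly k) (continuous_gradMode k)

lemma dirCoeff_mul_wave (hx : 0 < Lx) (hy : 0 < Ly) {k : ℤ × ℤ} (hk : k ≠ 0) :
    dirCoeff Lx Ly k 0 * wave Lx Ly k 0 + dirCoeff Lx Ly k 1 * wave Lx Ly k 1 =
      √(waveSq Lx Ly k) / √(Lx * Ly) := by
  have h := waveSq_pos hx hy hk
  have h1 : 0 < √(waveSq Lx Ly k) := Real.sqrt_pos.2 h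
  have h2 : 0 < √(Lx * Ly) := Real.sqrt_pos.2 (by positivity)
  unfold dirCoeff
  field_simp
  rw [Real.sq_sqrt h.le]; rfl

lemma dirCoeff_sq (hx : 0 < Lx) (hy : 0 < Ly) {k : ℤ × ℤ} (hk : k ≠ 0) :
    dirCoeff Lx Ly k 0 ^ 2 + dirCoeff Lx Ly k 1 ^ 2 = 1 / (Lx * Ly) := by
  have h := waveSq_pos hx hy hk
  have h2 : 0 < Lx * Ly := by positivity
  unfold dirCoeff
  rw [div_pow, div_pow, mul_pow, Real.sq_sqrt h.le, Real.sq_sqrt h2.le]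
  field_simp
  rfl

/-- A wave component is recovered from the unit vector and the length of the wave vector. -/
lemma wave_eq_dirCoeff (hx : 0 < Lx) (hy : 0 < Ly) {k : ℤ × ℤ} (hk : k ≠ 0) (i : Fin 2) :
    wave Lx Ly k i = dirCoeff Lx Ly k i * (√(waveSq Lx Ly k) * √(Lx * Ly)) := by
  have h1 : 0 < √(waveSq Lx Ly k) := Real.sqrt_pos.2 (waveSq_pos hx hy hk)
  have h2 : 0 < √(Lx * Ly) := Real.sqrt_pos.2 (by positivity)
  unfold dirCoeff
  field_simp

lemma abs_divMode_le (k : ℤ × ℤ) (p : ℝ × ℝ) :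
    |divMode Lx Ly k p| ≤ √(waveSq Lx Ly k) / √(Lx * Ly) * (3 / 2) := by
  unfold divMode
  rw [abs_mul, abs_of_nonneg (by positivity)]
  exact mul_le_mul_of_nonneg_left (abs_mode_le _ _) (by positivity)

/-- The coefficient of a field along a gradient mode. -/
def gradCoeff (k : ℤ × ℤ) (u : L2Field Lx Ly) : ℝ := inner ℝ (gradModeLp Lx Ly k) u

lemma gradCoeff_eq (k : ℤ × ℤ) (u : L2Field Lx Ly) :
    gradCoeff k u = dirCoeff Lx Ly k 0 * (∫ p in rect Lx Ly, u p 0 * mode Lx Ly k p) +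
      dirCoeff Lx Ly k 1 * ∫ p in rect Lx Ly, u p 1 * mode Lx Ly k p := by
  unfold gradCoeff gradModeLp
  rw [inner_fieldLp, ← integral_const_mul, ← integral_const_mul, ← integral_add
    ((integrable_comp_mul u 0 (continuous_mode k)).const_mul _)
    ((integrable_comp_mul u 1 (continuous_mode k)).const_mul _)]
  congr 1; funext p
  simp [gradMode]
  ring

lemma integral_gradModeLp_mul (k : ℤ × ℤ) (i : Fin 2) (η : ℝ × ℝ → ℝ) :
    ∫ p in rect Lx Ly, gradModeLp Lx Ly k p i * η p =
      dirCoeff Lx Ly k i * ∫ p in rect Lx Ly, mode Lx Ly k p * η p := by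
  rw [← integral_const_mul]
  refine integral_congr_ae ?_
  filter_upwards [coeFn_fieldLp (continuous_gradMode (Lx := Lx) (Ly := Ly) k)] with p hp
  have : gradModeLp Lx Ly k p = gradMode Lx Ly k p := hp
  rw [this]
  simp [gradMode, mul_assoc]

lemma inner_gradModeLp (hx : 0 < Lx) (hy : 0 < Ly) {k l : ℤ × ℤ} (hk : k ≠ 0) :
    inner ℝ (gradModeLp Lx Ly k) (gradModeLp Lx Ly l) = if k = l then (1 : ℝ) else 0 := by
  have h := gradCoeff_eq k (gradModeLp Lx Ly l)
  rw [gradCoeff, integral_gradModeLp_mul, integral_gradModeLp_mul,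
    integral_mode_mul_mode hx hy] at h
  rw [h]
  by_cases hkl : k = l
  · subst hkl
    have := dirCoeff_sq hx hy hk
    simp only [if_true]
    have h2 : Lx * Ly ≠ 0 := by positivity
    field_simp at this
    linarith
  · simp [hkl, Ne.symm hkl]

/-! ### The space of mean-zero curl-free fields -/

lemma meanZero_gradModeLp (hx : 0 < Lx) (hy : 0 < Ly) {k : ℤ × ℤ} (hk : k ≠ 0) :
    MeanZero (gradModeLp Lx Ly k) := by
  intro i
  have h := integral_gradModeLp_mul (Lx := Lx) (Ly := Ly) k i (fun _ => 1)
  simp only [mul_one, integral_mode hx hy, hk, if_false, mul_zero] at h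
  exact h

lemma curlFree_gradModeLp (hx : 0 < Lx) (hy : 0 < Ly) (k : ℤ × ℤ) :
    CurlFree (gradModeLp Lx Ly k) := by
  intro η hη
  have hm := isTest_mode hx.ne' hy.ne' k
  rw [integral_sub (integrable_comp_mul _ 1 (hη.pderiv 0).continuous)
    (integrable_comp_mul _ 0 (hη.pderiv 1).continuous), integral_gradModeLp_mul,
    integral_gradModeLp_mul, hm.integral_mul_pderiv hx.le hy.le hη,
    hm.integral_mul_pderiv hx.le hy.le hη, pderiv_mode, pderiv_mode]
  simp only [mul_assoc, integral_const_mul, dirCoeff]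
  ring

/-- The closed subspace of mean-zero curl-free fields, that is, of periodic gradients. -/
def potentialFields (Lx Ly : ℝ) : Submodule ℝ (L2Field Lx Ly) where
  carrier := {u | MeanZero u ∧ CurlFree u}
  zero_mem' := by
    have h : ∀ i : Fin 2, (fun p => (0 : L2Field Lx Ly) p i) =ᵐ[rectMeasure Lx Ly] 0 := fun i => by
      filter_upwards [Lp.coeFn_zero (EuclideanSpace ℝ (Fin 2)) 2 (rectMeasure Lx Ly)] with p hp
      rw [hp]; simp
    refine ⟨fun i => integral_eq_zero_of_ae (h i), fun η _ => integral_eq_zero_of_ae ?_⟩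
    filter_upwards [h 0, h 1] with p h0 h1
    rw [h0, h1]; simp
  add_mem' := by
    rintro u v ⟨hu, hu'⟩ ⟨hv, hv'⟩
    have h := Lp.coeFn_add u v
    refine ⟨fun i => ?_, fun η hη => ?_⟩
    · rw [integral_congr_ae (g := fun p => u p i + v p i), integral_add (integrable_comp u i)
        (integrable_comp v i), hu i, hv i, add_zero]
      filter_upwards [h] with p hp
      rw [hp]; simp
    · have hi : ∀ w : L2Field Lx Ly, Integrable
          (fun p => w p 1 * pderiv 0 η p - w p 0 * pderiv 1 η p) (rectMeasure Lx Ly) := fun w =>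
        (integrable_comp_mul w 1 (hη.pderiv 0).continuous).sub
          (integrable_comp_mul w 0 (hη.pderiv 1).continuous)
      rw [integral_congr_ae (g := fun p => (u p 1 * pderiv 0 η p - u p 0 * pderiv 1 η p) +
        (v p 1 * pderiv 0 η p - v p 0 * pderiv 1 η p)), integral_add (hi u) (hi v), hu' η hη,
        hv' η hη, add_zero]
      filter_upwards [h] with p hp
      rw [hp]; simp; ring
  smul_mem' := by
    rintro c u ⟨hu, hu'⟩
    have h := Lp.coeFn_smul c u
    refine ⟨fun i => ?_, fun η hη => ?_⟩
    · rw [integral_congr_ae (g := fun p => c * u p i), integral_const_mul, hu i, mul_zero]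
      filter_upwards [h] with p hp
      rw [hp]; simp
    · rw [integral_congr_ae (g := fun p => c * (u p 1 * pderiv 0 η p - u p 0 * pderiv 1 η p)),
        integral_const_mul, hu' η hη, mul_zero]
      filter_upwards [h] with p hp
      rw [hp]; simp; ring

lemma mem_potentialFields {u : L2Field Lx Ly} :
    u ∈ potentialFields Lx Ly ↔ MeanZero u ∧ CurlFree u := Iff.rfl

lemma isClosed_potentialFields : IsClosed (potentialFields Lx Ly : Set (L2Field Lx Ly)) := by
  have : (potentialFields Lx Ly : Set (L2Field Lx Ly)) =
      (⋂ i : Fin 2, {u | ∫ p in rect Lx Ly, u p i * 1 = 0}) ∩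
      ⋂ (η : ℝ × ℝ → ℝ) (_ : IsTest Lx Ly η),
        {u | (∫ p in rect Lx Ly, u p 1 * pderiv 0 η p) -
          ∫ p in rect Lx Ly, u p 0 * pderiv 1 η p = 0} := by
    ext u
    simp only [SetLike.mem_coe, mem_potentialFields, MeanZero, CurlFree, mem_inter_iff, mem_iInter,
      mem_ofPred_eq, mul_one]
    refine and_congr_right fun _ => forall₂_congr fun η hη => ?_
    rw [integral_sub (integrable_comp_mul u 1 (hη.pderiv 0).continuous)
      (integrable_comp_mul u 0 (hη.pderiv 1).continuous)]
  rw [this]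
  refine IsClosed.inter (isClosed_iInter fun i => ?_)
    (isClosed_iInter fun η => isClosed_iInter fun hη => ?_)
  · exact isClosed_singleton.preimage
      (continuous_integral_comp_mul i (continuous_const (y := (1 : ℝ))))
  · exact isClosed_singleton.preimage
      ((continuous_integral_comp_mul 1 (hη.pderiv 0).continuous).sub
        (continuous_integral_comp_mul 0 (hη.pderiv 1).continuous))

instance : CompleteSpace (potentialFields Lx Ly) :=
  isClosed_potentialFields.completeSpace_coe

/-- For a curl-free field, the scalar Fourier coefficients of both components are multiples of its
coefficient along the gradient mode. -/
lemma CurlFree.integral_mul_mode (hx : 0 < Lx) (hy : 0 < Ly) {u : L2Field Lx Ly}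
    (hu : CurlFree u) {k : ℤ × ℤ} (hk : k ≠ 0) (i : Fin 2) :
    ∫ p in rect Lx Ly, u p i * mode Lx Ly k p = Lx * Ly * dirCoeff Lx Ly k i * gradCoeff k u := by
  have h1 := hu (mode Lx Ly (-k)) (isTest_mode hx.ne' hy.ne' (-k))
  rw [integral_sub
    (integrable_comp_mul u 1 ((isTest_mode hx.ne' hy.ne' (-k)).pderiv 0).continuous)
    (integrable_comp_mul u 0 ((isTest_mode hx.ne' hy.ne' (-k)).pderiv 1).continuous)] at h1
  simp only [pderiv_mode, neg_neg, wave_neg, mul_left_comm _ (-wave Lx Ly k _),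
    integral_const_mul] at h1
  rw [wave_eq_dirCoeff hx hy hk 0, wave_eq_dirCoeff hx hy hk 1] at h1
  have hs : √(waveSq Lx Ly k) * √(Lx * Ly) ≠ 0 :=
    (mul_pos (Real.sqrt_pos.2 (waveSq_pos hx hy hk)) (Real.sqrt_pos.2 (by positivity))).ne'
  have h3 := dirCoeff_sq hx hy hk
  rw [gradCoeff_eq]
  set A := ∫ p in rect Lx Ly, u p 0 * mode Lx Ly k p
  set B := ∫ p in rect Lx Ly, u p 1 * mode Lx Ly k p
  set a := dirCoeff Lx Ly k 0
  set b := dirCoeff Lx Ly k 1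
  have h4 : a * B = b * A := by
    have : (√(waveSq Lx Ly k) * √(Lx * Ly)) * (a * B - b * A) = 0 := by linarith
    have := (mul_eq_zero.1 this).resolve_left hs
    linarith
  have h5 : Lx * Ly * (a ^ 2 + b ^ 2) = 1 := by rw [h3]; field_simp
  fin_cases i
  · change A = Lx * Ly * a * (a * A + b * B)
    linear_combination (-A) * h5 - Lx * Ly * b * h4
  · change B = Lx * Ly * b * (a * A + b * B)
    linear_combination (-B) * h5 + Lx * Ly * a * h4

/-- The gradient modes are complete among the mean-zero curl-free fields. -/
lemma eq_zero_of_gradCoeff (hx : 0 < Lx) (hy : 0 < Ly) {u : L2Field Lx Ly}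
    (hu : u ∈ potentialFields Lx Ly) (h : ∀ k, k ≠ 0 → gradCoeff k u = 0) : u = 0 := by
  have hz : ∀ i : Fin 2, (fun p => u p i) =ᵐ[rectMeasure Lx Ly] 0 := by
    intro i
    refine ae_eq_zero_of_integral_mul_mode (integrable_comp u i) fun k => ?_
    by_cases hk : k = 0
    · subst hk
      simp only [mode_zero, mul_one]
      exact hu.1 i
    · rw [hu.2.integral_mul_mode hx hy hk, h k hk, mul_zero]
  rw [Lp.eq_zero_iff_ae_eq_zero]
  filter_upwards [hz 0, hz 1] with p h0 h1
  ext i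
  fin_cases i
  · exact h0
  · exact h1

/-- The orthonormal basis of gradient modes. -/
def gradBasis (hx : 0 < Lx) (hy : 0 < Ly) :
    HilbertBasis {k : ℤ × ℤ // k ≠ 0} ℝ (potentialFields Lx Ly) :=
  HilbertBasis.mkOfOrthogonalEqBot
    (v := fun k => ⟨gradModeLp Lx Ly k, meanZero_gradModeLp hx hy k.2, curlFree_gradModeLp hx hy k⟩)
    (by
      rw [orthonormal_iff_ite]
      rintro ⟨k, hk⟩ ⟨l, hl⟩
      simp only [Submodule.coe_inner, inner_gradModeLp hx hy hk, Subtype.mk.injEq])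
    (by
      rw [Submodule.eq_bot_iff]
      rintro ⟨u, hu⟩ h
      ext1
      refine eq_zero_of_gradCoeff hx hy hu fun k hk => ?_
      exact (Submodule.mem_orthogonal _ _).1 h _ (Submodule.subset_span ⟨⟨k, hk⟩, rfl⟩))

/-- Parseval's identity. -/
lemma hasSum_gradCoeff_sq (hx : 0 < Lx) (hy : 0 < Ly) {u : L2Field Lx Ly}
    (hu : u ∈ potentialFields Lx Ly) :
    HasSum (fun k : {k : ℤ × ℤ // k ≠ 0} => gradCoeff (k : ℤ × ℤ) u ^ 2) (‖u‖ ^ 2) := by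
  have h := (gradBasis hx hy).hasSum_inner_mul_inner ⟨u, hu⟩ ⟨u, hu⟩
  rw [real_inner_self_eq_norm_sq, Submodule.coe_norm] at h
  convert! h using 2 with k
  have : ((gradBasis hx hy k : potentialFields Lx Ly) : L2Field Lx Ly) = gradModeLp Lx Ly k := by
    unfold gradBasis
    rw [HilbertBasis.coe_mkOfOrthogonalEqBot]
  rw [Submodule.coe_inner, Submodule.coe_inner, this, sq, gradCoeff,
    real_inner_comm (gradModeLp Lx Ly k) u]

end

section

variable {Lx Ly : ℝ}

/-! ### Fourier series of test functions -/

lemma summable_one_add_int_sq : Summable fun m : ℤ => ((1 : ℝ) + (m : ℝ) ^ 2)⁻¹ := by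
  have h := (Real.summable_one_div_int_pow (p := 2)).2 (by norm_num)
  refine Summable.of_norm_bounded_eventually h ?_
  have : ({0} : Set ℤ)ᶜ ∈ (cofinite : Filter ℤ) := (finite_singleton 0).compl_mem_cofinite
  filter_upwards [this] with m hm
  have hm' : (m : ℝ) ≠ 0 := by exact_mod_cast hm
  rw [Real.norm_of_nonneg (by positivity), one_div]
  exact inv_anti₀ (by positivity) (by linarith)

lemma waveSq_ge (hx : 0 < Lx) (hy : 0 < Ly) :
    ∃ c > 0, ∀ k : ℤ × ℤ, c * ((k.1 : ℝ) ^ 2 + (k.2 : ℝ) ^ 2) ≤ waveSq Lx Ly k := by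
  refine ⟨min ((2 * Real.pi / Lx) ^ 2) ((2 * Real.pi / Ly) ^ 2),
    lt_min (by positivity) (by positivity), fun k => ?_⟩
  have e : waveSq Lx Ly k =
      (2 * Real.pi / Lx) ^ 2 * (k.1 : ℝ) ^ 2 + (2 * Real.pi / Ly) ^ 2 * (k.2 : ℝ) ^ 2 := by
    simp only [waveSq, wave, Fin.isValue, if_true, one_ne_zero, if_false]; ring
  rw [e, mul_add]
  exact add_le_add (mul_le_mul_of_nonneg_right (min_le_left _ _) (sq_nonneg _))
    (mul_le_mul_of_nonneg_right (min_le_right _ _) (sq_nonneg _))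

lemma one_le_normSq_of_ne_zero {k : ℤ × ℤ} (hk : k ≠ 0) :
    (1 : ℝ) ≤ (k.1 : ℝ) ^ 2 + (k.2 : ℝ) ^ 2 := by
  have h : (0 : ℤ) < k.1 ^ 2 + k.2 ^ 2 := by
    by_cases h1 : k.1 = 0
    · have h2 : k.2 ≠ 0 := fun h' => hk (Prod.ext h1 h')
      positivity
    · positivity
  have h : (1 : ℤ) ≤ k.1 ^ 2 + k.2 ^ 2 := h
  exact_mod_cast h

lemma exists_le_waveSq (hx : 0 < Lx) (hy : 0 < Ly) :
    ∃ c > 0, ∀ k : ℤ × ℤ, k ≠ 0 → c ≤ waveSq Lx Ly k := by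
  obtain ⟨c, hc, h⟩ := waveSq_ge hx hy
  refine ⟨c, hc, fun k hk => le_trans ?_ (h k)⟩
  have := one_le_normSq_of_ne_zero hk
  nlinarith

lemma summable_inv_waveSq_sq (hx : 0 < Lx) (hy : 0 < Ly) :
    Summable fun k : ℤ × ℤ => (waveSq Lx Ly k ^ 2)⁻¹ := by
  obtain ⟨c, hc, h⟩ := waveSq_ge hx hy
  have h1 : Summable fun k : ℤ × ℤ =>
      ((1 : ℝ) + (k.1 : ℝ) ^ 2)⁻¹ * ((1 : ℝ) + (k.2 : ℝ) ^ 2)⁻¹ :=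
    summable_one_add_int_sq.mul_of_nonneg summable_one_add_int_sq
      (fun _ => by positivity) (fun _ => by positivity)
  refine Summable.of_norm_bounded_eventually (h1.mul_left (4 / c ^ 2)) ?_
  have : ({0} : Set (ℤ × ℤ))ᶜ ∈ (cofinite : Filter (ℤ × ℤ)) :=
    (finite_singleton 0).compl_mem_cofinite
  filter_upwards [this] with k hk
  rw [Real.norm_of_nonneg (by positivity)]
  have hk1 := one_le_normSq_of_ne_zero hk
  set a := (k.1 : ℝ) ^ 2
  set b := (k.2 : ℝ) ^ 2
  have ha : 0 ≤ a := sq_nonneg _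
  have hb : 0 ≤ b := sq_nonneg _
  have e : 4 / c ^ 2 * ((1 + a)⁻¹ * (1 + b)⁻¹) = (c ^ 2 / 4 * ((1 + a) * (1 + b)))⁻¹ := by
    rw [mul_inv, mul_inv, inv_div]
  rw [e]
  refine inv_anti₀ (by positivity) ?_
  have h2 : (c * (a + b)) ^ 2 ≤ waveSq Lx Ly k ^ 2 :=
    pow_le_pow_left₀ (by positivity) (h k) 2
  refine le_trans ?_ h2
  have h3 : (1 + a) * (1 + b) ≤ 4 * (a + b) ^ 2 := by nlinarith
  calc c ^ 2 / 4 * ((1 + a) * (1 + b)) ≤ c ^ 2 / 4 * (4 * (a + b) ^ 2) := by gcongr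
    _ = (c * (a + b)) ^ 2 := by ring

lemma IsTest.exists_bound {η : ℝ × ℝ → ℝ} (hx : 0 < Lx) (hy : 0 < Ly) (h : IsTest Lx Ly η) :
    ∃ M, ∀ p, |η p| ≤ M := by
  obtain ⟨C, hC⟩ := (isCompact_Icc.prod isCompact_Icc :
    IsCompact (Icc (0 : ℝ) Lx ×ˢ Icc (0 : ℝ) Ly)).exists_bound_of_continuousOn
      h.continuous.continuousOn
  refine ⟨C, fun p => ?_⟩
  obtain ⟨x, hx', e1⟩ := Function.Periodic.exists_mem_Ico₀ (f := fun s => η (s, p.2))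
    (fun s => h.periodic_x s p.2) hx p.1
  obtain ⟨y, hy', e2⟩ := Function.Periodic.exists_mem_Ico₀ (f := fun s => η (x, s))
    (fun s => h.periodic_y x s) hy p.2
  have e : η p = η (x, y) := e1.trans e2
  rw [e]
  exact hC (x, y) ⟨Ico_subset_Icc_self hx', Ico_subset_Icc_self hy'⟩

/-- The Fourier coefficients of a scalar function with respect to the modes. -/
def modeCoeff (Lx Ly : ℝ) (f : ℝ × ℝ → ℝ) (k : ℤ × ℤ) : ℝ :=
  (Lx * Ly)⁻¹ * ∫ p in rect Lx Ly, f p * mode Lx Ly k p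

lemma IsTest.modeCoeff_pderiv {f : ℝ × ℝ → ℝ} (hx : 0 < Lx) (hy : 0 < Ly) (h : IsTest Lx Ly f)
    (i : Fin 2) (k : ℤ × ℤ) :
    modeCoeff Lx Ly (ThinKS.pderiv i f) (-k) = wave Lx Ly k i * modeCoeff Lx Ly f k := by
  have h1 := (isTest_mode hx.ne' hy.ne' (-k)).integral_mul_pderiv hx.le hy.le h i
  unfold modeCoeff
  simp_rw [mul_comm (ThinKS.pderiv i f _), h1, pderiv_mode, neg_neg, wave_neg]
  simp only [mul_assoc, integral_const_mul, mul_comm (mode Lx Ly k _)]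
  ring

lemma IsTest.modeCoeff_lap {f : ℝ × ℝ → ℝ} (hx : 0 < Lx) (hy : 0 < Ly) (h : IsTest Lx Ly f)
    (k : ℤ × ℤ) :
    modeCoeff Lx Ly (ThinKS.lap f) k = -waveSq Lx Ly k * modeCoeff Lx Ly f k := by
  have h2 : ∀ i, modeCoeff Lx Ly (ThinKS.pderiv i (ThinKS.pderiv i f)) k =
      -wave Lx Ly k i ^ 2 * modeCoeff Lx Ly f k := by
    intro i
    have := (h.pderiv i).modeCoeff_pderiv hx hy i (-k)
    rw [neg_neg, h.modeCoeff_pderiv hx hy i k, wave_neg] at this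
    rw [this]; ring
  have h3 : modeCoeff Lx Ly (ThinKS.lap f) k =
      modeCoeff Lx Ly (ThinKS.pderiv 0 (ThinKS.pderiv 0 f)) k +
      modeCoeff Lx Ly (ThinKS.pderiv 1 (ThinKS.pderiv 1 f)) k := by
    unfold modeCoeff ThinKS.lap
    simp only [add_mul]
    rw [integral_add, mul_add]
    · exact integrable_of_continuous
        (((h.pderiv 0).pderiv 0).continuous.mul (continuous_mode k))
    · exact integrable_of_continuous
        (((h.pderiv 1).pderiv 1).continuous.mul (continuous_mode k))
  rw [h3, h2, h2, waveSq]; ring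

lemma IsTest.exists_modeCoeff_bound {f : ℝ × ℝ → ℝ} (hx : 0 < Lx) (hy : 0 < Ly)
    (h : IsTest Lx Ly f) : ∃ M, ∀ k, |modeCoeff Lx Ly f k| ≤ M := by
  obtain ⟨M, hM⟩ := h.exists_bound hx hy
  refine ⟨|(Lx * Ly)⁻¹| * (M * (3 / 2) * (rectMeasure Lx Ly).real univ), fun k => ?_⟩
  unfold modeCoeff
  rw [abs_mul]
  gcongr
  refine norm_integral_le_of_norm_le_const (μ := rectMeasure Lx Ly)
    (f := fun p => f p * mode Lx Ly k p) (Eventually.of_forall fun p => ?_)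
  rw [norm_mul]
  exact mul_le_mul (hM p) (abs_mode_le k p) (norm_nonneg _) ((abs_nonneg _).trans (hM p))

/-- The coefficients decay like those of the fourth derivatives divided by `|κ| ^ 4`, which is
summable on a planar lattice. -/
lemma IsTest.summable_modeCoeff {f : ℝ × ℝ → ℝ} (hx : 0 < Lx) (hy : 0 < Ly)
    (h : IsTest Lx Ly f) : Summable fun k => |modeCoeff Lx Ly f k| := by
  obtain ⟨M, hM⟩ := h.lap.lap.exists_modeCoeff_bound hx hy
  refine Summable.of_norm_bounded_eventually ((summable_inv_waveSq_sq hx hy).mul_left M) ?_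
  have : ({0} : Set (ℤ × ℤ))ᶜ ∈ (cofinite : Filter (ℤ × ℤ)) :=
    (finite_singleton 0).compl_mem_cofinite
  filter_upwards [this] with k hk
  have h1 := hM k
  rw [h.lap.modeCoeff_lap hx hy, h.modeCoeff_lap hx hy, abs_mul, abs_mul] at h1
  have hp := waveSq_pos hx hy hk
  rw [abs_neg, abs_of_pos hp] at h1
  rw [Real.norm_eq_abs, abs_abs, ← div_eq_mul_inv, le_div_iff₀ (by positivity)]
  linarith

/-- An absolutely convergent series of modes may be integrated termwise against an integrable
function. -/
lemma hasSum_integral_mul_modes {g : ℝ × ℝ → ℝ} (hg : Integrable g (rectMeasure Lx Ly))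
    {a : ℤ × ℤ → ℝ} (ha : Summable fun k => |a k|) :
    HasSum (fun k => a k * ∫ p in rect Lx Ly, g p * mode Lx Ly k p)
      (∫ p in rect Lx Ly, g p * ∑' k, a k * mode Lx Ly k p) := by
  have hgi : ∀ k, Integrable (fun p => g p * mode Lx Ly k p) (rectMeasure Lx Ly) := fun k =>
    hg.mul_bdd (c := 3 / 2) (continuous_mode k).aestronglyMeasurable
      (Eventually.of_forall fun p => abs_mode_le k p)
  have h := hasSum_integral_of_summable_integral_norm (μ := rectMeasure Lx Ly)
    (F := fun k p => a k * (g p * mode Lx Ly k p)) (fun k => (hgi k).const_mul _) (by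
      refine Summable.of_nonneg_of_le (fun k => integral_nonneg fun p => norm_nonneg _)
        (fun k => ?_) (ha.mul_right (∫ p in rect Lx Ly, |g p| * (3 / 2)))
      rw [← integral_const_mul]
      refine integral_mono ((hgi k).const_mul _).norm ((hg.abs.mul_const _).const_mul _)
        fun p => ?_
      simp only [norm_mul, Real.norm_eq_abs]
      gcongr
      exact abs_mode_le k p)
  simp only [integral_const_mul] at h
  convert! h using 2
  funext p
  rw [← tsum_mul_left]
  congr 1; funext k; ring

lemma IsTest.ae_eq_tsum {f : ℝ × ℝ → ℝ} (hx : 0 < Lx) (hy : 0 < Ly) (h : IsTest Lx Ly f) :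
    f =ᵐ[rectMeasure Lx Ly] fun p => ∑' k, modeCoeff Lx Ly f k * mode Lx Ly k p := by
  have hs := h.summable_modeCoeff hx hy
  have hm : ∀ l, Continuous (mode Lx Ly l) := fun l => continuous_mode l
  have hc : Continuous fun p => ∑' k, modeCoeff Lx Ly f k * mode Lx Ly k p := by
    refine continuous_tsum (fun k => by fun_prop) (hs.mul_right (3 / 2)) fun k p => ?_
    rw [norm_mul]
    exact mul_le_mul_of_nonneg_left (abs_mode_le k p) (abs_nonneg _)
  have key := ae_eq_zero_of_integral_mul_mode
    (integrable_of_continuous (Lx := Lx) (Ly := Ly) (h.continuous.sub hc)) (fun l => by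
      have h1 := hasSum_integral_mul_modes
        (integrable_of_continuous (Lx := Lx) (Ly := Ly)
          (continuous_mode (Lx := Lx) (Ly := Ly) l)) hs
      simp only [integral_mode_mul_mode hx hy] at h1
      have h2 := h1.unique (hasSum_single l fun k hk => by simp [Ne.symm hk])
      change ∫ p in rect Lx Ly,
        (f p - ∑' k, modeCoeff Lx Ly f k * mode Lx Ly k p) * mode Lx Ly l p = 0
      simp only [sub_mul]
      have h3 := integral_sub
        (integrable_of_continuous (Lx := Lx) (Ly := Ly) (h.continuous.mul (hm l)))
        (integrable_of_continuous (Lx := Lx) (Ly := Ly) (hc.mul (hm l)))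
      refine h3.trans ?_
      simp only [Pi.mul_apply]
      simp only [mul_comm _ (mode Lx Ly l _)]
      rw [h2]
      simp only [if_true, modeCoeff, mul_comm _ (mode Lx Ly l _)]
      field_simp
      ring)
  filter_upwards [key] with p hp
  exact sub_eq_zero.1 hp

/-- Parseval's identity for an integrable function against a test function. -/
lemma IsTest.hasSum_modeCoeff {f g : ℝ × ℝ → ℝ} (hx : 0 < Lx) (hy : 0 < Ly) (h : IsTest Lx Ly f)
    (hg : Integrable g (rectMeasure Lx Ly)) :
    HasSum (fun k => modeCoeff Lx Ly f k * ∫ p in rect Lx Ly, g p * mode Lx Ly k p)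
      (∫ p in rect Lx Ly, g p * f p) := by
  convert! hasSum_integral_mul_modes hg (h.summable_modeCoeff hx hy) using 1
  refine integral_congr_ae ?_
  filter_upwards [h.ae_eq_tsum hx hy] with p hp
  rw [hp]

end

section

variable {Lx Ly : ℝ}

/-! ### The weak formulation in Fourier coefficients -/

/-- The eigenvalues of the linear operator `Δ² + Δ`. -/
def eigen (Lx Ly : ℝ) (k : ℤ × ℤ) : ℝ := waveSq Lx Ly k ^ 2 - waveSq Lx Ly k

/-- The nonlinearity, tested against a gradient mode. -/
def quadCoeff (k : ℤ × ℤ) (u : L2Field Lx Ly) : ℝ :=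
  ∫ p in rect Lx Ly, ‖u p‖ ^ 2 * divMode Lx Ly k p

/-- The right-hand side of the equation in direction `i`, tested against `η`. -/
def weakRHS (i : Fin 2) (η : ℝ × ℝ → ℝ) (u : L2Field Lx Ly) : ℝ :=
  ∫ p in rect Lx Ly, (-(u p i * lap (lap η) p) - u p i * lap η p - ‖u p‖ ^ 2 * pderiv i η p)

lemma continuous_gradCoeff (k : ℤ × ℤ) :
    Continuous (gradCoeff k : L2Field Lx Ly → ℝ) := by
  unfold gradCoeff; fun_prop

lemma continuous_quadCoeff (k : ℤ × ℤ) :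
    Continuous (quadCoeff k : L2Field Lx Ly → ℝ) :=
  continuous_integral_normSq_mul (continuous_divMode k) (abs_divMode_le k)

lemma weakRHS_eq (i : Fin 2) {η : ℝ × ℝ → ℝ} (hη : IsTest Lx Ly η) (u : L2Field Lx Ly) :
    weakRHS i η u = -(∫ p in rect Lx Ly, u p i * lap (lap η) p) -
      (∫ p in rect Lx Ly, u p i * lap η p) - ∫ p in rect Lx Ly, ‖u p‖ ^ 2 * pderiv i η p := by
  have h1 := integrable_comp_mul u i hη.lap.lap.continuous
  have h2 := integrable_comp_mul u i hη.lap.continuous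
  have h3 := integrable_normSq_mul u (hη.pderiv i).continuous
  unfold weakRHS
  refine (integral_sub (h1.neg.sub h2) h3).trans (congrArg (· - _) ?_)
  refine (integral_sub h1.neg h2).trans (congrArg (· - _) ?_)
  exact integral_neg _

lemma continuous_weakRHS (hx : 0 < Lx) (hy : 0 < Ly) (i : Fin 2) {η : ℝ × ℝ → ℝ}
    (hη : IsTest Lx Ly η) : Continuous (weakRHS i η : L2Field Lx Ly → ℝ) := by
  obtain ⟨M, hM⟩ := (hη.pderiv i).exists_bound hx hy
  have := ((continuous_integral_comp_mul (Lx := Lx) (Ly := Ly) i hη.lap.lap.continuous).neg.sub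
    (continuous_integral_comp_mul i hη.lap.continuous)).sub
    (continuous_integral_normSq_mul (hη.pderiv i).continuous hM)
  convert! this using 1
  funext u
  exact weakRHS_eq i hη u

lemma weakRHS_mode (hx : 0 < Lx) (hy : 0 < Ly) (i : Fin 2) (k : ℤ × ℤ) (u : L2Field Lx Ly) :
    weakRHS i (mode Lx Ly k) u = -eigen Lx Ly k * (∫ p in rect Lx Ly, u p i * mode Lx Ly k p) -
      wave Lx Ly k i * ∫ p in rect Lx Ly, ‖u p‖ ^ 2 * mode Lx Ly (-k) p := by
  rw [weakRHS_eq i (isTest_mode hx.ne' hy.ne' k), lap_lap_mode, lap_mode, pderiv_mode]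
  simp only [mul_left_comm _ (waveSq Lx Ly k ^ 2), mul_left_comm _ (-waveSq Lx Ly k),
    mul_left_comm _ (wave Lx Ly k i), integral_const_mul, eigen]
  ring

lemma quadCoeff_eq (k : ℤ × ℤ) (u : L2Field Lx Ly) :
    quadCoeff k u = √(waveSq Lx Ly k) / √(Lx * Ly) *
      ∫ p in rect Lx Ly, ‖u p‖ ^ 2 * mode Lx Ly (-k) p := by
  unfold quadCoeff divMode
  simp only [mul_left_comm _ (√(waveSq Lx Ly k) / √(Lx * Ly)), integral_const_mul]

/-- The projection of the weak formulation to a gradient mode. -/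
lemma dirCoeff_weakRHS (hx : 0 < Lx) (hy : 0 < Ly) {k : ℤ × ℤ} (hk : k ≠ 0) (u : L2Field Lx Ly) :
    dirCoeff Lx Ly k 0 * weakRHS 0 (mode Lx Ly k) u +
      dirCoeff Lx Ly k 1 * weakRHS 1 (mode Lx Ly k) u =
      -eigen Lx Ly k * gradCoeff k u - quadCoeff k u := by
  rw [weakRHS_mode hx hy, weakRHS_mode hx hy, gradCoeff_eq, quadCoeff_eq,
    ← dirCoeff_mul_wave hx hy hk]
  ring

/-- The coefficients of a weak solution along the gradient modes satisfy the integrated form of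
`c' = -λ c - q`, with `λ = eigen` and `q = quadCoeff`. -/
theorem IsWeakSolution.gradCoeff_eq {I : Set ℝ} {u₀ : L2Field Lx Ly} {u : ℝ → L2Field Lx Ly}
    (hx : 0 < Lx) (hy : 0 < Ly) (h : IsWeakSolution I u₀ u) {t : ℝ} (ht0 : 0 ≤ t)
    (hI : Icc 0 t ⊆ I) {k : ℤ × ℤ} (hk : k ≠ 0) :
    gradCoeff k (u t) = gradCoeff k u₀ +
      ∫ s in (0 : ℝ)..t, (-eigen Lx Ly k * gradCoeff k (u s) - quadCoeff k (u s)) := by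
  have hm := isTest_mode hx.ne' hy.ne' (Lx := Lx) (Ly := Ly) k
  have hw : ∀ i, ∫ p in rect Lx Ly, u t p i * mode Lx Ly k p =
      (∫ p in rect Lx Ly, u₀ p i * mode Lx Ly k p) +
        ∫ s in (0 : ℝ)..t, weakRHS i (mode Lx Ly k) (u s) := fun i =>
    h.weak t (hI ⟨ht0, le_rfl⟩) i _ hm
  have hint : ∀ i, IntervalIntegrable (fun s => weakRHS i (mode Lx Ly k) (u s)) volume 0 t := by
    intro i
    refine ContinuousOn.intervalIntegrable ?_
    rw [uIcc_of_le ht0]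
    exact (continuous_weakRHS hx hy i hm).comp_continuousOn (h.continuousOn.mono hI)
  simp_rw [← dirCoeff_weakRHS hx hy hk]
  rw [intervalIntegral.integral_add ((hint 0).const_mul _) ((hint 1).const_mul _),
    intervalIntegral.integral_const_mul, intervalIntegral.integral_const_mul,
    ThinKS.gradCoeff_eq, ThinKS.gradCoeff_eq, hw 0, hw 1]
  ring

/-- The mean is a conserved quantity of the equation. -/
theorem IsWeakSolution.mem_potentialFields {I : Set ℝ} {u₀ : L2Field Lx Ly} {u : ℝ → L2Field Lx Ly}
    (hx : 0 < Lx) (hy : 0 < Ly) (h : IsWeakSolution I u₀ u) (h₀ : MeanZero u₀) {t : ℝ}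
    (ht : t ∈ I) : u t ∈ potentialFields Lx Ly := by
  refine ⟨fun i => ?_, h.curlFree t ht⟩
  have hw : ∫ p in rect Lx Ly, u t p i * mode Lx Ly 0 p =
      (∫ p in rect Lx Ly, u₀ p i * mode Lx Ly 0 p) +
        ∫ s in (0 : ℝ)..t, weakRHS i (mode Lx Ly 0) (u s) :=
    h.weak t ht i _ (isTest_mode hx.ne' hy.ne' 0)
  simpa [weakRHS_mode hx hy, eigen, waveSq, wave, mode_zero, h₀ i] using hw

/-- Testing with the modes suffices: a curve of mean-zero curl-free fields whose Fourier
coefficients satisfy the integrated equation is a weak solution. -/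
theorem isWeakSolution_of_gradCoeff {u₀ : L2Field Lx Ly} {u : ℝ → L2Field Lx Ly}
    (hx : 0 < Lx) (hy : 0 < Ly) (hc : ContinuousOn u (Ici 0)) (h0 : u 0 = u₀)
    (hmem : ∀ t, 0 ≤ t → u t ∈ potentialFields Lx Ly)
    (hcoeff : ∀ t, 0 ≤ t → ∀ k : ℤ × ℤ, k ≠ 0 → gradCoeff k (u t) = gradCoeff k u₀ +
      ∫ s in (0 : ℝ)..t, (-eigen Lx Ly k * gradCoeff k (u s) - quadCoeff k (u s))) :
    IsWeakSolution (Ici 0) u₀ u := by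
  refine ⟨hc, h0, fun t ht => (hmem t ht).2, fun t ht i η hη => ?_⟩
  have ht : 0 ≤ t := ht
  change _ = _ + ∫ s in (0 : ℝ)..t, weakRHS i η (u s)
  -- the weak equation tested with the modes: trivial for the constant mode, and for the others
  -- both components are multiples of the equation for the gradient coefficient
  have hmode : ∀ k, ∫ p in rect Lx Ly, u t p i * mode Lx Ly k p =
      (∫ p in rect Lx Ly, u₀ p i * mode Lx Ly k p) +
        ∫ s in (0 : ℝ)..t, weakRHS i (mode Lx Ly k) (u s) := by
    intro k
    have h00 := hmem 0 le_rfl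
    rw [h0] at h00
    by_cases hk : k = 0
    · subst hk
      simp [weakRHS_mode hx hy, eigen, waveSq, wave, mode_zero, h00.1 i, (hmem t ht).1 i]
    · have e : ∀ s ∈ uIcc 0 t, weakRHS i (mode Lx Ly k) (u s) = Lx * Ly * dirCoeff Lx Ly k i *
          (-eigen Lx Ly k * gradCoeff k (u s) - quadCoeff k (u s)) := by
        intro s hs
        rw [uIcc_of_le ht] at hs
        rw [weakRHS_mode hx hy, (hmem s hs.1).2.integral_mul_mode hx hy hk, quadCoeff_eq,
          wave_eq_dirCoeff hx hy hk i]
        have h2 : √(Lx * Ly) ≠ 0 := (Real.sqrt_pos.2 (by positivity)).ne'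
        have h3 : Lx * Ly = √(Lx * Ly) ^ 2 := (Real.sq_sqrt (by positivity)).symm
        generalize √(Lx * Ly) = r at h2 h3 ⊢
        rw [h3]
        field_simp
      rw [intervalIntegral.integral_congr e, intervalIntegral.integral_const_mul,
        (hmem t ht).2.integral_mul_mode hx hy hk, h00.2.integral_mul_mode hx hy hk,
        hcoeff t ht k hk]
      ring
  -- both sides of the weak formulation are summed over the Fourier series of the test function
  set a := modeCoeff Lx Ly η with ha
  have hL2 : ∀ v : L2Field Lx Ly, HasSum
      (fun k => a k * ∫ p in rect Lx Ly, v p i * mode Lx Ly k p) (∫ p in rect Lx Ly, v p i * η p) :=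
    fun v => hη.hasSum_modeCoeff hx hy (integrable_comp v i)
  have hRHS : ∀ v : L2Field Lx Ly, HasSum (fun k => a k * weakRHS i (mode Lx Ly k) v)
      (weakRHS i η v) := by
    intro v
    have e1 := hη.lap.lap.hasSum_modeCoeff hx hy (integrable_comp v i)
    have e2 := hη.lap.hasSum_modeCoeff hx hy (integrable_comp v i)
    have e3 := (Equiv.neg (ℤ × ℤ)).hasSum_iff.2
      ((hη.pderiv i).hasSum_modeCoeff hx hy (integrable_normSq v))
    rw [weakRHS_eq i hη]
    convert! (e1.neg.sub e2).sub e3 using 1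
    funext k
    simp only [Function.comp_apply, Equiv.neg_apply, hη.modeCoeff_pderiv hx hy,
      hη.lap.modeCoeff_lap hx hy, hη.modeCoeff_lap hx hy, weakRHS_mode hx hy, eigen]
    ring
  -- the sum over the modes commutes with the time integral by dominated convergence, because the
  -- Fourier coefficients of the derivatives of the test function are summable
  obtain ⟨R, hR⟩ : ∃ R, ∀ s ∈ Icc 0 t, ‖u s‖ ≤ R :=
    isCompact_Icc.exists_bound_of_continuousOn (hc.mono Icc_subset_Ici_self)
  obtain ⟨M, hM⟩ : ∃ M, ∀ s ∈ Icc 0 t, ∀ k, |∫ p in rect Lx Ly, u s p i * mode Lx Ly k p| ≤ M ∧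
      |∫ p in rect Lx Ly, ‖u s p‖ ^ 2 * mode Lx Ly (-k) p| ≤ M := by
    refine ⟨max (3 / 2 * (1 + R ^ 2) * (1 + (rectMeasure Lx Ly).real univ)) (3 / 2 * R ^ 2),
      fun s hs k => ⟨le_max_of_le_left ?_, le_max_of_le_right ?_⟩⟩
    · have hb : ∀ p, ‖u s p i * mode Lx Ly k p‖ ≤ 3 / 2 * (1 + ‖u s p‖ ^ 2) := by
        intro p
        have h1 : |u s p i| ≤ ‖u s p‖ := PiLp.norm_apply_le (u s p) i
        rw [norm_mul, mul_comm]
        refine mul_le_mul (abs_mode_le k p) ?_ (norm_nonneg _) (by norm_num)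
        refine h1.trans ?_
        nlinarith [sq_nonneg (‖u s p‖ - 1), sq_nonneg ‖u s p‖]
      have hi := (integrable_const (μ := rectMeasure Lx Ly) (1 : ℝ)).add (integrable_normSq (u s))
      refine (norm_integral_le_of_norm_le (hi.const_mul (3 / 2)) (Eventually.of_forall hb)).trans ?_
      simp only [Pi.add_apply]
      rw [integral_const_mul, integral_add (integrable_const _) (integrable_normSq (u s)),
        integral_normSq, mul_assoc]
      refine mul_le_mul_of_nonneg_left ?_ (by norm_num)
      have h2 : ‖u s‖ ^ 2 ≤ R ^ 2 := pow_le_pow_left₀ (norm_nonneg _) (hR s hs) 2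
      have h3 : 0 ≤ (rectMeasure Lx Ly).real univ := measureReal_nonneg
      simp only [integral_const, smul_eq_mul, mul_one]
      nlinarith [sq_nonneg R, mul_nonneg (sq_nonneg R) h3]
    · refine (abs_integral_normSq_mul_le (u s) (continuous_mode (-k)) (abs_mode_le (-k))).trans ?_
      exact mul_le_mul_of_nonneg_left (pow_le_pow_left₀ (norm_nonneg _) (hR s hs) 2) (by norm_num)
  have hsum : Summable fun k => (|modeCoeff Lx Ly (lap (lap η)) k| + |modeCoeff Lx Ly (lap η) k| +
      |modeCoeff Lx Ly (pderiv i η) (-k)|) * M :=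
    ((hη.lap.lap.summable_modeCoeff hx hy).add (hη.lap.summable_modeCoeff hx hy)).add
      ((Equiv.neg (ℤ × ℤ)).summable_iff.2 ((hη.pderiv i).summable_modeCoeff hx hy)) |>.mul_right M
  have htime : HasSum (fun k => ∫ s in (0 : ℝ)..t, a k * weakRHS i (mode Lx Ly k) (u s))
      (∫ s in (0 : ℝ)..t, weakRHS i η (u s)) := by
    refine intervalIntegral.hasSum_integral_of_dominated_convergence
      (fun k _ => (|modeCoeff Lx Ly (lap (lap η)) k| + |modeCoeff Lx Ly (lap η) k| +
        |modeCoeff Lx Ly (pderiv i η) (-k)|) * M) (fun k => ?_) (fun k => ?_) ?_ ?_ ?_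
    · have hcont : ContinuousOn (fun s => a k * weakRHS i (mode Lx Ly k) (u s)) (Icc 0 t) :=
        continuousOn_const.mul ((continuous_weakRHS hx hy i
          (isTest_mode hx.ne' hy.ne' k)).comp_continuousOn (hc.mono Icc_subset_Ici_self))
      rw [uIoc_of_le ht]
      exact (hcont.mono Ioc_subset_Icc_self).aestronglyMeasurable measurableSet_Ioc
    · refine Eventually.of_forall fun s hs => ?_
      rw [uIoc_of_le ht] at hs
      obtain ⟨h1, h2⟩ := hM s (Ioc_subset_Icc_self hs) k
      rw [weakRHS_mode hx hy, hη.modeCoeff_pderiv hx hy, hη.lap.modeCoeff_lap hx hy,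
        hη.modeCoeff_lap hx hy, ← ha]
      set A := ∫ p in rect Lx Ly, u s p i * mode Lx Ly k p
      set B := ∫ p in rect Lx Ly, ‖u s p‖ ^ 2 * mode Lx Ly (-k) p
      have e : a k * (-eigen Lx Ly k * A - wave Lx Ly k i * B) =
          -(-waveSq Lx Ly k * (-waveSq Lx Ly k * a k)) * A - (-waveSq Lx Ly k * a k) * A -
            wave Lx Ly k i * a k * B := by
        unfold eigen; ring
      rw [e, Real.norm_eq_abs, add_mul, add_mul]
      refine (abs_sub _ _).trans (add_le_add ((abs_sub _ _).trans (add_le_add ?_ ?_)) ?_)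
      · rw [abs_mul, abs_neg]; gcongr
      · rw [abs_mul]; gcongr
      · rw [abs_mul]; gcongr
    · exact Eventually.of_forall fun s _ => hsum
    · exact intervalIntegrable_const
    · exact Eventually.of_forall fun s _ => hRHS (u s)
  refine (hL2 (u t)).unique ?_
  convert! (hL2 u₀).add htime using 1
  funext k
  rw [hmode k, intervalIntegral.integral_const_mul]
  ring

end

section

variable {Lx Ly : ℝ}

/-! ### Stability of the coefficient equations -/

/-- Duhamel's bound: a forcing of exponential growth `α` is damped by the factor `λ + α`. -/
lemma abs_le_of_linear_ode {lam α M T : ℝ} {y h : ℝ → ℝ} (hla : 0 < lam + α) (hM : 0 ≤ M)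
    (hc : ContinuousOn y (Icc 0 T))
    (hd : ∀ s ∈ Ico 0 T, HasDerivWithinAt y (-lam * y s + h s) (Ici s) s)
    (hh : ∀ s ∈ Ico 0 T, |h s| ≤ M * Real.exp (α * s)) {t : ℝ} (ht : t ∈ Icc 0 T) :
    |y t| ≤ (|y 0| + M / (lam + α)) * Real.exp (α * t) := by
  have key := image_norm_le_of_norm_deriv_right_le_deriv_boundary' (a := 0) (b := T)
    (f := fun s => Real.exp (lam * s) * y s) (f' := fun s => Real.exp (lam * s) * h s)
    (B := fun s => |y 0| + M / (lam + α) * Real.exp ((lam + α) * s))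
    (B' := fun s => M * Real.exp ((lam + α) * s))
    ((by fun_prop : Continuous fun s : ℝ => Real.exp (lam * s)).continuousOn.mul hc)
    (fun s hs => by
      have h1 : HasDerivAt (fun s => Real.exp (lam * s)) (Real.exp (lam * s) * lam) s := by
        simpa using ((hasDerivAt_id s).const_mul lam).exp
      convert! h1.hasDerivWithinAt.mul (hd s hs) using 1
      ring)
    (by
      simp only [mul_zero, Real.exp_zero, one_mul, mul_one, Real.norm_eq_abs]
      have : 0 ≤ M / (lam + α) := by positivity
      linarith)
    (by fun_prop)
    (fun s _ => by
      have h1 : HasDerivAt (fun s => Real.exp ((lam + α) * s))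
          (Real.exp ((lam + α) * s) * (lam + α)) s := by
        simpa using ((hasDerivAt_id s).const_mul (lam + α)).exp
      have h2 := (h1.const_mul (M / (lam + α))).const_add (|y 0|)
      convert! h2.hasDerivWithinAt using 1
      field_simp)
    (fun s hs => by
      rw [Real.norm_eq_abs, abs_mul, Real.abs_exp, add_mul, Real.exp_add]
      calc Real.exp (lam * s) * |h s| ≤ Real.exp (lam * s) * (M * Real.exp (α * s)) := by
            gcongr; exact hh s hs
        _ = _ := by ring) ht
  rw [Real.norm_eq_abs, abs_mul, Real.abs_exp] at key
  have e1 : |y t| = Real.exp (-(lam * t)) * (Real.exp (lam * t) * |y t|) := by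
    rw [← mul_assoc, ← Real.exp_add]; simp
  have e2 : Real.exp (-(lam * t)) ≤ Real.exp (α * t) := by
    apply Real.exp_le_exp.2
    nlinarith [ht.1]
  have e3 : Real.exp (-(lam * t)) * Real.exp ((lam + α) * t) = Real.exp (α * t) := by
    rw [← Real.exp_add]; congr 1; ring
  rw [e1]
  calc Real.exp (-(lam * t)) * (Real.exp (lam * t) * |y t|)
      ≤ Real.exp (-(lam * t)) * (|y 0| + M / (lam + α) * Real.exp ((lam + α) * t)) := by gcongr
    _ = Real.exp (-(lam * t)) * |y 0| +
        M / (lam + α) * (Real.exp (-(lam * t)) * Real.exp ((lam + α) * t)) := by ring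
    _ ≤ Real.exp (α * t) * |y 0| + M / (lam + α) * Real.exp (α * t) := by
        rw [e3]; gcongr
    _ = _ := by ring

/-- The fundamental theorem of calculus for an integrand that is continuous on `[0, T]` only: the
integrand is extended by constants. -/
lemma hasDerivWithinAt_of_integral_eq {y g : ℝ → ℝ} {y₀ T : ℝ} (hg : ContinuousOn g (Icc 0 T))
    (hy : ∀ t ∈ Icc 0 T, y t = y₀ + ∫ s in (0 : ℝ)..t, g s) :
    ContinuousOn y (Icc 0 T) ∧ ∀ s ∈ Ico 0 T, HasDerivWithinAt y (g s) (Ici s) s := by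
  rcases lt_or_ge T 0 with hT | hT
  · simp [Icc_eq_empty_of_lt hT, Ico_eq_empty_of_le hT.le]
  set G : ℝ → ℝ := IccExtend hT ((Icc 0 T).domRestrict g) with hGdef
  have hG : Continuous G := (continuousOn_iff_continuous_domRestrict.1 hg).Icc_extend'
  have hGg : ∀ s ∈ Icc 0 T, G s = g s := fun s hs => by
    rw [hGdef, IccExtend_of_mem _ _ hs]; rfl
  have hd : ∀ t, HasDerivAt (fun t => y₀ + ∫ s in (0 : ℝ)..t, G s) (G t) t := fun t =>
    (intervalIntegral.integral_hasDerivAt_right (hG.intervalIntegrable _ _)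
      hG.aestronglyMeasurable.stronglyMeasurableAtFilter hG.continuousAt).const_add y₀
  have hyG : ∀ t ∈ Icc 0 T, y t = y₀ + ∫ s in (0 : ℝ)..t, G s := by
    intro t ht
    rw [hy t ht]
    congr 1
    refine intervalIntegral.integral_congr fun s hs => ?_
    rw [uIcc_of_le ht.1] at hs
    exact (hGg s ⟨hs.1, hs.2.trans ht.2⟩).symm
  refine ⟨ContinuousOn.congr (fun t _ => (hd t).continuousAt.continuousWithinAt) hyG,
    fun s hs => ?_⟩
  rw [← hGg s (Ico_subset_Icc_self hs)]
  refine (hd s).hasDerivWithinAt.congr_of_eventuallyEq ?_ (hyG s (Ico_subset_Icc_self hs))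
  have : Icc s T ∈ nhdsWithin s (Ici s) := Icc_mem_nhdsGE hs.2
  filter_upwards [this] with t ht
  exact hyG t ⟨hs.1.trans ht.1, ht.2⟩

/-- The supremum bound for the divergence of a gradient mode. It controls the tested nonlinearity
on `L²`, and its Lipschitz constant. -/
def quadBound (Lx Ly : ℝ) (k : ℤ × ℤ) : ℝ := √(waveSq Lx Ly k) / √(Lx * Ly) * (3 / 2)

lemma quadBound_nonneg (k : ℤ × ℤ) : 0 ≤ quadBound Lx Ly k := by unfold quadBound; positivity

lemma abs_quadCoeff_sub_le (k : ℤ × ℤ) (u v : L2Field Lx Ly) :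
    |quadCoeff k u - quadCoeff k v| ≤ quadBound Lx Ly k * (‖u - v‖ * (‖u‖ + ‖v‖)) :=
  abs_integral_normSq_mul_sub_le u v (continuous_divMode k) (abs_divMode_le k)

lemma abs_quadCoeff_le (k : ℤ × ℤ) (u : L2Field Lx Ly) :
    |quadCoeff k u| ≤ quadBound Lx Ly k * ‖u‖ ^ 2 :=
  abs_integral_normSq_mul_le u (continuous_divMode k) (abs_divMode_le k)

lemma gradCoeff_sub (k : ℤ × ℤ) (u v : L2Field Lx Ly) :
    gradCoeff k (u - v) = gradCoeff k u - gradCoeff k v := inner_sub_right _ _ _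

/-- The squared gain of the `α`-damped linear evolution against the nonlinearity, mode by mode. -/
def gainSq (Lx Ly α : ℝ) (k : ℤ × ℤ) : ℝ := (quadBound Lx Ly k / (eigen Lx Ly k + α)) ^ 2

/-- The fourth-order dissipation beats the derivative in the nonlinearity: the total gain is finite,
and arbitrarily small once the damping is large. -/
lemma exists_gainSq_small (hx : 0 < Lx) (hy : 0 < Ly) {ε : ℝ} (hε : 0 < ε) :
    ∃ α : ℝ, (∀ k : ℤ × ℤ, 0 < eigen Lx Ly k + α) ∧
      Summable (fun k : {k : ℤ × ℤ // k ≠ 0} => gainSq Lx Ly α k) ∧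
      ∑' k : {k : ℤ × ℤ // k ≠ 0}, gainSq Lx Ly α k < ε := by
  obtain ⟨c, hc, hcw⟩ := exists_le_waveSq hx hy
  have hA : 0 < Lx * Ly := by positivity
  have hlow : ∀ α : ℝ, 1 ≤ α → ∀ k : ℤ × ℤ,
      waveSq Lx Ly k ^ 2 / 2 + (α - 1) < eigen Lx Ly k + α := by
    intro α hα k
    unfold eigen
    nlinarith [sq_nonneg (waveSq Lx Ly k - 1)]
  have hpos : ∀ α : ℝ, 1 ≤ α → ∀ k : ℤ × ℤ, 0 < eigen Lx Ly k + α := fun α hα k =>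
    lt_of_le_of_lt (by have := sq_nonneg (waveSq Lx Ly k); linarith) (hlow α hα k)
  have hbd : ∀ α : ℝ, 1 ≤ α → ∀ k : ℤ × ℤ, k ≠ 0 →
      gainSq Lx Ly α k ≤ 9 / (Lx * Ly * c) * (waveSq Lx Ly k ^ 2)⁻¹ := by
    intro α hα k hk
    have hw := waveSq_pos hx hy hk
    have h1 : waveSq Lx Ly k ^ 2 / 2 ≤ eigen Lx Ly k + α :=
      le_trans (by linarith) (hlow α hα k).le
    have h2 : quadBound Lx Ly k ^ 2 = 9 / 4 * waveSq Lx Ly k / (Lx * Ly) := by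
      unfold quadBound
      rw [mul_pow, div_pow, Real.sq_sqrt hw.le, Real.sq_sqrt hA.le]; ring
    unfold gainSq
    rw [div_pow, h2]
    calc 9 / 4 * waveSq Lx Ly k / (Lx * Ly) / (eigen Lx Ly k + α) ^ 2
        ≤ 9 / 4 * waveSq Lx Ly k / (Lx * Ly) / (waveSq Lx Ly k ^ 2 / 2) ^ 2 := by gcongr
      _ = 9 / (Lx * Ly * waveSq Lx Ly k) * (waveSq Lx Ly k ^ 2)⁻¹ := by field_simp; ring
      _ ≤ 9 / (Lx * Ly * c) * (waveSq Lx Ly k ^ 2)⁻¹ := by gcongr; exact hcw k hk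
  have hsum : Summable fun k : {k : ℤ × ℤ // k ≠ 0} =>
      9 / (Lx * Ly * c) * (waveSq Lx Ly (k : ℤ × ℤ) ^ 2)⁻¹ :=
    ((summable_inv_waveSq_sq hx hy).mul_left _).comp_injective Subtype.val_injective
  have hlim : Tendsto (fun α => ∑' k : {k : ℤ × ℤ // k ≠ 0}, gainSq Lx Ly α k) atTop
      (nhds (∑' _ : {k : ℤ × ℤ // k ≠ 0}, (0 : ℝ))) := by
    refine tendsto_tsum_of_dominated_convergence hsum (fun k => ?_) ?_
    · have h : Tendsto (fun α => quadBound Lx Ly (k : ℤ × ℤ) / (eigen Lx Ly (k : ℤ × ℤ) + α)) atTop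
          (nhds 0) := tendsto_const_nhds.div_atTop (tendsto_atTop_add_const_left _ _ tendsto_id)
      simpa [gainSq] using h.pow 2
    · filter_upwards [eventually_ge_atTop 1] with α hα k
      rw [gainSq, Real.norm_of_nonneg (sq_nonneg _)]
      exact hbd α hα k k.2
  rw [tsum_zero] at hlim
  obtain ⟨α, h1, h2⟩ := ((hlim.eventually (gt_mem_nhds hε)).and (eventually_ge_atTop 1)).exists
  exact ⟨α, hpos α h2, Summable.of_nonneg_of_le (fun k => sq_nonneg _)
    (fun k => hbd α h2 k k.2) hsum, h1⟩

/-- The curve `u` satisfies the integrated equation for the coefficient `k` on `[0, T]`. -/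
def CoeffEq (T : ℝ) (u₀ : L2Field Lx Ly) (u : ℝ → L2Field Lx Ly) (k : ℤ × ℤ) : Prop :=
  ∀ t ∈ Icc 0 T, gradCoeff k (u t) = gradCoeff k u₀ +
    ∫ s in (0 : ℝ)..t, (-eigen Lx Ly k * gradCoeff k (u s) - quadCoeff k (u s))

lemma CoeffEq.hasDerivWithinAt {T : ℝ} {u₀ : L2Field Lx Ly} {u : ℝ → L2Field Lx Ly} {k : ℤ × ℤ}
    (h : CoeffEq T u₀ u k) (hc : ContinuousOn u (Icc 0 T)) :
    ContinuousOn (fun t => gradCoeff k (u t)) (Icc 0 T) ∧ ∀ s ∈ Ico 0 T,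
      HasDerivWithinAt (fun t => gradCoeff k (u t))
        (-eigen Lx Ly k * gradCoeff k (u s) - quadCoeff k (u s)) (Ici s) s := by
  refine hasDerivWithinAt_of_integral_eq ?_ h
  exact (continuousOn_const.mul ((continuous_gradCoeff k).comp_continuousOn hc)).sub
    ((continuous_quadCoeff k).comp_continuousOn hc)

lemma CoeffEq.initial {T : ℝ} {u₀ : L2Field Lx Ly} {u : ℝ → L2Field Lx Ly} {k : ℤ × ℤ}
    (h : CoeffEq T u₀ u k) (hT : 0 ≤ T) : gradCoeff k (u 0) = gradCoeff k u₀ := by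
  have := h 0 ⟨le_rfl, hT⟩
  simpa using this

/-- The coefficients of a bounded solution are dominated by a sequence that does not depend on the
solution and is square summable. -/
lemma CoeffEq.abs_gradCoeff_le {T R α : ℝ} {u₀ : L2Field Lx Ly} {u : ℝ → L2Field Lx Ly}
    {k : ℤ × ℤ} (h : CoeffEq T u₀ u k) (hc : ContinuousOn u (Icc 0 T))
    (hR : ∀ t ∈ Icc 0 T, ‖u t‖ ≤ R) (hα : 0 < eigen Lx Ly k + α) (hα0 : 0 ≤ α) {t : ℝ}
    (ht : t ∈ Icc 0 T) :
    |gradCoeff k (u t)| ≤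
      (|gradCoeff k u₀| + quadBound Lx Ly k * R ^ 2 / (eigen Lx Ly k + α)) * Real.exp (α * t) := by
  obtain ⟨h1, h2⟩ := h.hasDerivWithinAt hc
  have := abs_le_of_linear_ode (y := fun t => gradCoeff k (u t)) (h := fun s => -quadCoeff k (u s))
    hα (mul_nonneg (quadBound_nonneg k) (sq_nonneg R)) h1
    (fun s hs => by simpa [sub_eq_add_neg] using h2 s hs)
    (fun s hs => by
      rw [abs_neg]
      have h3 := abs_quadCoeff_le k (u s)
      have h4 : ‖u s‖ ^ 2 ≤ R ^ 2 :=
        pow_le_pow_left₀ (norm_nonneg _) (hR s (Ico_subset_Icc_self hs)) 2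
      have h5 : 1 ≤ Real.exp (α * s) := Real.one_le_exp (mul_nonneg hα0 hs.1)
      calc |quadCoeff k (u s)| ≤ quadBound Lx Ly k * R ^ 2 :=
            h3.trans (mul_le_mul_of_nonneg_left h4 (quadBound_nonneg k))
        _ ≤ _ := le_mul_of_one_le_right (mul_nonneg (quadBound_nonneg k) (sq_nonneg R)) h5) ht
  simpa only [h.initial (ht.1.trans ht.2)] using this

/-- Two bounded curves which satisfy the same coefficient equations up to small errors `r` stay
close to each other. The weight `exp (-α t)` makes the nonlinearity a contraction. -/
theorem norm_sub_sq_le_of_coeffEq {T R α ε : ℝ} {u₀ : L2Field Lx Ly} {u v : ℝ → L2Field Lx Ly}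
    (hx : 0 < Lx) (hy : 0 < Ly) (hα : ∀ k : ℤ × ℤ, 0 < eigen Lx Ly k + α)
    (hsum : Summable fun k : {k : ℤ × ℤ // k ≠ 0} => gainSq Lx Ly α k)
    (hsmall : 16 * R ^ 2 * ∑' k : {k : ℤ × ℤ // k ≠ 0}, gainSq Lx Ly α k ≤ 1)
    (hu : ContinuousOn u (Icc 0 T)) (hv : ContinuousOn v (Icc 0 T))
    (hum : ∀ t ∈ Icc 0 T, u t ∈ potentialFields Lx Ly)
    (hvm : ∀ t ∈ Icc 0 T, v t ∈ potentialFields Lx Ly)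
    (huR : ∀ t ∈ Icc 0 T, ‖u t‖ ≤ R) (hvR : ∀ t ∈ Icc 0 T, ‖v t‖ ≤ R)
    (r : {k : ℤ × ℤ // k ≠ 0} → ℝ) (hr0 : ∀ k, 0 ≤ r k) (hr : Summable fun k => r k ^ 2)
    (hrε : ∑' k, r k ^ 2 ≤ ε)
    (h : ∀ k : {k : ℤ × ℤ // k ≠ 0}, (CoeffEq T u₀ u k ∧ CoeffEq T u₀ v k) ∨
      ∀ t ∈ Icc 0 T, |gradCoeff (k : ℤ × ℤ) (u t - v t)| ≤ r k * Real.exp (α * t)) :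
    ∀ t ∈ Icc 0 T, ‖u t - v t‖ ^ 2 ≤ 4 * ε * Real.exp (α * t) ^ 2 := by
  intro t ht
  -- `G` is the weighted supremum of the difference, attained at time `τ`
  obtain ⟨τ, hτ, hmax⟩ := isCompact_Icc.exists_isMaxOn (nonempty_of_mem ht)
    (f := fun s => ‖u s - v s‖ * Real.exp (-(α * s))) ((hu.sub hv).norm.mul (by fun_prop))
  set G := ‖u τ - v τ‖ * Real.exp (-(α * τ)) with hG
  have hG0 : 0 ≤ G := by positivity
  have hle : ∀ s ∈ Icc 0 T, ‖u s - v s‖ ≤ G * Real.exp (α * s) := by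
    intro s hs
    have h1 : ‖u s - v s‖ * Real.exp (-(α * s)) ≤ G := hmax hs
    calc ‖u s - v s‖ = ‖u s - v s‖ * Real.exp (-(α * s)) * Real.exp (α * s) := by
          rw [mul_assoc, ← Real.exp_add]; simp
      _ ≤ _ := by gcongr
  have hR0 : 0 ≤ R := (norm_nonneg _).trans (huR t ht)
  -- each coefficient of the difference is bounded by its gain times `G`, up to `r k`
  have hcoef : ∀ k : {k : ℤ × ℤ // k ≠ 0}, |gradCoeff (k : ℤ × ℤ) (u τ - v τ)| ≤
      (2 * R * G * (quadBound Lx Ly k / (eigen Lx Ly k + α)) + r k) * Real.exp (α * τ) := by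
    intro k
    have hq0 : 0 ≤ quadBound Lx Ly k / (eigen Lx Ly k + α) :=
      div_nonneg (quadBound_nonneg _) (hα k).le
    rcases h k with ⟨h1, h2⟩ | h1
    · obtain ⟨c1, d1⟩ := h1.hasDerivWithinAt hu
      obtain ⟨c2, d2⟩ := h2.hasDerivWithinAt hv
      have h0T : 0 ≤ T := hτ.1.trans hτ.2
      have := abs_le_of_linear_ode (y := fun t => gradCoeff (k : ℤ × ℤ) (u t) - gradCoeff k (v t))
        (h := fun s => -(quadCoeff (k : ℤ × ℤ) (u s) - quadCoeff k (v s))) (hα k)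
        (M := 2 * R * G * quadBound Lx Ly k)
        (mul_nonneg (by positivity) (quadBound_nonneg _)) (c1.sub c2)
        (fun s hs => by
          convert! (d1 s hs).sub (d2 s hs) using 1
          ring)
        (fun s hs => by
          have hs' := Ico_subset_Icc_self hs
          rw [abs_neg]
          calc |quadCoeff (k : ℤ × ℤ) (u s) - quadCoeff k (v s)|
              ≤ quadBound Lx Ly k * (‖u s - v s‖ * (‖u s‖ + ‖v s‖)) := abs_quadCoeff_sub_le _ _ _
            _ ≤ quadBound Lx Ly k * (G * Real.exp (α * s) * (R + R)) := by
                refine mul_le_mul_of_nonneg_left ?_ (quadBound_nonneg _)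
                exact mul_le_mul (hle s hs') (add_le_add (huR s hs') (hvR s hs')) (by positivity)
                  (by positivity)
            _ = _ := by ring) hτ
      rw [h1.initial h0T, h2.initial h0T, sub_self, abs_zero, zero_add] at this
      rw [gradCoeff_sub]
      refine this.trans (mul_le_mul_of_nonneg_right ?_ (Real.exp_pos _).le)
      rw [mul_div_assoc]
      linarith [hr0 k]
    · refine (h1 τ hτ).trans (mul_le_mul_of_nonneg_right ?_ (Real.exp_pos _).le)
      have : 0 ≤ 2 * R * G * (quadBound Lx Ly k / (eigen Lx Ly k + α)) := by positivity
      linarith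
  -- Parseval's identity turns this into a bound for `G` in terms of itself
  have hpars := hasSum_gradCoeff_sq hx hy (sub_mem (hum τ hτ) (hvm τ hτ))
  have hbig : Summable fun k : {k : ℤ × ℤ // k ≠ 0} =>
      (8 * R ^ 2 * G ^ 2 * gainSq Lx Ly α k + 2 * r k ^ 2) * Real.exp (α * τ) ^ 2 :=
    ((hsum.mul_left _).add (hr.mul_left 2)).mul_right _
  have hGsq : ‖u τ - v τ‖ ^ 2 ≤ (8 * R ^ 2 * G ^ 2 *
      (∑' k : {k : ℤ × ℤ // k ≠ 0}, gainSq Lx Ly α k) + 2 * ε) * Real.exp (α * τ) ^ 2 := by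
    calc ‖u τ - v τ‖ ^ 2 ≤ ∑' k : {k : ℤ × ℤ // k ≠ 0},
          (8 * R ^ 2 * G ^ 2 * gainSq Lx Ly α k + 2 * r k ^ 2) * Real.exp (α * τ) ^ 2 := by
          rw [← hpars.tsum_eq]
          refine Summable.tsum_le_tsum (fun k => ?_) hpars.summable hbig
          have h1 := pow_le_pow_left₀ (abs_nonneg _) (hcoef k) 2
          rw [sq_abs, mul_pow] at h1
          refine h1.trans (mul_le_mul_of_nonneg_right ?_ (sq_nonneg _))
          have := add_sq_le (a := 2 * R * G * (quadBound Lx Ly k / (eigen Lx Ly k + α))) (b := r k)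
          refine this.trans (le_of_eq ?_)
          unfold gainSq
          ring
      _ = (8 * R ^ 2 * G ^ 2 * (∑' k : {k : ℤ × ℤ // k ≠ 0}, gainSq Lx Ly α k) +
            2 * ∑' k, r k ^ 2) * Real.exp (α * τ) ^ 2 := by
          rw [tsum_mul_right, Summable.tsum_add (hsum.mul_left _) (hr.mul_left 2), tsum_mul_left,
            tsum_mul_left]
      _ ≤ _ := by gcongr
  have hGG : G ^ 2 ≤ 4 * ε := by
    have e : G ^ 2 * Real.exp (α * τ) ^ 2 = ‖u τ - v τ‖ ^ 2 := by
      rw [hG, mul_pow, mul_assoc, ← mul_pow, ← Real.exp_add]; simp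
    have h3 : G ^ 2 ≤ 8 * R ^ 2 * G ^ 2 *
        (∑' k : {k : ℤ × ℤ // k ≠ 0}, gainSq Lx Ly α k) + 2 * ε :=
      le_of_mul_le_mul_right (e.le.trans hGsq) (by positivity)
    have h4 := mul_le_mul_of_nonneg_left hsmall (sq_nonneg G)
    linarith
  calc ‖u t - v t‖ ^ 2 ≤ (G * Real.exp (α * t)) ^ 2 :=
        pow_le_pow_left₀ (norm_nonneg _) (hle t ht) 2
    _ = G ^ 2 * Real.exp (α * t) ^ 2 := mul_pow _ _ _
    _ ≤ _ := by gcongr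

/-- Uniqueness of weak solutions. Continuity in time makes both solutions bounded on `[0, T]`, and
no further regularity is needed. -/
theorem IsWeakSolution.eqOn {T : ℝ} {u₀ : L2Field Lx Ly} {u v : ℝ → L2Field Lx Ly}
    (hx : 0 < Lx) (hy : 0 < Ly) (h₀ : MeanZero u₀)
    (hu : IsWeakSolution (Icc 0 T) u₀ u) (hv : IsWeakSolution (Icc 0 T) u₀ v) :
    EqOn u v (Icc 0 T) := by
  obtain ⟨R₁, hR₁⟩ := isCompact_Icc.exists_bound_of_continuousOn hu.continuousOn
  obtain ⟨R₂, hR₂⟩ := isCompact_Icc.exists_bound_of_continuousOn hv.continuousOn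
  set R := max R₁ R₂
  obtain ⟨α, hα, hsum, hsm⟩ := exists_gainSq_small hx hy (ε := 1 / (16 * R ^ 2 + 1)) (by positivity)
  have hsmall : 16 * R ^ 2 * ∑' k : {k : ℤ × ℤ // k ≠ 0}, gainSq Lx Ly α k ≤ 1 := by
    rw [lt_div_iff₀ (by positivity)] at hsm
    have : 0 ≤ ∑' k : {k : ℤ × ℤ // k ≠ 0}, gainSq Lx Ly α k := tsum_nonneg fun _ => sq_nonneg _
    linarith
  have key := norm_sub_sq_le_of_coeffEq (ε := 0) hx hy hα hsum hsmall hu.continuousOn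
    hv.continuousOn (fun t ht => hu.mem_potentialFields hx hy h₀ ht)
    (fun t ht => hv.mem_potentialFields hx hy h₀ ht)
    (fun t ht => (hR₁ t ht).trans (le_max_left _ _))
    (fun t ht => (hR₂ t ht).trans (le_max_right _ _)) (fun _ => 0) (fun _ => le_rfl)
    (by simp) (by simp)
    (fun k => Or.inl ⟨fun t ht => hu.gradCoeff_eq hx hy ht.1 (Icc_subset_Icc_right ht.2) k.2,
      fun t ht => hv.gradCoeff_eq hx hy ht.1 (Icc_subset_Icc_right ht.2) k.2⟩)
  intro t ht
  have h1 := key t ht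
  rw [mul_zero, zero_mul] at h1
  have h2 : ‖u t - v t‖ = 0 := by
    have := sq_nonneg ‖u t - v t‖
    exact pow_eq_zero_iff (two_ne_zero) |>.1 (le_antisymm h1 this)
  exact sub_eq_zero.1 (norm_eq_zero.1 h2)

end

section

variable {Lx Ly : ℝ}

/-! ### Limits of truncated solutions -/

/-- Uniformly bounded solutions of the truncated systems converge to a weak solution. The `N`-th
approximation is only required on the time interval `[0, N]`. -/
theorem exists_weakSolution_of_truncations {R : ℝ} {u₀ : L2Field Lx Ly} {N₀ : ℕ}
    {U : ℕ → ℝ → L2Field Lx Ly} {K : ℕ → Set (ℤ × ℤ)} (hx : 0 < Lx) (hy : 0 < Ly)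
    (hu₀ : u₀ ∈ potentialFields Lx Ly)
    (hK : ∀ k, ∀ᶠ N in atTop, k ∈ K N) (hKmono : Monotone K)
    (hc : ∀ N ≥ N₀, ContinuousOn (U N) (Icc 0 N))
    (hm : ∀ N ≥ N₀, ∀ t ∈ Icc (0 : ℝ) N, U N t ∈ potentialFields Lx Ly)
    (hR : ∀ N ≥ N₀, ∀ t ∈ Icc (0 : ℝ) N, ‖U N t‖ ≤ R)
    (heq : ∀ N ≥ N₀, ∀ k ∈ K N, k ≠ 0 → CoeffEq N u₀ (U N) k)
    (hzero : ∀ N ≥ N₀, ∀ k ∉ K N, k ≠ 0 → ∀ t ∈ Icc (0 : ℝ) N, gradCoeff k (U N t) = 0) :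
    ∃ u : ℝ → L2Field Lx Ly, IsWeakSolution (Ici 0) u₀ u ∧
      ∀ t, 0 ≤ t → Tendsto (fun N => U N t) atTop (nhds (u t)) := by
  classical
  obtain ⟨α, hα, hsum, hsm⟩ := exists_gainSq_small hx hy (ε := 1 / (16 * R ^ 2 + 1)) (by positivity)
  -- the constant mode has `eigen = 0`
  have hα0 : 0 ≤ α := by
    have := hα 0
    simp only [eigen, waveSq, wave] at this
    simp at this
    exact this.le
  have hsmall : 16 * R ^ 2 * ∑' k : {k : ℤ × ℤ // k ≠ 0}, gainSq Lx Ly α k ≤ 1 := by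
    rw [lt_div_iff₀ (by positivity)] at hsm
    have : 0 ≤ ∑' k : {k : ℤ × ℤ // k ≠ 0}, gainSq Lx Ly α k := tsum_nonneg fun _ => sq_nonneg _
    linarith
  -- the coefficients outside the truncation, bounded uniformly in time up to the weight
  set r : ℕ → {k : ℤ × ℤ // k ≠ 0} → ℝ := fun N k => if (k : ℤ × ℤ) ∈ K N then 0 else
    |gradCoeff (k : ℤ × ℤ) u₀| + quadBound Lx Ly k * R ^ 2 / (eigen Lx Ly k + α) with hrdef
  have hq0 : ∀ k : ℤ × ℤ, 0 ≤ quadBound Lx Ly k * R ^ 2 / (eigen Lx Ly k + α) := fun k =>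
    div_nonneg (mul_nonneg (quadBound_nonneg _) (sq_nonneg _)) (hα k).le
  have hr0 : ∀ N k, 0 ≤ r N k := by
    intro N k
    simp only [hrdef]
    split_ifs
    · exact le_rfl
    · exact add_nonneg (abs_nonneg _) (hq0 k)
  have hbsum : Summable fun k : {k : ℤ × ℤ // k ≠ 0} =>
      2 * (gradCoeff (k : ℤ × ℤ) u₀ ^ 2 + R ^ 4 * gainSq Lx Ly α k) :=
    ((hasSum_gradCoeff_sq hx hy hu₀).summable.add (hsum.mul_left _)).mul_left 2
  have hrb : ∀ N k, r N k ^ 2 ≤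
      2 * (gradCoeff (k : ℤ × ℤ) u₀ ^ 2 + R ^ 4 * gainSq Lx Ly α k) := by
    intro N k
    simp only [hrdef]
    split_ifs
    · rw [zero_pow two_ne_zero]
      unfold gainSq
      positivity
    · refine (add_sq_le).trans (le_of_eq ?_)
      rw [sq_abs]
      unfold gainSq
      ring
  have hrsum : ∀ N, Summable fun k => r N k ^ 2 := fun N =>
    Summable.of_nonneg_of_le (fun k => sq_nonneg _) (hrb N) hbsum
  set ε : ℕ → ℝ := fun N => ∑' k, r N k ^ 2 with hεdef
  have hε : Tendsto ε atTop (nhds 0) := by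
    have : Tendsto ε atTop (nhds (∑' _ : {k : ℤ × ℤ // k ≠ 0}, (0 : ℝ))) := by
      refine tendsto_tsum_of_dominated_convergence hbsum (fun k => ?_)
        (Eventually.of_forall fun N k => ?_)
      · refine tendsto_const_nhds.congr' ?_
        filter_upwards [hK k] with N hN
        simp [hrdef, hN]
      · rw [Real.norm_of_nonneg (sq_nonneg _)]
        exact hrb N k
    rwa [tsum_zero] at this
  -- two truncated solutions solve the same equation inside the smaller truncation, and differ by
  -- at most the tail outside
  have hcmp : ∀ N ≥ N₀, ∀ M ≥ N, ∀ t ∈ Icc (0 : ℝ) N,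
      ‖U N t - U M t‖ ^ 2 ≤ 4 * ε N * Real.exp (α * t) ^ 2 := by
    intro N hN M hNM
    have hM : M ≥ N₀ := hN.trans hNM
    have hsub : Icc (0 : ℝ) N ⊆ Icc 0 M := Icc_subset_Icc_right (by exact_mod_cast hNM)
    refine norm_sub_sq_le_of_coeffEq (u₀ := u₀) hx hy hα hsum hsmall (hc N hN)
      ((hc M hM).mono hsub) (hm N hN) (fun t ht => hm M hM t (hsub ht)) (hR N hN)
      (fun t ht => hR M hM t (hsub ht)) (r N) (hr0 N) (hrsum N) le_rfl fun k => ?_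
    by_cases hk : (k : ℤ × ℤ) ∈ K N
    · exact Or.inl ⟨heq N hN k hk k.2, fun t ht => heq M hM k (hKmono hNM hk) k.2 t (hsub ht)⟩
    · refine Or.inr fun t ht => ?_
      rw [gradCoeff_sub, hzero N hN k hk k.2 t ht, zero_sub, abs_neg]
      simp only [hrdef, hk, if_false]
      by_cases hkM : (k : ℤ × ℤ) ∈ K M
      · exact (heq M hM k hkM k.2).abs_gradCoeff_le (hc M hM) (hR M hM) (hα k) hα0 (hsub ht)
      · rw [hzero M hM k hkM k.2 t (hsub ht), abs_zero]
        exact mul_nonneg (add_nonneg (abs_nonneg _) (hq0 k)) (Real.exp_pos _).le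
  -- the approximations are Cauchy, locally uniformly in time
  have hδ : ∀ t : ℝ, Tendsto (fun N => √(4 * ε N * Real.exp (α * t) ^ 2)) atTop (nhds 0) := by
    intro t
    have := ((hε.const_mul 4).mul_const (Real.exp (α * t) ^ 2)).sqrt
    simpa using this
  have hcauchy : ∀ t, 0 ≤ t → CauchySeq fun N => U N t := by
    intro t ht
    rw [Metric.cauchySeq_iff']
    intro δ hδ0
    obtain ⟨N, hN1, hN2, hN3⟩ := (((hδ t).eventually (gt_mem_nhds hδ0)).and
      ((eventually_ge_atTop N₀).and (eventually_ge_atTop ⌈t⌉₊))).exists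
    refine ⟨N, fun M hM => ?_⟩
    rw [dist_comm, dist_eq_norm]
    refine lt_of_le_of_lt ?_ hN1
    exact Real.le_sqrt_of_sq_le (hcmp N hN2 M hM t ⟨ht, Nat.ceil_le.1 hN3⟩)
  choose! u hu using fun (t : ℝ) (ht : 0 ≤ t) => cauchySeq_tendsto_of_complete (hcauchy t ht)
  have hlim : ∀ N ≥ N₀, ∀ t ∈ Icc (0 : ℝ) N,
      ‖U N t - u t‖ ≤ √(4 * ε N * Real.exp (α * t) ^ 2) := by
    intro N hN t ht
    refine le_of_tendsto ((tendsto_const_nhds.sub (hu t ht.1)).norm) ?_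
    filter_upwards [eventually_ge_atTop N] with M hM
    exact Real.le_sqrt_of_sq_le (hcmp N hN M hM t ht)
  have hcont : ContinuousOn u (Ici 0) := by
    intro t ht
    have ht : 0 ≤ t := ht
    have hunif : TendstoUniformlyOn U u atTop (Icc 0 (t + 1)) := by
      rw [Metric.tendstoUniformlyOn_iff]
      intro δ hδ0
      filter_upwards [(hδ (t + 1)).eventually (gt_mem_nhds hδ0), eventually_ge_atTop N₀,
        eventually_ge_atTop ⌈t + 1⌉₊] with N h1 h2 h3 s hs
      rw [dist_comm, dist_eq_norm]
      have hε0 : 0 ≤ ε N := tsum_nonneg fun _ => sq_nonneg _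
      refine lt_of_le_of_lt ((hlim N h2 s ⟨hs.1, hs.2.trans (Nat.ceil_le.1 h3)⟩).trans ?_) h1
      have : α * s ≤ α * (t + 1) := mul_le_mul_of_nonneg_left hs.2 hα0
      gcongr
    have h1 : ContinuousOn u (Icc 0 (t + 1)) := by
      refine hunif.continuousOn (Eventually.frequently ?_)
      filter_upwards [eventually_ge_atTop N₀, eventually_ge_atTop ⌈t + 1⌉₊] with N h2 h3
      exact (hc N h2).mono (Icc_subset_Icc_right (Nat.ceil_le.1 h3))
    refine (h1 t ⟨ht, by linarith⟩).mono_of_mem_nhdsWithin ?_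
    have : Iic (t + 1) ∈ nhds t := Iic_mem_nhds (by linarith)
    filter_upwards [mem_nhdsWithin_of_mem_nhds this, self_mem_nhdsWithin] with s h2 h3
    exact ⟨h3, h2⟩
  have hmem : ∀ t, 0 ≤ t → u t ∈ potentialFields Lx Ly := by
    intro t ht
    refine isClosed_potentialFields.mem_of_tendsto (hu t ht) ?_
    filter_upwards [eventually_ge_atTop N₀, eventually_ge_atTop ⌈t⌉₊] with N h2 h3
    exact hm N h2 t ⟨ht, Nat.ceil_le.1 h3⟩
  have hcoeff : ∀ t, 0 ≤ t → ∀ k : ℤ × ℤ, k ≠ 0 → gradCoeff k (u t) = gradCoeff k u₀ +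
      ∫ s in (0 : ℝ)..t, (-eigen Lx Ly k * gradCoeff k (u s) - quadCoeff k (u s)) := by
    intro t ht k hk
    have hF : Continuous fun w : L2Field Lx Ly => -eigen Lx Ly k * gradCoeff k w - quadCoeff k w :=
      (continuous_const.mul (continuous_gradCoeff k)).sub (continuous_quadCoeff k)
    have h1 : Tendsto (fun N => gradCoeff k (U N t)) atTop (nhds (gradCoeff k (u t))) :=
      ((continuous_gradCoeff k).tendsto _).comp (hu t ht)
    have h2 : Tendsto (fun N => ∫ s in (0 : ℝ)..t,
        (-eigen Lx Ly k * gradCoeff k (U N s) - quadCoeff k (U N s))) atTop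
        (nhds (∫ s in (0 : ℝ)..t, (-eigen Lx Ly k * gradCoeff k (u s) - quadCoeff k (u s)))) := by
      refine intervalIntegral.tendsto_integral_filter_of_dominated_convergence
        (fun _ => |eigen Lx Ly k| * (‖gradModeLp Lx Ly k‖ * R) + quadBound Lx Ly k * R ^ 2)
        ?_ ?_ intervalIntegrable_const ?_
      · filter_upwards [eventually_ge_atTop N₀, eventually_ge_atTop ⌈t⌉₊] with N h2 h3
        rw [uIoc_of_le ht]
        refine ((hF.comp_continuousOn ((hc N h2).mono
          (Icc_subset_Icc_right (Nat.ceil_le.1 h3)))).mono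
          Ioc_subset_Icc_self).aestronglyMeasurable measurableSet_Ioc
      · filter_upwards [eventually_ge_atTop N₀, eventually_ge_atTop ⌈t⌉₊] with N h2 h3
        refine Eventually.of_forall fun s hs => ?_
        rw [uIoc_of_le ht] at hs
        have h4 := hR N h2 s ⟨hs.1.le, hs.2.trans (Nat.ceil_le.1 h3)⟩
        have h5 : |gradCoeff k (U N s)| ≤ ‖gradModeLp Lx Ly k‖ * R :=
          (abs_real_inner_le_norm _ _).trans (mul_le_mul_of_nonneg_left h4 (norm_nonneg _))
        have h6 : |quadCoeff k (U N s)| ≤ quadBound Lx Ly k * R ^ 2 :=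
          (abs_quadCoeff_le k _).trans (mul_le_mul_of_nonneg_left
            (pow_le_pow_left₀ (norm_nonneg _) h4 2) (quadBound_nonneg k))
        refine (abs_sub _ _).trans (add_le_add ?_ h6)
        rw [abs_mul, abs_neg]
        exact mul_le_mul_of_nonneg_left h5 (abs_nonneg _)
      · refine Eventually.of_forall fun s hs => ?_
        rw [uIoc_of_le ht] at hs
        exact (hF.tendsto _).comp (hu s hs.1.le)
    refine tendsto_nhds_unique h1 ((h2.const_add _).congr' ?_)
    filter_upwards [eventually_ge_atTop N₀, eventually_ge_atTop ⌈t⌉₊, hK k] with N h3 h4 h5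
    exact (heq N h3 k h5 hk t ⟨ht, Nat.ceil_le.1 h4⟩).symm
  have hinit : u 0 = u₀ := by
    refine sub_eq_zero.1 (eq_zero_of_gradCoeff hx hy (sub_mem (hmem 0 le_rfl) hu₀) fun k hk => ?_)
    rw [gradCoeff_sub, hcoeff 0 le_rfl k hk]
    simp
  exact ⟨u, isWeakSolution_of_gradCoeff hx hy hcont hinit hmem hcoeff, hu⟩

end

section

/-! ### The gauge profile -/

/-- The profile of the gauge: it has mass `1` on `[-1, 1]`, vanishes at the end points, and has a
negative second moment, so that linear functions contribute with a favourable sign. -/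
def bump (x : ℝ) : ℝ := 15 / 8 * (1 - x ^ 2) * (1 - 3 * x ^ 2)

@[fun_prop]
lemma continuous_bump : Continuous bump := by unfold bump; fun_prop

lemma bump_neg (x : ℝ) : bump (-x) = bump x := by unfold bump; ring

lemma abs_bump_le {x : ℝ} (hx : x ∈ Icc (-1 : ℝ) 1) : |bump x| ≤ 15 / 8 := by
  have h : x ^ 2 ≤ 1 := by nlinarith [hx.1, hx.2]
  unfold bump
  rw [abs_le]
  constructor <;> nlinarith [sq_nonneg x, mul_nonneg (sq_nonneg x) (sub_nonneg.2 h)]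

lemma integral_bump : ∫ s in (-1 : ℝ)..1, bump s = 1 := by
  have : ∀ s, bump s = 15 / 8 - 15 / 2 * s ^ 2 + 45 / 8 * s ^ 4 := fun s => by unfold bump; ring
  simp_rw [this]
  rw [intervalIntegral.integral_add, intervalIntegral.integral_sub]
  · simp; norm_num
  all_goals exact Continuous.intervalIntegrable (by fun_prop) _ _

lemma integral_bump_mul : ∫ s in (-1 : ℝ)..1, bump s * s = 0 := by
  have : ∀ s, bump s * s = 15 / 8 * s - 15 / 2 * s ^ 3 + 45 / 8 * s ^ 5 :=
    fun s => by unfold bump; ring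
  simp_rw [this]
  rw [intervalIntegral.integral_add, intervalIntegral.integral_sub]
  · rw [intervalIntegral.integral_const_mul, integral_id]; simp; norm_num
  all_goals exact Continuous.intervalIntegrable (by fun_prop) _ _

lemma integral_bump_mul_sq : ∫ s in (-1 : ℝ)..1, bump s * s ^ 2 = -1 / 7 := by
  have : ∀ s, bump s * s ^ 2 = 15 / 8 * s ^ 2 - 15 / 2 * s ^ 4 + 45 / 8 * s ^ 6 :=
    fun s => by unfold bump; ring
  simp_rw [this]
  rw [intervalIntegral.integral_add, intervalIntegral.integral_sub]
  · simp; norm_num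
  all_goals exact Continuous.intervalIntegrable (by fun_prop) _ _

lemma sq_integral_le {f : ℝ → ℝ} (hf : Continuous f) {a b : ℝ} (hab : a ≤ b) :
    (∫ x in a..b, f x) ^ 2 ≤ (b - a) * ∫ x in a..b, f x ^ 2 := by
  rcases hab.eq_or_lt with rfl | hlt
  · simp
  set A := ∫ x in a..b, f x with hA
  set m := A / (b - a)
  have h0 : 0 ≤ ∫ x in a..b, (f x - m) ^ 2 :=
    intervalIntegral.integral_nonneg hab fun x _ => sq_nonneg _
  have e : ∀ x, (f x - m) ^ 2 = f x ^ 2 - 2 * m * f x + m ^ 2 := fun x => by ring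
  simp_rw [e] at h0
  rw [intervalIntegral.integral_add (Continuous.intervalIntegrable (by fun_prop) _ _)
    (Continuous.intervalIntegrable (by fun_prop) _ _), intervalIntegral.integral_sub
    (Continuous.intervalIntegrable (by fun_prop) _ _)
    (Continuous.intervalIntegrable (by fun_prop) _ _), intervalIntegral.integral_const_mul,
    intervalIntegral.integral_const, smul_eq_mul, ← hA] at h0
  have hpos : 0 < b - a := sub_pos.2 hlt
  have hm : m * (b - a) = A := by simp only [m]; field_simp
  have h1 := mul_nonneg hpos.le h0
  nlinarith

lemma abs_integral_bump_mul_le {f : ℝ → ℝ} {M : ℝ}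
    (hM : ∀ s ∈ Icc (-1 : ℝ) 1, |f s| ≤ M) : |∫ s in (-1 : ℝ)..1, bump s * f s| ≤ 15 / 4 * M := by
  have h := intervalIntegral.norm_integral_le_of_norm_le_const (a := (-1 : ℝ)) (b := 1)
    (f := fun s => bump s * f s) (C := 15 / 8 * M) (fun s hs => by
      rw [uIoc_of_le (by norm_num)] at hs
      have hs' := Ioc_subset_Icc_self hs
      rw [norm_mul]
      exact mul_le_mul (abs_bump_le hs') (hM s hs') (norm_nonneg _) (by norm_num))
  rw [Real.norm_eq_abs] at h
  refine h.trans (le_of_eq ?_)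
  norm_num
  ring

/-- A function which vanishes in the mean against the profile is controlled by its second
derivative: after splitting off the tangent `a * s`, the cross term between `a` and the remainder
is absorbed by the negative second moment. -/
lemma integral_bump_mul_sq_le {w w' w'' : ℝ → ℝ} (h1 : ∀ s, HasDerivAt w (w' s) s)
    (h2 : ∀ s, HasDerivAt w' (w'' s) s) (h3 : Continuous w'')
    (h0 : ∫ s in (-1 : ℝ)..1, bump s * w s = 0) :
    ∫ s in (-1 : ℝ)..1, bump s * w s ^ 2 ≤ 2600 * ∫ s in (-1 : ℝ)..1, w'' s ^ 2 := by
  have hwc : Continuous w := continuous_iff_continuousAt.2 fun s => (h1 s).continuousAt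
  set E := ∫ s in (-1 : ℝ)..1, w'' s ^ 2 with hE
  have hE0 : 0 ≤ E := intervalIntegral.integral_nonneg (by norm_num) fun _ _ => sq_nonneg _
  set R := √E
  have hR0 : 0 ≤ R := Real.sqrt_nonneg _
  have hR2 : R ^ 2 = E := Real.sq_sqrt hE0
  have hsub : ∀ a b : ℝ, -1 ≤ a → a ≤ b → b ≤ 1 → |w' b - w' a| ≤ √(b - a) * R := by
    intro a b ha hab hb
    have e : ∫ x in a..b, w'' x = w' b - w' a :=
      intervalIntegral.integral_eq_sub_of_hasDerivAt (fun x _ => h2 x) (h3.intervalIntegrable _ _)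
    rw [← e, ← Real.sqrt_mul (sub_nonneg.2 hab)]
    apply Real.abs_le_sqrt
    refine (sq_integral_le h3 hab).trans (mul_le_mul_of_nonneg_left ?_ (sub_nonneg.2 hab))
    exact intervalIntegral.integral_mono_interval ha hab hb
      (Eventually.of_forall fun x => sq_nonneg (w'' x)) ((h3.pow 2).intervalIntegrable _ _)
  have hw' : ∀ s ∈ Icc (-1 : ℝ) 1, |w' s - w' 0| ≤ R := by
    intro s hs
    rcases le_total 0 s with h | h
    · refine (hsub 0 s (by norm_num) h hs.2).trans (mul_le_of_le_one_left hR0 ?_)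
      exact Real.sqrt_le_one.2 (by linarith [hs.2])
    · rw [abs_sub_comm]
      refine (hsub s 0 hs.1 h (by norm_num)).trans (mul_le_of_le_one_left hR0 ?_)
      exact Real.sqrt_le_one.2 (by linarith [hs.1])
  -- `r` is the remainder of the first Taylor polynomial at the centre
  set a := w' 0
  set r : ℝ → ℝ := fun s => w s - w 0 - a * s with hr
  have hrc : Continuous r := by fun_prop
  have hrb : ∀ s ∈ Icc (-1 : ℝ) 1, |r s| ≤ R := by
    intro s hs
    have h := (convex_Icc (-1 : ℝ) 1).norm_image_sub_le_of_norm_hasDerivWithin_le (f := r)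
      (f' := fun s => w' s - a) (C := R) (x := 0) (y := s)
      (fun x _ => by
        have := ((h1 x).sub_const (w 0)).sub ((hasDerivAt_id x).const_mul a)
        rw [mul_one] at this
        exact this.hasDerivWithinAt)
      (fun x hx => hw' x hx) ⟨by norm_num, by norm_num⟩ hs
    have h0' : r 0 = 0 := by simp [hr]
    rw [h0', sub_zero, sub_zero] at h
    refine h.trans (mul_le_of_le_one_right hR0 ?_)
    rw [Real.norm_eq_abs, abs_le]; exact hs
  have hci : ∀ f : ℝ → ℝ, Continuous f → IntervalIntegrable (fun s => bump s * f s) volume (-1) 1 :=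
    fun f hf => (continuous_bump.mul hf).intervalIntegrable _ _
  -- the mean condition bounds the value at the centre by the remainder
  have hv0 : |w 0| ≤ 15 / 4 * R := by
    have e : ∀ s, bump s * w s = w 0 * bump s + a * (bump s * s) + bump s * r s := fun s => by
      simp only [hr]; ring
    simp_rw [e] at h0
    rw [intervalIntegral.integral_add (Continuous.intervalIntegrable (by fun_prop) _ _)
      (hci r hrc), intervalIntegral.integral_add (Continuous.intervalIntegrable (by fun_prop) _ _)
      (Continuous.intervalIntegrable (by fun_prop) _ _), intervalIntegral.integral_const_mul,
      intervalIntegral.integral_const_mul, integral_bump, integral_bump_mul] at h0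
    have h4 := abs_integral_bump_mul_le hrb
    have h5 : w 0 = -∫ s in (-1 : ℝ)..1, bump s * r s := by linarith
    rw [h5, abs_neg]; exact h4
  set ρ : ℝ → ℝ := fun s => w 0 + r s with hρ
  have hρc : Continuous ρ := by fun_prop
  have hρb : ∀ s ∈ Icc (-1 : ℝ) 1, |ρ s| ≤ 5 * R := fun s hs => by
    refine (abs_add_le _ _).trans ?_
    linarith [hrb s hs]
  have e : ∀ s, bump s * w s ^ 2 =
      a ^ 2 * (bump s * s ^ 2) + 2 * a * (bump s * (s * ρ s)) + bump s * ρ s ^ 2 := fun s => by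
    simp only [hρ, hr]; ring
  simp_rw [e]
  rw [intervalIntegral.integral_add (Continuous.intervalIntegrable (by fun_prop) _ _)
    (Continuous.intervalIntegrable (by fun_prop) _ _), intervalIntegral.integral_add
    (Continuous.intervalIntegrable (by fun_prop) _ _)
    (Continuous.intervalIntegrable (by fun_prop) _ _), intervalIntegral.integral_const_mul,
    intervalIntegral.integral_const_mul, integral_bump_mul_sq]
  have hA := abs_integral_bump_mul_le (f := fun s => s * ρ s) (M := 5 * R) fun s hs => by
    rw [abs_mul]
    have : |s| ≤ 1 := abs_le.2 hs
    calc |s| * |ρ s| ≤ 1 * (5 * R) := mul_le_mul this (hρb s hs) (abs_nonneg _) zero_le_one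
      _ = 5 * R := one_mul _
  have hB := abs_integral_bump_mul_le (f := fun s => ρ s ^ 2) (M := (5 * R) ^ 2) fun s hs => by
    rw [abs_pow]
    exact pow_le_pow_left₀ (abs_nonneg _) (hρb s hs) 2
  set A := ∫ s in (-1 : ℝ)..1, bump s * (s * ρ s)
  set B := ∫ s in (-1 : ℝ)..1, bump s * ρ s ^ 2
  have hB' := (abs_le.1 hB).2
  have hA2 : A ^ 2 ≤ (15 / 4 * (5 * R)) ^ 2 := sq_le_sq' (abs_le.1 hA).1 (abs_le.1 hA).2
  rw [← hR2]
  -- the terms in `a` are `-a ^ 2 / 7 + 2 * a * A ≤ 7 * A ^ 2`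
  nlinarith [sq_nonneg (a - 7 * A), sq_nonneg R]

/-- The Fourier transform of the profile. -/
def bumpHat (θ : ℝ) : ℝ := ∫ s in (-1 : ℝ)..1, bump s * Real.cos (θ * s)

lemma bumpHat_neg (θ : ℝ) : bumpHat (-θ) = bumpHat θ := by simp [bumpHat]

lemma bumpHat_zero : bumpHat 0 = 1 := by simp [bumpHat, integral_bump]

lemma abs_bumpHat_le (θ : ℝ) : |bumpHat θ| ≤ 15 / 4 := by
  have := abs_integral_bump_mul_le (f := fun s => Real.cos (θ * s)) (M := 1)
    fun s _ => Real.abs_cos_le_one _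
  simpa [bumpHat] using this

/-- Two integrations by parts; the first boundary term vanishes because the profile does. -/
lemma sq_mul_abs_bumpHat_le (θ : ℝ) : θ ^ 2 * |bumpHat θ| ≤ 120 := by
  by_cases hθ : θ = 0
  · simp [hθ]
  have hF : ∀ s ∈ uIcc (-1 : ℝ) 1, HasDerivAt
      (fun s => θ * bump s * Real.sin (θ * s) +
        (15 / 8 * (-8 * s + 12 * s ^ 3)) * Real.cos (θ * s))
      (θ ^ 2 * (bump s * Real.cos (θ * s)) +
        15 / 8 * (-8 + 36 * s ^ 2) * Real.cos (θ * s)) s := by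
    intro s _
    have hb : HasDerivAt bump (15 / 8 * (-8 * s + 12 * s ^ 3)) s := by
      have h := (((hasDerivAt_pow 2 s).const_sub 1).mul
        (((hasDerivAt_pow 2 s).const_mul 3).const_sub 1)).const_mul (15 / 8)
      convert! h using 1
      · funext x; simp [bump]; ring
      · simp; ring
    have hp : HasDerivAt (fun s : ℝ => 15 / 8 * (-8 * s + 12 * s ^ 3))
        (15 / 8 * (-8 + 36 * s ^ 2)) s := by
      have h := (((hasDerivAt_id s).const_mul (-8)).add
        ((hasDerivAt_pow 3 s).const_mul 12)).const_mul (15 / 8)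
      convert! h using 1
      simp; ring
    have hl : HasDerivAt (fun s => θ * s) θ s := by
      simpa using (hasDerivAt_id s).const_mul θ
    have h := ((hb.const_mul θ).mul hl.sin).add (hp.mul hl.cos)
    convert! h using 1
    ring
  have hint := intervalIntegral.integral_eq_sub_of_hasDerivAt hF
    (Continuous.intervalIntegrable (by fun_prop) _ _)
  rw [intervalIntegral.integral_add (Continuous.intervalIntegrable (by fun_prop) _ _)
    (Continuous.intervalIntegrable (by fun_prop) _ _), intervalIntegral.integral_const_mul] at hint
  have hJ := intervalIntegral.norm_integral_le_of_norm_le_const (a := (-1 : ℝ)) (b := 1)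
    (f := fun s => 15 / 8 * (-8 + 36 * s ^ 2) * Real.cos (θ * s)) (C := 105 / 2) (fun s hs => by
      rw [uIoc_of_le (by norm_num)] at hs
      have h : s ^ 2 ≤ 1 := by nlinarith [hs.1, hs.2]
      have h' : |15 / 8 * (-8 + 36 * s ^ 2)| ≤ 105 / 2 := by
        rw [abs_le]; constructor <;> nlinarith [sq_nonneg s]
      rw [norm_mul]
      calc ‖15 / 8 * (-8 + 36 * s ^ 2)‖ * ‖Real.cos (θ * s)‖ ≤ 105 / 2 * 1 :=
            mul_le_mul h' (Real.abs_cos_le_one _) (norm_nonneg _) (by norm_num)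
        _ = 105 / 2 := mul_one _)
  set J := ∫ s in (-1 : ℝ)..1, 15 / 8 * (-8 + 36 * s ^ 2) * Real.cos (θ * s)
  have e1 : θ * bump 1 * Real.sin (θ * 1) + 15 / 8 * (-8 * 1 + 12 * 1 ^ 3) * Real.cos (θ * 1) -
      (θ * bump (-1) * Real.sin (θ * -1) +
        15 / 8 * (-8 * -1 + 12 * (-1) ^ 3) * Real.cos (θ * -1)) = 15 * Real.cos θ := by
    have : bump 1 = 0 := by unfold bump; norm_num
    rw [bump_neg, this]
    simp only [mul_one, mul_neg, Real.cos_neg]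
    ring
  rw [e1] at hint
  have e2 : θ ^ 2 * bumpHat θ = 15 * Real.cos θ - J := by
    unfold bumpHat; linarith
  rw [← abs_of_nonneg (sq_nonneg θ), ← abs_mul, e2]
  rw [Real.norm_eq_abs] at hJ
  refine (abs_sub _ _).trans ?_
  have h3 : |15 * Real.cos θ| ≤ 15 := by
    rw [abs_mul, abs_of_pos (by norm_num : (0 : ℝ) < 15)]
    linarith [Real.abs_cos_le_one θ]
  norm_num at hJ
  linarith

lemma abs_bumpHat_le_div (θ : ℝ) : |bumpHat θ| ≤ 124 / (1 + θ ^ 2) := by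
  rw [le_div_iff₀ (by positivity)]
  linarith [sq_mul_abs_bumpHat_le θ, abs_bumpHat_le θ]

end

section

/-! ### The gauge density and its Fourier series -/

/-- Since `n ^ 2 + r ^ 2 ≥ (n + r) ^ 2 / 2`, the terms are dominated by a telescoping series. -/
lemma sum_range_inv_one_add_sq_le {r : ℝ} (hr : 1 ≤ r) (n : ℕ) :
    ∑ m ∈ Finset.range n, (1 + ((m : ℝ) / r) ^ 2)⁻¹ ≤ 4 * r := by
  have key : ∀ n : ℕ, ∑ m ∈ Finset.range n, (1 + ((m : ℝ) / r) ^ 2)⁻¹ ≤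
      2 * r ^ 2 * ((r - 1 / 2)⁻¹ - (n + r - 1 / 2)⁻¹) := by
    intro n
    induction n with
    | zero => simp
    | succ n ih =>
      rw [Finset.sum_range_succ]
      have hn : (0 : ℝ) ≤ n := n.cast_nonneg
      have h1 : (1 + ((n : ℝ) / r) ^ 2)⁻¹ ≤
          2 * r ^ 2 * ((n + r - 1 / 2)⁻¹ - ((n + 1 : ℕ) + r - 1 / 2)⁻¹) := by
        have e1 : (1 + ((n : ℝ) / r) ^ 2)⁻¹ = r ^ 2 / (r ^ 2 + n ^ 2) := by
          field_simp
        have e2 : (n + r - 1 / 2)⁻¹ - ((n + 1 : ℕ) + r - 1 / 2)⁻¹ =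
            ((n + r) ^ 2 - 1 / 4)⁻¹ := by
          have h1 : (n : ℝ) + r - 1 / 2 ≠ 0 := by linarith
          have h2 : (n : ℝ) + 1 + r - 1 / 2 ≠ 0 := by linarith
          have h3 : ((n : ℝ) + r) ^ 2 - 1 / 4 ≠ 0 := by nlinarith
          push_cast
          rw [inv_sub_inv h1 h2, inv_eq_one_div, div_eq_div_iff (mul_ne_zero h1 h2) h3]
          ring
        rw [e1, e2, ← div_eq_mul_inv, div_le_div_iff₀ (by positivity) (by nlinarith)]
        have : 0 ≤ r ^ 2 := by positivity
        nlinarith [sq_nonneg ((n : ℝ) - r), mul_nonneg this (sq_nonneg ((n : ℝ) - r))]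
      linarith
  refine (key n).trans ?_
  have hn : (0 : ℝ) ≤ n := n.cast_nonneg
  have h2 : (0 : ℝ) ≤ (n + r - 1 / 2)⁻¹ := inv_nonneg.2 (by linarith)
  have h3 : (r - 1 / 2)⁻¹ ≤ 2 / r := by
    rw [inv_eq_one_div, div_le_div_iff₀ (by linarith) (by linarith)]
    linarith
  calc 2 * r ^ 2 * ((r - 1 / 2)⁻¹ - (n + r - 1 / 2)⁻¹) ≤ 2 * r ^ 2 * (2 / r) := by
        refine mul_le_mul_of_nonneg_left ?_ (by positivity)
        linarith
    _ = 4 * r := by field_simp; norm_num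

lemma sum_inv_one_add_sq_le {r : ℝ} (hr : 1 ≤ r) (s : Finset ℤ) :
    ∑ m ∈ s, (1 + ((m : ℝ) / r) ^ 2)⁻¹ ≤ 8 * r := by
  classical
  set f : ℤ → ℝ := fun m => (1 + ((m : ℝ) / r) ^ 2)⁻¹
  have hf : ∀ m, 0 ≤ f m := fun m => by positivity
  have hfn : ∀ m : ℤ, f m = (1 + ((m.natAbs : ℝ) / r) ^ 2)⁻¹ := fun m => by
    have : ((m.natAbs : ℝ)) ^ 2 = (m : ℝ) ^ 2 := by
      rw [Nat.cast_natAbs, Int.cast_abs, sq_abs]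
    simp only [f]
    rw [div_pow, div_pow, this]
  -- the nonnegative and the negative integers are each mapped injectively to their absolute values
  have half : ∀ t : Finset ℤ, InjOn Int.natAbs (t : Set ℤ) → ∑ m ∈ t, f m ≤ 4 * r := by
    intro t ht
    obtain ⟨n, hn⟩ := (t.image Int.natAbs).exists_nat_subset_range
    calc ∑ m ∈ t, f m = ∑ j ∈ t.image Int.natAbs, (1 + ((j : ℝ) / r) ^ 2)⁻¹ := by
          rw [Finset.sum_image ht]
          exact Finset.sum_congr rfl fun m _ => hfn m
      _ ≤ ∑ j ∈ Finset.range n, (1 + ((j : ℝ) / r) ^ 2)⁻¹ :=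
          Finset.sum_le_sum_of_subset_of_nonneg hn fun j _ _ => by positivity
      _ ≤ 4 * r := sum_range_inv_one_add_sq_le hr n
  have h1 := half (s.filter (0 ≤ ·)) fun a ha b hb h => by
    simp only [Finset.coe_filter, mem_ofPred_eq] at ha hb
    omega
  have h2 := half (s.filter (¬ 0 ≤ ·)) fun a ha b hb h => by
    simp only [Finset.coe_filter, mem_ofPred_eq] at ha hb
    omega
  have := Finset.sum_filter_add_sum_filter_not s (0 ≤ ·) f
  linarith

lemma integral_bump_mul_sin (θ : ℝ) : ∫ s in (-1 : ℝ)..1, bump s * Real.sin (θ * s) = 0 := by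
  have h := intervalIntegral.integral_comp_neg (a := (-1 : ℝ)) (b := 1)
    (fun s => bump s * Real.sin (θ * s))
  simp only [bump_neg, mul_neg, Real.sin_neg, intervalIntegral.integral_neg, neg_neg] at h
  linarith

/-- The gauge density: the profile, concentrated on `[-ℓ, ℓ]` and scaled to mass `4 L`, so that its
mean over a period is `4`. Clamping the argument extends the profile by zero. -/
def gaugeDensity (L ℓ y : ℝ) : ℝ := 4 * L / ℓ * bump (max (-1) (min (y / ℓ) 1))

/-- The Fourier coefficients of `gaugeDensity`, a real even function of period `L`. -/
def gaugeCoeff (L ℓ : ℝ) (m : ℤ) : ℝ := 4 * bumpHat (2 * Real.pi * m / L * ℓ)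

variable {L ℓ : ℝ}

@[fun_prop]
lemma continuous_gaugeDensity : Continuous (gaugeDensity L ℓ) := by
  unfold gaugeDensity; fun_prop

lemma bump_one : bump 1 = 0 := by unfold bump; norm_num

lemma gaugeDensity_of_mem (hℓ : 0 < ℓ) {y : ℝ} (hy : y ∈ Icc (-ℓ) ℓ) :
    gaugeDensity L ℓ y = 4 * L / ℓ * bump (y / ℓ) := by
  have h1 : y / ℓ ≤ 1 := (div_le_one hℓ).2 hy.2
  have h2 : -1 ≤ y / ℓ := by rw [le_div_iff₀ hℓ]; linarith [hy.1]
  rw [gaugeDensity, min_eq_left h1, max_eq_right h2]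

lemma gaugeDensity_of_le (hℓ : 0 < ℓ) {y : ℝ} (hy : ℓ ≤ y) : gaugeDensity L ℓ y = 0 := by
  have h1 : 1 ≤ y / ℓ := (one_le_div hℓ).2 hy
  rw [gaugeDensity, min_eq_right h1, max_eq_right (by norm_num), bump_one, mul_zero]

lemma gaugeDensity_of_le_neg (hℓ : 0 < ℓ) {y : ℝ} (hy : y ≤ -ℓ) : gaugeDensity L ℓ y = 0 := by
  have h1 : y / ℓ ≤ -1 := by rw [div_le_iff₀ hℓ]; linarith
  rw [gaugeDensity, min_eq_left (by linarith), max_eq_left h1, bump_neg, bump_one, mul_zero]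

lemma integral_gaugeDensity_mul (hℓ : 0 < ℓ) (hL : ℓ ≤ L / 2) {g : ℝ → ℝ} (hg : Continuous g) :
    ∫ y in -(L / 2)..L / 2, gaugeDensity L ℓ y * g y =
      4 * L * ∫ s in (-1 : ℝ)..1, bump s * g (ℓ * s) := by
  have hi : ∀ a b, IntervalIntegrable (fun y => gaugeDensity L ℓ y * g y) volume a b :=
    fun a b => Continuous.intervalIntegrable (by fun_prop) _ _
  rw [← intervalIntegral.integral_add_adjacent_intervals (hi (-(L / 2)) (-ℓ)) (hi _ _),
    ← intervalIntegral.integral_add_adjacent_intervals (hi (-ℓ) ℓ) (hi _ (L / 2))]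
  have z1 : ∫ y in -(L / 2)..-ℓ, gaugeDensity L ℓ y * g y = 0 := by
    rw [intervalIntegral.integral_congr (g := fun _ => 0), intervalIntegral.integral_zero]
    intro y hy
    rw [uIcc_of_le (by linarith)] at hy
    simp [gaugeDensity_of_le_neg hℓ hy.2]
  have z2 : ∫ y in ℓ..L / 2, gaugeDensity L ℓ y * g y = 0 := by
    rw [intervalIntegral.integral_congr (g := fun _ => 0), intervalIntegral.integral_zero]
    intro y hy
    rw [uIcc_of_le hL] at hy
    simp [gaugeDensity_of_le hℓ hy.1]
  have z3 : ∫ y in -ℓ..ℓ, gaugeDensity L ℓ y * g y =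
      4 * L * ∫ s in (-1 : ℝ)..1, bump s * g (ℓ * s) := by
    have e : ∫ y in -ℓ..ℓ, gaugeDensity L ℓ y * g y =
        ∫ y in -ℓ..ℓ, (fun s => 4 * L / ℓ * (bump s * g (ℓ * s))) (y / ℓ) := by
      refine intervalIntegral.integral_congr fun y hy => ?_
      rw [uIcc_of_le (by linarith)] at hy
      simp only [gaugeDensity_of_mem hℓ hy, mul_div_cancel₀ y hℓ.ne']
      ring
    rw [e, intervalIntegral.integral_comp_div (fun s => 4 * L / ℓ * (bump s * g (ℓ * s))) hℓ.ne',
      neg_div, div_self hℓ.ne',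
      intervalIntegral.integral_const_mul, smul_eq_mul]
    field_simp
  rw [z1, z2, z3]
  ring

lemma abs_gaugeCoeff_le (L ℓ : ℝ) (m : ℤ) :
    |gaugeCoeff L ℓ m| ≤ 496 * (1 + ((m : ℝ) / (L / (2 * Real.pi * ℓ))) ^ 2)⁻¹ := by
  have h := abs_bumpHat_le_div (2 * Real.pi * m / L * ℓ)
  have e : 2 * Real.pi * m / L * ℓ = (m : ℝ) / (L / (2 * Real.pi * ℓ)) := by
    rw [div_div_eq_mul_div]; ring
  rw [gaugeCoeff, abs_mul, abs_of_pos (by norm_num : (0 : ℝ) < 4), ← e]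
  rw [div_eq_mul_inv (124 : ℝ)] at h
  linarith

lemma sum_abs_gaugeCoeff_le (hr : 1 ≤ L / (2 * Real.pi * ℓ)) (s : Finset ℤ) :
    ∑ m ∈ s, |gaugeCoeff L ℓ m| ≤ 3968 * (L / (2 * Real.pi * ℓ)) := by
  refine (Finset.sum_le_sum fun m _ => abs_gaugeCoeff_le L ℓ m).trans ?_
  rw [← Finset.mul_sum]
  linarith [sum_inv_one_add_sq_le hr s]

lemma summable_gaugeCoeff (hr : 1 ≤ L / (2 * Real.pi * ℓ)) :
    Summable fun m => |gaugeCoeff L ℓ m| :=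
  summable_of_sum_le (fun _ => abs_nonneg _) (sum_abs_gaugeCoeff_le hr)

/-- The Fourier series of the gauge density converges to it on a period. -/
lemma hasSum_gaugeDensity (hℓ : 0 < ℓ) (hL : ℓ ≤ L / 2) (hr : 1 ≤ L / (2 * Real.pi * ℓ))
    {y : ℝ} (hy : y ∈ Icc (-(L / 2)) (L / 2)) :
    HasSum (fun m : ℤ => gaugeCoeff L ℓ m * Real.cos (2 * Real.pi * m / L * y))
      (gaugeDensity L ℓ y) := by
  have hL0 : 0 < L := by linarith
  have : Fact (0 < L) := ⟨hL0⟩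
  have hEnd : gaugeDensity L ℓ (-(L / 2)) = gaugeDensity L ℓ (L / 2) := by
    rw [gaugeDensity_of_le hℓ hL, gaugeDensity_of_le_neg hℓ (by linarith)]
  have e0 : -(L / 2) + L = L / 2 := by ring
  let F : C(AddCircle L, ℂ) :=
    ⟨AddCircle.liftIco L (-(L / 2)) fun y => (gaugeDensity L ℓ y : ℂ),
      AddCircle.liftIco_continuous (by rw [e0, hEnd]) (by fun_prop)⟩
  have hF : ∀ y ∈ Ico (-(L / 2)) (L / 2), F y = (gaugeDensity L ℓ y : ℂ) := fun y hy => by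
    have hy' : y ∈ Ico (-(L / 2)) (-(L / 2) + L) := by rwa [e0]
    exact AddCircle.liftIco_coe_apply (f := fun y => (gaugeDensity L ℓ y : ℂ)) hy'
  have hexp : ∀ (m : ℤ) (x : ℝ), (fourier m (x : AddCircle L) : ℂ) =
      (Real.cos (2 * Real.pi * m / L * x) : ℂ) +
        (Real.sin (2 * Real.pi * m / L * x) : ℂ) * Complex.I := fun m x => by
    rw [fourier_coe_apply, Complex.ofReal_cos, Complex.ofReal_sin, ← Complex.exp_mul_I]
    congr 1
    push_cast
    ring
  have hcoef : ∀ m, fourierCoeff F m = (gaugeCoeff L ℓ m : ℂ) := by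
    intro m
    have hcong : ∫ x in -(L / 2)..L / 2, fourier (-m) (x : AddCircle L) • F x =
        ∫ x in -(L / 2)..L / 2,
          (((gaugeDensity L ℓ x * Real.cos (2 * Real.pi * m / L * x) : ℝ) : ℂ) -
            ((gaugeDensity L ℓ x * Real.sin (2 * Real.pi * m / L * x) : ℝ) : ℂ) * Complex.I) := by
      refine intervalIntegral.integral_congr_Ioo_of_le (by linarith) fun x hx => ?_
      have e : 2 * Real.pi * ((-m : ℤ) : ℝ) / L * x = -(2 * Real.pi * m / L * x) := by
        push_cast; ring
      simp only [hF x (Ioo_subset_Ico_self hx), hexp, e, Real.cos_neg, Real.sin_neg, smul_eq_mul]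
      push_cast
      ring
    have h1 : ∫ x in -(L / 2)..L / 2, gaugeDensity L ℓ x * Real.cos (2 * Real.pi * m / L * x) =
        L * gaugeCoeff L ℓ m := by
      rw [integral_gaugeDensity_mul hℓ hL (g := fun x => Real.cos (2 * Real.pi * m / L * x))
        (by fun_prop), gaugeCoeff, bumpHat]
      simp only [← mul_assoc]
      ring
    have h2 : ∫ x in -(L / 2)..L / 2, gaugeDensity L ℓ x * Real.sin (2 * Real.pi * m / L * x) =
        0 := by
      rw [integral_gaugeDensity_mul hℓ hL (g := fun x => Real.sin (2 * Real.pi * m / L * x))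
        (by fun_prop)]
      simp only [← mul_assoc, integral_bump_mul_sin, mul_zero]
    rw [fourierCoeff_eq_intervalIntegral _ _ (-(L / 2)), e0, hcong, intervalIntegral.integral_sub
      (Continuous.intervalIntegrable (by fun_prop) _ _)
      (Continuous.intervalIntegrable (by fun_prop) _ _), intervalIntegral.integral_mul_const,
      intervalIntegral.integral_ofReal, intervalIntegral.integral_ofReal, h1, h2]
    have hLc : (L : ℂ) ≠ 0 := by exact_mod_cast hL0.ne'
    simp [hLc]
  have hsum : Summable (fourierCoeff F) := by
    refine Summable.of_norm ?_
    simpa [hcoef] using summable_gaugeCoeff hr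
  have main : ∀ y ∈ Ico (-(L / 2)) (L / 2),
      HasSum (fun m : ℤ => gaugeCoeff L ℓ m * Real.cos (2 * Real.pi * m / L * y))
        (gaugeDensity L ℓ y) := by
    intro y hy
    have h := (has_pointwise_sum_fourier_series_of_summable hsum (y : AddCircle L)).mapL
      Complex.reCLM
    convert! h using 1
    · funext m
      rw [hcoef, hexp]
      simp [-Complex.ofReal_cos, -Complex.ofReal_sin]
    · rw [hF y hy]; simp
  rcases eq_or_lt_of_le hy.2 with rfl | h
  · have h := main (-(L / 2)) ⟨le_rfl, by linarith⟩
    rw [hEnd] at h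
    simpa only [mul_neg, Real.cos_neg] using h
  · exact main y ⟨hy.1, h⟩

/-- The Fourier truncation of the gauge density. -/
def gaugeSum (L ℓ : ℝ) (N : ℕ) (y : ℝ) : ℝ :=
  ∑ m ∈ Finset.Icc (-(N : ℤ)) N, gaugeCoeff L ℓ m * Real.cos (2 * Real.pi * m / L * y)

@[fun_prop]
lemma continuous_gaugeSum (N : ℕ) : Continuous (gaugeSum L ℓ N) := by
  unfold gaugeSum; fun_prop

lemma gaugeSum_periodic (hL : L ≠ 0) (N : ℕ) : Function.Periodic (gaugeSum L ℓ N) L := by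
  intro y
  refine Finset.sum_congr rfl fun m _ => ?_
  rw [← Real.cos_add_int_mul_two_pi (2 * Real.pi * m / L * y) m]
  congr 2
  field_simp

lemma abs_gaugeSum_le (hr : 1 ≤ L / (2 * Real.pi * ℓ)) (N : ℕ) (y : ℝ) :
    |gaugeSum L ℓ N y| ≤ 3968 * (L / (2 * Real.pi * ℓ)) := by
  refine (Finset.abs_sum_le_sum_abs _ _).trans (le_trans (Finset.sum_le_sum fun m _ => ?_)
    (sum_abs_gaugeCoeff_le hr (Finset.Icc (-(N : ℤ)) N)))
  rw [abs_mul]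
  exact mul_le_of_le_one_right (abs_nonneg _) (Real.abs_cos_le_one _)

lemma eventually_abs_gaugeSum_sub_le (hℓ : 0 < ℓ) (hL : ℓ ≤ L / 2)
    (hr : 1 ≤ L / (2 * Real.pi * ℓ)) :
    ∀ᶠ N : ℕ in atTop, ∀ y ∈ Icc (-(L / 2)) (L / 2),
      |gaugeSum L ℓ N y - gaugeDensity L ℓ y| ≤ 1 := by
  have h := tendstoUniformly_tsum (summable_gaugeCoeff hr)
    (f := fun (m : ℤ) (y : ℝ) => gaugeCoeff L ℓ m * Real.cos (2 * Real.pi * m / L * y))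
    fun m y => by
      rw [norm_mul]
      exact mul_le_of_le_one_right (abs_nonneg _) (Real.abs_cos_le_one _)
  rw [Metric.tendstoUniformly_iff] at h
  filter_upwards [Finset.tendsto_Icc_neg.eventually (h 1 one_pos)] with N hN y hy
  have h1 := (hN y).le
  rw [(hasSum_gaugeDensity hℓ hL hr hy).tsum_eq, dist_comm, Real.dist_eq] at h1
  exact h1

/-- If `v` has vanishing mean against the profile at `b`, then the Fourier-truncated gauge centred
at `b` is dominated by a quarter of the fourth-order dissipation. The width `ℓ` is chosen such that
the factor `4 L * 2600 ℓ ^ 3` arising from rescaling the profile is at most `1 / 4`. -/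
theorem integral_gaugeSum_mul_sq_le {N : ℕ} {v v' v'' : ℝ → ℝ} {b : ℝ} (hℓ : 0 < ℓ)
    (hL : ℓ ≤ L / 2) (hLℓ : 64000 * ℓ ^ 3 * L = 1)
    (hN : ∀ y ∈ Icc (-(L / 2)) (L / 2), |gaugeSum L ℓ N y - gaugeDensity L ℓ y| ≤ 1)
    (h1 : ∀ s, HasDerivAt v (v' s) s) (h2 : ∀ s, HasDerivAt v' (v'' s) s) (h3 : Continuous v'')
    (hp : Function.Periodic v L) (hp'' : Function.Periodic v'' L)
    (h0 : ∫ s in (-1 : ℝ)..1, bump s * v (b + ℓ * s) = 0) :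
    ∫ x in (0 : ℝ)..L, gaugeSum L ℓ N (x - b) * v x ^ 2 ≤
      1 / 4 * (∫ x in (0 : ℝ)..L, v'' x ^ 2) + ∫ x in (0 : ℝ)..L, v x ^ 2 := by
  have hL0 : 0 < L := by linarith
  have hvc : Continuous v := continuous_iff_continuousAt.2 fun s => (h1 s).continuousAt
  -- recentre the period at `b`
  have shift : ∀ f : ℝ → ℝ, Function.Periodic f L →
      ∫ x in (0 : ℝ)..L, f x = ∫ y in -(L / 2)..L / 2, f (b + y) := by
    intro f hf
    have := hf.intervalIntegral_add_eq 0 (b + -(L / 2))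
    rw [zero_add] at this
    rw [this, intervalIntegral.integral_comp_add_left]
    congr 1; ring
  have hqp := gaugeSum_periodic (ℓ := ℓ) hL0.ne' N
  rw [shift (fun x => gaugeSum L ℓ N (x - b) * v x ^ 2) fun x => by
      simp only [hp x, add_sub_right_comm, hqp (x - b)],
    shift (fun x => v'' x ^ 2) fun x => by simp only [hp'' x],
    shift (fun x => v x ^ 2) fun x => by simp only [hp x]]
  simp only [add_sub_cancel_left]
  -- the truncation error of the gauge is at most `1`
  have step1 : ∫ y in -(L / 2)..L / 2, gaugeSum L ℓ N y * v (b + y) ^ 2 ≤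
      (∫ y in -(L / 2)..L / 2, gaugeDensity L ℓ y * v (b + y) ^ 2) +
        ∫ y in -(L / 2)..L / 2, v (b + y) ^ 2 := by
    rw [← intervalIntegral.integral_add (Continuous.intervalIntegrable (by fun_prop) _ _)
      (Continuous.intervalIntegrable (by fun_prop) _ _)]
    refine intervalIntegral.integral_mono_on (by linarith)
      (Continuous.intervalIntegrable (by fun_prop) _ _)
      (Continuous.intervalIntegrable (by fun_prop) _ _) fun y hy => ?_
    have := (abs_le.1 (hN y hy)).2
    nlinarith [sq_nonneg (v (b + y))]
  have step2 : ∫ y in -(L / 2)..L / 2, gaugeDensity L ℓ y * v (b + y) ^ 2 ≤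
      1 / 4 * ∫ y in -(L / 2)..L / 2, v'' (b + y) ^ 2 := by
    rw [integral_gaugeDensity_mul hℓ hL (g := fun y => v (b + y) ^ 2) (by fun_prop)]
    have hl : ∀ s, HasDerivAt (fun s => b + ℓ * s) ℓ s := fun s => by
      simpa using ((hasDerivAt_id s).const_mul ℓ).const_add b
    have hb := integral_bump_mul_sq_le (w := fun s => v (b + ℓ * s))
      (w' := fun s => v' (b + ℓ * s) * ℓ) (w'' := fun s => v'' (b + ℓ * s) * ℓ * ℓ)
      (fun s => (h1 _).comp s (hl s))
      (fun s => ((h2 _).comp s (hl s)).mul_const ℓ) (by fun_prop) h0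
    have e : ∫ s in (-1 : ℝ)..1, (v'' (b + ℓ * s) * ℓ * ℓ) ^ 2 =
        ℓ ^ 3 * ∫ y in -ℓ..ℓ, v'' (b + y) ^ 2 := by
      have h := intervalIntegral.smul_integral_comp_mul_left (a := (-1 : ℝ)) (b := 1)
        (fun y => v'' (b + y) ^ 2) ℓ
      rw [mul_neg, mul_one] at h
      rw [← h, smul_eq_mul, ← intervalIntegral.integral_const_mul,
        ← intervalIntegral.integral_const_mul]
      refine intervalIntegral.integral_congr fun s _ => ?_
      ring
    rw [e] at hb
    have hmono : ∫ y in -ℓ..ℓ, v'' (b + y) ^ 2 ≤ ∫ y in -(L / 2)..L / 2, v'' (b + y) ^ 2 :=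
      intervalIntegral.integral_mono_interval (by linarith) (by linarith) hL
        (Eventually.of_forall fun y => sq_nonneg _)
        (Continuous.intervalIntegrable (by fun_prop) _ _)
    have hnn : 0 ≤ ∫ y in -(L / 2)..L / 2, v'' (b + y) ^ 2 :=
      intervalIntegral.integral_nonneg (by linarith) fun y _ => sq_nonneg _
    set A := ∫ s in (-1 : ℝ)..1, bump s * v (b + ℓ * s) ^ 2
    set X := ∫ y in -ℓ..ℓ, v'' (b + y) ^ 2
    set Y := ∫ y in -(L / 2)..L / 2, v'' (b + y) ^ 2
    calc 4 * L * A ≤ 4 * L * (2600 * (ℓ ^ 3 * X)) := by gcongr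
      _ = 13 / 80 * (64000 * ℓ ^ 3 * L) * X := by ring
      _ ≤ 1 / 4 * Y := by rw [hLℓ]; linarith
  linarith

end

section

variable {Lx Ly : ℝ}

/-! ### Trigonometric polynomials -/

/-- The trigonometric polynomial with frequencies in `s` and coefficients `a`. -/
def modeSum (Lx Ly : ℝ) (s : Finset (ℤ × ℤ)) (a : ℤ × ℤ → ℝ) (p : ℝ × ℝ) : ℝ :=
  ∑ k ∈ s, a k * mode Lx Ly k p

/-- As `modeSum`, with the reflected modes; the derivatives of `modeSum` have this form. -/
def negModeSum (Lx Ly : ℝ) (s : Finset (ℤ × ℤ)) (a : ℤ × ℤ → ℝ) (p : ℝ × ℝ) : ℝ :=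
  ∑ k ∈ s, a k * mode Lx Ly (-k) p

lemma isTest_modeSum (hx : Lx ≠ 0) (hy : Ly ≠ 0) (s : Finset (ℤ × ℤ)) (a : ℤ × ℤ → ℝ) :
    IsTest Lx Ly (modeSum Lx Ly s a) where
  smooth := ContDiff.sum fun k _ => contDiff_const.mul (contDiff_mode k)
  periodic_x x y := Finset.sum_congr rfl fun k _ => by rw [mode_add_x hx]
  periodic_y x y := Finset.sum_congr rfl fun k _ => by rw [mode_add_y hy]

@[fun_prop]
lemma continuous_modeSum (s : Finset (ℤ × ℤ)) (a : ℤ × ℤ → ℝ) :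
    Continuous (modeSum Lx Ly s a) := by
  unfold modeSum; fun_prop

lemma pderiv_modeSum (hx : Lx ≠ 0) (hy : Ly ≠ 0) (i : Fin 2) (s : Finset (ℤ × ℤ))
    (a : ℤ × ℤ → ℝ) :
    pderiv i (modeSum Lx Ly s a) = negModeSum Lx Ly s fun k => a k * wave Lx Ly k i := by
  funext p
  have hd : ∀ k, Differentiable ℝ fun p => a k * mode Lx Ly k p := fun k =>
    ((isTest_mode hx hy k).const_mul (a k)).differentiable
  rw [pderiv_eq_fderiv (isTest_modeSum hx hy s a).differentiable]
  unfold modeSum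
  rw [fderiv_fun_sum fun k _ => hd k p, sum_apply]
  refine Finset.sum_congr rfl fun k _ => ?_
  rw [← pderiv_eq_fderiv (hd k), pderiv_const_mul, pderiv_mode, mul_assoc]

/-- Parseval's identity for trigonometric polynomials, with the modes relabelled by `e`. -/
lemma integral_sum_mode_sq (hx : 0 < Lx) (hy : 0 < Ly) {e : ℤ × ℤ → ℤ × ℤ}
    (he : Function.Injective e) (s : Finset (ℤ × ℤ)) (a : ℤ × ℤ → ℝ) :
    ∫ p in rect Lx Ly, (∑ k ∈ s, a k * mode Lx Ly (e k) p) ^ 2 = Lx * Ly * ∑ k ∈ s, a k ^ 2 := by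
  have h1 : ∀ p, (∑ k ∈ s, a k * mode Lx Ly (e k) p) ^ 2 =
      ∑ k ∈ s, ∑ l ∈ s, a k * a l * (mode Lx Ly (e k) p * mode Lx Ly (e l) p) := fun p => by
    rw [sq, Finset.sum_mul_sum]
    exact Finset.sum_congr rfl fun k _ => Finset.sum_congr rfl fun l _ => by ring
  simp_rw [h1]
  rw [integral_finsetSum _ fun k _ => integrable_of_continuous (by fun_prop), Finset.mul_sum]
  refine Finset.sum_congr rfl fun k hk => ?_
  rw [integral_finsetSum _ fun l _ => integrable_of_continuous (by fun_prop)]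
  simp only [integral_const_mul, integral_mode_mul_mode hx hy, he.eq_iff, mul_ite, mul_zero,
    Finset.sum_ite_eq, hk, if_true]
  ring

lemma integral_modeSum_sq (hx : 0 < Lx) (hy : 0 < Ly) (s : Finset (ℤ × ℤ)) (a : ℤ × ℤ → ℝ) :
    ∫ p in rect Lx Ly, modeSum Lx Ly s a p ^ 2 = Lx * Ly * ∑ k ∈ s, a k ^ 2 :=
  integral_sum_mode_sq hx hy Function.injective_id s a

lemma integral_negModeSum_sq (hx : 0 < Lx) (hy : 0 < Ly) (s : Finset (ℤ × ℤ)) (a : ℤ × ℤ → ℝ) :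
    ∫ p in rect Lx Ly, negModeSum Lx Ly s a p ^ 2 = Lx * Ly * ∑ k ∈ s, a k ^ 2 :=
  integral_sum_mode_sq hx hy neg_injective s a

/-- A mode which oscillates in `y` has vanishing `y`-averages. -/
lemma integral_axis_mul_mode (hx : 0 < Lx) (hy : 0 < Ly) {f : ℝ → ℝ} (hf : Continuous f)
    {k : ℤ × ℤ} (hk : k.2 ≠ 0) : ∫ p in rect Lx Ly, f p.1 * mode Lx Ly k p = 0 := by
  rw [integral_rect hx.le hy.le (by fun_prop)]
  have h : ∀ x, ∫ y in (0 : ℝ)..Ly, f x * mode Lx Ly k (x, y) = 0 := fun x => by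
    have := integral_cas hy (wave Lx Ly k 0 * x) k.2
    rw [if_neg hk] at this
    rw [intervalIntegral.integral_const_mul, mul_eq_zero]
    right
    simpa [mode, wave] using this
  simp [h]

lemma integral_axis_mul_modeSum (hx : 0 < Lx) (hy : 0 < Ly) {f : ℝ → ℝ} (hf : Continuous f)
    {s : Finset (ℤ × ℤ)} (hs : ∀ k ∈ s, k.2 ≠ 0) (a : ℤ × ℤ → ℝ) :
    ∫ p in rect Lx Ly, f p.1 * modeSum Lx Ly s a p = 0 := by
  unfold modeSum
  simp_rw [Finset.mul_sum, mul_left_comm (f _)]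
  rw [integral_finsetSum _ fun k _ => integrable_of_continuous (by fun_prop)]
  refine Finset.sum_eq_zero fun k hk => ?_
  rw [integral_const_mul, integral_axis_mul_mode hx hy hf (hs k hk), mul_zero]

lemma integral_axis_mul_negModeSum (hx : 0 < Lx) (hy : 0 < Ly) {f : ℝ → ℝ} (hf : Continuous f)
    {s : Finset (ℤ × ℤ)} (hs : ∀ k ∈ s, k.2 ≠ 0) (a : ℤ × ℤ → ℝ) :
    ∫ p in rect Lx Ly, f p.1 * negModeSum Lx Ly s a p = 0 := by
  unfold negModeSum
  simp_rw [Finset.mul_sum, mul_left_comm (f _)]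
  rw [integral_finsetSum _ fun k _ => integrable_of_continuous (by fun_prop)]
  refine Finset.sum_eq_zero fun k hk => ?_
  rw [integral_const_mul, integral_axis_mul_mode hx hy hf (by simpa using hs k hk), mul_zero]

lemma abs_integral_mul_mul_le {f g h : ℝ × ℝ → ℝ} (hf : Continuous f) (hg : Continuous g)
    (hh : Continuous h) {M A B : ℝ} (hA : 0 ≤ A) (hB : 0 ≤ B) (hM : ∀ p, |f p| ≤ M)
    (h1 : ∫ p in rect Lx Ly, g p ^ 2 ≤ A ^ 2) (h2 : ∫ p in rect Lx Ly, h p ^ 2 ≤ B ^ 2) :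
    |∫ p in rect Lx Ly, f p * g p * h p| ≤ M * (A * B) := by
  have hM0 : 0 ≤ M := (abs_nonneg _).trans (hM 0)
  have hol := integral_mul_norm_le_Lp_mul_Lq (μ := rectMeasure Lx Ly) (f := g) (g := h)
    (p := 2) (q := 2) ⟨by norm_num, by norm_num, by norm_num⟩
    (memLp_of_continuous hg _) (memLp_of_continuous hh _)
  simp only [Real.norm_eq_abs, Real.rpow_two, sq_abs, ← Real.sqrt_eq_rpow] at hol
  have hg' : √(∫ p in rect Lx Ly, g p ^ 2) ≤ A := Real.sqrt_le_iff.2 ⟨hA, h1⟩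
  have hh' : √(∫ p in rect Lx Ly, h p ^ 2) ≤ B := Real.sqrt_le_iff.2 ⟨hB, h2⟩
  calc |∫ p in rect Lx Ly, f p * g p * h p| ≤ ∫ p in rect Lx Ly, |f p * g p * h p| :=
        abs_integral_le_integral_abs
    _ ≤ ∫ p in rect Lx Ly, M * (|g p| * |h p|) := by
        refine integral_mono (integrable_of_continuous (by fun_prop))
          (integrable_of_continuous (by fun_prop)) fun p => ?_
        simp only [abs_mul, mul_assoc]
        exact mul_le_mul_of_nonneg_right (hM p) (by positivity)
    _ = M * ∫ p in rect Lx Ly, |g p| * |h p| := integral_const_mul _ _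
    _ ≤ M * (A * B) := by
        refine mul_le_mul_of_nonneg_left (hol.trans ?_) hM0
        exact mul_le_mul hg' hh' (Real.sqrt_nonneg _) hA

/-! ### The transversal modes -/

/-- A mode that oscillates in `y` has a wave vector of length at least `2 π / Ly`; the constant is
`36 ≤ (2 π) ^ 2`. -/
lemma waveSq_ge_of_ne (hx : 0 < Lx) (hy : 0 < Ly) {k : ℤ × ℤ} (hk : k.2 ≠ 0) :
    36 ≤ Ly ^ 2 * waveSq Lx Ly k := by
  have h1 : (1 : ℝ) ≤ (k.2 : ℝ) ^ 2 := by
    have : (1 : ℤ) ≤ k.2 ^ 2 := by have : 0 < k.2 ^ 2 := by positivity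
                                   omega
    exact_mod_cast this
  have e : Ly ^ 2 * waveSq Lx Ly k =
      (Ly * wave Lx Ly k 0) ^ 2 + 4 * Real.pi ^ 2 * (k.2 : ℝ) ^ 2 := by
    simp only [waveSq, wave, Fin.isValue, if_true, one_ne_zero, if_false]
    field_simp
    ring
  rw [e]
  have := Real.pi_gt_three
  nlinarith [sq_nonneg (Ly * wave Lx Ly k 0)]

/-- In a thin rectangle the sum of `|κ|⁻⁴` over the modes that oscillate in the thin direction
is as small as the thin direction alone would suggest. -/
lemma sum_inv_waveSq_sq_le (hx : 0 < Lx) (hy : 0 < Ly) (hxy : Ly ≤ Lx) {s : Finset (ℤ × ℤ)}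
    (hs : ∀ k ∈ s, k.2 ≠ 0) : ∑ k ∈ s, (waveSq Lx Ly k ^ 2)⁻¹ ≤ Lx * Ly ^ 3 / 10 := by
  classical
  set α := 2 * Real.pi / Lx with hα
  set β := 2 * Real.pi / Ly with hβ
  have hα0 : 0 < α := by positivity
  have hβ0 : 0 < β := by positivity
  have hαβ : α ≤ β := by
    rw [hα, hβ]; gcongr
  have hw : ∀ k : ℤ × ℤ, waveSq Lx Ly k = (α * k.1) ^ 2 + (β * k.2) ^ 2 := fun k => by
    simp only [waveSq, wave, Fin.isValue, if_true, one_ne_zero, if_false, hα, hβ]; ring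
  -- the sum is enlarged to a product set and evaluated first along `x`
  set A := s.image Prod.fst
  set B := s.image Prod.snd
  have hB : ∀ n ∈ B, n ≠ 0 := fun n hn => by
    obtain ⟨k, hk, rfl⟩ := Finset.mem_image.1 hn
    exact hs k hk
  have hsub : s ⊆ A ×ˢ B := fun k hk =>
    Finset.mem_product.2 ⟨Finset.mem_image_of_mem _ hk, Finset.mem_image_of_mem _ hk⟩
  have inner : ∀ n ∈ B, ∑ m ∈ A, (waveSq Lx Ly (m, n) ^ 2)⁻¹ ≤
      16 / (α * β ^ 3) * (1 + ((n : ℝ) / 1) ^ 2)⁻¹ := by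
    intro n hn
    have hn1 : (1 : ℝ) ≤ |(n : ℝ)| := by
      have := Int.one_le_abs (hB n hn)
      exact_mod_cast this
    set ν := |(n : ℝ)|
    have hν2 : (n : ℝ) ^ 2 = ν ^ 2 := (sq_abs _).symm
    set r := β * ν / α with hr
    have hr1 : 1 ≤ r := by
      rw [hr, one_le_div hα0]; nlinarith
    have term : ∀ m ∈ A, (waveSq Lx Ly (m, n) ^ 2)⁻¹ ≤
        ((β * ν) ^ 4)⁻¹ * (1 + ((m : ℝ) / r) ^ 2)⁻¹ := by
      intro m _
      rw [← mul_inv]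
      refine inv_anti₀ (by positivity) ?_
      have e : (β * ν) ^ 4 * (1 + ((m : ℝ) / r) ^ 2) =
          (β * ν) ^ 2 * ((α * m) ^ 2 + (β * ν) ^ 2) := by
        rw [hr]; field_simp; ring
      rw [e, hw, sq ((α * _) ^ 2 + _)]
      simp only [mul_pow, hν2]
      have h1 : 0 ≤ α ^ 2 * (m : ℝ) ^ 2 := by positivity
      have h2 : 0 ≤ β ^ 2 * ν ^ 2 := by positivity
      nlinarith
    refine (Finset.sum_le_sum term).trans ?_
    rw [← Finset.mul_sum]
    calc ((β * ν) ^ 4)⁻¹ * ∑ m ∈ A, (1 + ((m : ℝ) / r) ^ 2)⁻¹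
        ≤ ((β * ν) ^ 4)⁻¹ * (8 * r) := by
          gcongr; exact sum_inv_one_add_sq_le hr1 A
      _ = 8 / (α * β ^ 3) * (ν ^ 3)⁻¹ := by rw [hr]; field_simp
      _ ≤ 8 / (α * β ^ 3) * (2 * (1 + ((n : ℝ) / 1) ^ 2)⁻¹) := by
          refine mul_le_mul_of_nonneg_left ?_ (by positivity)
          rw [div_one, hν2, ← div_eq_mul_inv, inv_eq_one_div, div_le_div_iff₀ (by positivity)
            (by positivity)]
          nlinarith [mul_nonneg (sub_nonneg.2 hn1) (sq_nonneg ν)]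
      _ = _ := by ring
  calc ∑ k ∈ s, (waveSq Lx Ly k ^ 2)⁻¹ ≤ ∑ k ∈ A ×ˢ B, (waveSq Lx Ly k ^ 2)⁻¹ :=
        Finset.sum_le_sum_of_subset_of_nonneg hsub fun k _ _ => by positivity
    _ = ∑ n ∈ B, ∑ m ∈ A, (waveSq Lx Ly (m, n) ^ 2)⁻¹ := Finset.sum_product_right _ _ _
    _ ≤ ∑ n ∈ B, 16 / (α * β ^ 3) * (1 + ((n : ℝ) / 1) ^ 2)⁻¹ := Finset.sum_le_sum inner
    _ ≤ 16 / (α * β ^ 3) * (8 * 1) := by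
        rw [← Finset.mul_sum]
        gcongr
        exact sum_inv_one_add_sq_le le_rfl B
    _ = 8 / Real.pi ^ 4 * (Lx * Ly ^ 3) := by
        rw [hα, hβ]; field_simp; norm_num
    _ ≤ 1 / 10 * (Lx * Ly ^ 3) := by
        refine mul_le_mul_of_nonneg_right ?_ (by positivity)
        rw [div_le_div_iff₀ (by positivity) (by norm_num)]
        have h3 := Real.pi_gt_three
        have : (3 : ℝ) ^ 4 ≤ Real.pi ^ 4 := by gcongr
        linarith
    _ = _ := by ring

lemma dirCoeff_sq_le (hx : 0 < Lx) (hy : 0 < Ly) {k : ℤ × ℤ} (hk : k ≠ 0) (i : Fin 2) :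
    Lx * Ly * dirCoeff Lx Ly k i ^ 2 ≤ 1 := by
  have h := dirCoeff_sq hx hy hk
  have hA : 0 < Lx * Ly := by positivity
  have h' : Lx * Ly * (dirCoeff Lx Ly k 0 ^ 2 + dirCoeff Lx Ly k 1 ^ 2) = 1 := by
    rw [h]; field_simp
  fin_cases i
  · simp only [Fin.zero_eta, Fin.isValue]
    nlinarith [mul_nonneg hA.le (sq_nonneg (dirCoeff Lx Ly k 1))]
  · simp only [Fin.mk_one, Fin.isValue]
    nlinarith [mul_nonneg hA.le (sq_nonneg (dirCoeff Lx Ly k 0))]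

/-- The transversal part of a field is bounded pointwise by its second derivatives, with a constant
of the order of the thin side. -/
lemma abs_modeSum_dirCoeff_le (hx : 0 < Lx) (hy : 0 < Ly) (hxy : Ly ≤ Lx) {s : Finset (ℤ × ℤ)}
    (hs : ∀ k ∈ s, k.2 ≠ 0) (c : ℤ × ℤ → ℝ) (i : Fin 2) (p : ℝ × ℝ) :
    |modeSum Lx Ly s (fun k => c k * dirCoeff Lx Ly k i) p| ≤
      Ly / 2 * √(∑ k ∈ s, waveSq Lx Ly k ^ 2 * c k ^ 2) := by
  set S := ∑ k ∈ s, waveSq Lx Ly k ^ 2 * c k ^ 2 with hS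
  have hS0 : 0 ≤ S := Finset.sum_nonneg fun k _ => by positivity
  have hA : 0 < Lx * Ly := by positivity
  have hs0 : ∀ k ∈ s, k ≠ 0 := fun k hk h => hs k hk (by simp [h])
  have hcs := Finset.sum_mul_sq_le_sq_mul_sq s (fun k => waveSq Lx Ly k * c k)
    (fun k => (waveSq Lx Ly k)⁻¹ * (dirCoeff Lx Ly k i * mode Lx Ly k p))
  have e1 : ∑ k ∈ s, waveSq Lx Ly k * c k *
      ((waveSq Lx Ly k)⁻¹ * (dirCoeff Lx Ly k i * mode Lx Ly k p)) =
      modeSum Lx Ly s (fun k => c k * dirCoeff Lx Ly k i) p := by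
    refine Finset.sum_congr rfl fun k hk => ?_
    have := (waveSq_pos hx hy (hs0 k hk)).ne'
    field_simp
  have e2 : ∑ k ∈ s, (waveSq Lx Ly k * c k) ^ 2 = S :=
    Finset.sum_congr rfl fun k _ => mul_pow _ _ _
  have e3 : ∑ k ∈ s, ((waveSq Lx Ly k)⁻¹ * (dirCoeff Lx Ly k i * mode Lx Ly k p)) ^ 2 ≤
      9 / 40 * Ly ^ 2 := by
    calc _ ≤ ∑ k ∈ s, 9 / 4 / (Lx * Ly) * (waveSq Lx Ly k ^ 2)⁻¹ := by
          refine Finset.sum_le_sum fun k hk => ?_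
          have h1 := dirCoeff_sq_le hx hy (hs0 k hk) i
          have h2 : mode Lx Ly k p ^ 2 ≤ 9 / 4 := by
            have := sq_le_sq' (abs_le.1 (abs_mode_le (Lx := Lx) (Ly := Ly) k p)).1
              (abs_le.1 (abs_mode_le (Lx := Lx) (Ly := Ly) k p)).2
            linarith
          have h3 : dirCoeff Lx Ly k i ^ 2 * mode Lx Ly k p ^ 2 ≤ 9 / 4 / (Lx * Ly) := by
            rw [le_div_iff₀ hA]
            nlinarith [sq_nonneg (dirCoeff Lx Ly k i), sq_nonneg (mode Lx Ly k p),
              mul_nonneg hA.le (sq_nonneg (dirCoeff Lx Ly k i))]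
          rw [mul_pow, mul_pow, inv_pow, mul_comm]
          exact mul_le_mul_of_nonneg_right h3 (by positivity)
      _ ≤ 9 / 4 / (Lx * Ly) * (Lx * Ly ^ 3 / 10) := by
          rw [← Finset.mul_sum]
          gcongr
          exact sum_inv_waveSq_sq_le hx hy hxy hs
      _ = 9 / 40 * Ly ^ 2 := by field_simp; norm_num
  rw [e1, e2] at hcs
  refine abs_le_of_sq_le_sq ?_ (by positivity)
  rw [mul_pow, Real.sq_sqrt hS0]
  nlinarith [mul_le_mul_of_nonneg_left e3 hS0, mul_nonneg hS0 (sq_nonneg Ly)]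

end

section

variable {Lx Ly : ℝ}

/-! ### The cubic term -/

/-- The components of the field with coefficients `c` along the gradient modes in `s`. -/
def comp (Lx Ly : ℝ) (s : Finset (ℤ × ℤ)) (c : ℤ × ℤ → ℝ) (i : Fin 2) : ℝ × ℝ → ℝ :=
  modeSum Lx Ly s fun k => c k * dirCoeff Lx Ly k i

/-- The divergence of the field with coefficients `c` along the gradient modes in `s`. -/
def divSum (Lx Ly : ℝ) (s : Finset (ℤ × ℤ)) (c : ℤ × ℤ → ℝ) (p : ℝ × ℝ) : ℝ :=
  ∑ k ∈ s, c k * divMode Lx Ly k p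

/-- The pointwise squared length of the field with coefficients `c` along the modes in `s`. -/
def fieldSq (Lx Ly : ℝ) (s : Finset (ℤ × ℤ)) (c : ℤ × ℤ → ℝ) (p : ℝ × ℝ) : ℝ :=
  comp Lx Ly s c 0 p ^ 2 + comp Lx Ly s c 1 p ^ 2

/-- The frequencies in `s` which depend on `x` only. -/
def axial (s : Finset (ℤ × ℤ)) : Finset (ℤ × ℤ) := s.filter fun k => k.2 = 0

/-- The frequencies in `s` which oscillate in `y`. -/
def transversal (s : Finset (ℤ × ℤ)) : Finset (ℤ × ℤ) := s.filter fun k => ¬k.2 = 0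

variable {s : Finset (ℤ × ℤ)} {c : ℤ × ℤ → ℝ}

@[fun_prop]
lemma continuous_comp (i : Fin 2) : Continuous (comp Lx Ly s c i) := by unfold comp; fun_prop

@[fun_prop]
lemma continuous_divSum : Continuous (divSum Lx Ly s c) := by unfold divSum; fun_prop

@[fun_prop]
lemma continuous_fieldSq : Continuous (fieldSq Lx Ly s c) := by unfold fieldSq; fun_prop

lemma divSum_eq : divSum Lx Ly s c =
    negModeSum Lx Ly s fun k => c k * (√(waveSq Lx Ly k) / √(Lx * Ly)) := by
  funext p
  exact Finset.sum_congr rfl fun k _ => by rw [divMode, mul_assoc]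

lemma comp_eq_add (i : Fin 2) (p : ℝ × ℝ) : comp Lx Ly s c i p =
    comp Lx Ly (axial s) c i p + comp Lx Ly (transversal s) c i p :=
  (Finset.sum_filter_add_sum_filter_not s _ _).symm

lemma divSum_eq_add (p : ℝ × ℝ) : divSum Lx Ly s c p =
    divSum Lx Ly (axial s) c p + divSum Lx Ly (transversal s) c p :=
  (Finset.sum_filter_add_sum_filter_not s _ _).symm

lemma wave_one_of_eq {k : ℤ × ℤ} (hk : k.2 = 0) : wave Lx Ly k 1 = 0 := by simp [wave, hk]

lemma dirCoeff_one_of_eq {k : ℤ × ℤ} (hk : k.2 = 0) : dirCoeff Lx Ly k 1 = 0 := by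
  simp [dirCoeff, wave_one_of_eq hk]

lemma mode_of_eq {k : ℤ × ℤ} (hk : k.2 = 0) (p : ℝ × ℝ) :
    mode Lx Ly k p = cas (wave Lx Ly k 0 * p.1) := by
  simp [mode, wave_one_of_eq hk]

lemma comp_axial_one (p : ℝ × ℝ) : comp Lx Ly (axial s) c 1 p = 0 :=
  Finset.sum_eq_zero fun k hk => by
    beta_reduce
    rw [dirCoeff_one_of_eq (Finset.mem_filter.1 hk).2, mul_zero, zero_mul]

/-- The axial part of a trigonometric polynomial, as a function of `x`. -/
def axisSum (Lx Ly : ℝ) (s : Finset (ℤ × ℤ)) (a : ℤ × ℤ → ℝ) (x : ℝ) : ℝ :=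
  ∑ k ∈ axial s, a k * cas (wave Lx Ly k 0 * x)

@[fun_prop]
lemma continuous_axisSum {a : ℤ × ℤ → ℝ} : Continuous (axisSum Lx Ly s a) := by
  have := continuous_cas
  unfold axisSum; fun_prop

lemma modeSum_axial (a : ℤ × ℤ → ℝ) (p : ℝ × ℝ) :
    modeSum Lx Ly (axial s) a p = axisSum Lx Ly s a p.1 :=
  Finset.sum_congr rfl fun k hk => by rw [mode_of_eq (Finset.mem_filter.1 hk).2]

lemma comp_axial_zero (p : ℝ × ℝ) : comp Lx Ly (axial s) c 0 p =
    axisSum Lx Ly s (fun k => c k * dirCoeff Lx Ly k 0) p.1 := modeSum_axial _ _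

lemma isTest_comp (hx : Lx ≠ 0) (hy : Ly ≠ 0) (i : Fin 2) : IsTest Lx Ly (comp Lx Ly s c i) :=
  isTest_modeSum hx hy _ _

lemma pderiv_comp_axial (hx : 0 < Lx) (hy : 0 < Ly) (hs : ∀ k ∈ s, k ≠ 0) :
    pderiv 0 (comp Lx Ly (axial s) c 0) = divSum Lx Ly (axial s) c := by
  rw [comp, pderiv_modeSum hx.ne' hy.ne', divSum_eq]
  funext p
  refine Finset.sum_congr rfl fun k hk => ?_
  obtain ⟨h1, h2⟩ := Finset.mem_filter.1 hk
  beta_reduce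
  rw [← dirCoeff_mul_wave hx hy (hs k h1), dirCoeff_one_of_eq h2]
  ring

/-- The divergence of the axial part is also a function of `x` alone. -/
lemma divSum_axial (p : ℝ × ℝ) :
    divSum Lx Ly (axial s) c p = divSum Lx Ly (axial s) c (p.1, 0) := by
  refine Finset.sum_congr rfl fun k hk => ?_
  have : (-k).2 = 0 := by simpa using (Finset.mem_filter.1 hk).2
  rw [divMode, divMode, mode_of_eq this, mode_of_eq this]

lemma transversal_ne {k : ℤ × ℤ} (hk : k ∈ transversal s) : k.2 ≠ 0 := (Finset.mem_filter.1 hk).2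

lemma integral_comp_sq_le (hx : 0 < Lx) (hy : 0 < Ly) (hs : ∀ k ∈ s, k ≠ 0) (i : Fin 2) :
    ∫ p in rect Lx Ly, comp Lx Ly s c i p ^ 2 ≤ ∑ k ∈ s, c k ^ 2 := by
  rw [comp, integral_modeSum_sq hx hy, Finset.mul_sum]
  refine Finset.sum_le_sum fun k hk => ?_
  have := dirCoeff_sq_le hx hy (hs k hk) i
  nlinarith [sq_nonneg (c k)]

lemma integral_comp_sq_add (hx : 0 < Lx) (hy : 0 < Ly) (hs : ∀ k ∈ s, k ≠ 0) :
    (∫ p in rect Lx Ly, comp Lx Ly s c 0 p ^ 2) + ∫ p in rect Lx Ly, comp Lx Ly s c 1 p ^ 2 =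
      ∑ k ∈ s, c k ^ 2 := by
  rw [comp, comp, integral_modeSum_sq hx hy, integral_modeSum_sq hx hy, ← mul_add,
    ← Finset.sum_add_distrib, Finset.mul_sum]
  refine Finset.sum_congr rfl fun k hk => ?_
  rw [mul_pow, mul_pow, ← mul_add, dirCoeff_sq hx hy (hs k hk)]
  field_simp

lemma integral_fieldSq (hx : 0 < Lx) (hy : 0 < Ly) (hs : ∀ k ∈ s, k ≠ 0) :
    ∫ p in rect Lx Ly, fieldSq Lx Ly s c p = ∑ k ∈ s, c k ^ 2 := by
  rw [← integral_comp_sq_add hx hy hs]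
  exact integral_add (integrable_of_continuous (by fun_prop))
    (integrable_of_continuous (by fun_prop))

lemma integral_divSum_sq (hx : 0 < Lx) (hy : 0 < Ly) :
    ∫ p in rect Lx Ly, divSum Lx Ly s c p ^ 2 = ∑ k ∈ s, waveSq Lx Ly k * c k ^ 2 := by
  have hA : 0 < Lx * Ly := by positivity
  rw [divSum_eq, integral_negModeSum_sq hx hy, Finset.mul_sum]
  refine Finset.sum_congr rfl fun k _ => ?_
  rw [mul_pow, div_pow, Real.sq_sqrt (waveSq_nonneg k), Real.sq_sqrt hA.le]
  field_simp

lemma integral_pderiv_comp_sq_le (hx : 0 < Lx) (hy : 0 < Ly) (hs : ∀ k ∈ s, k ≠ 0) (i : Fin 2) :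
    ∫ p in rect Lx Ly, pderiv 0 (comp Lx Ly s c i) p ^ 2 ≤ ∑ k ∈ s, waveSq Lx Ly k * c k ^ 2 := by
  rw [comp, pderiv_modeSum hx.ne' hy.ne', integral_negModeSum_sq hx hy, Finset.mul_sum]
  refine Finset.sum_le_sum fun k hk => ?_
  have h1 := dirCoeff_sq_le hx hy (hs k hk) i
  have h2 : wave Lx Ly k 0 ^ 2 ≤ waveSq Lx Ly k := by
    unfold waveSq; nlinarith [sq_nonneg (wave Lx Ly k 1)]
  calc Lx * Ly * (c k * dirCoeff Lx Ly k i * wave Lx Ly k 0) ^ 2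
      = (Lx * Ly * dirCoeff Lx Ly k i ^ 2) * (wave Lx Ly k 0 ^ 2 * c k ^ 2) := by ring
    _ ≤ 1 * (waveSq Lx Ly k * c k ^ 2) := by gcongr
    _ = _ := one_mul _

lemma sum_waveSq_transversal_le (hx : 0 < Lx) (hy : 0 < Ly) :
    ∑ k ∈ transversal s, waveSq Lx Ly k * c k ^ 2 ≤
      (Ly / 6 * √(∑ k ∈ transversal s, waveSq Lx Ly k ^ 2 * c k ^ 2)) ^ 2 := by
  rw [mul_pow, Real.sq_sqrt (Finset.sum_nonneg fun k _ => by positivity), Finset.mul_sum]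
  refine Finset.sum_le_sum fun k hk => ?_
  have h := waveSq_ge_of_ne hx hy (transversal_ne hk)
  have : 0 ≤ waveSq Lx Ly k * c k ^ 2 := mul_nonneg (waveSq_nonneg k) (sq_nonneg _)
  nlinarith [mul_le_mul_of_nonneg_right h this]

lemma sum_transversal_le (hx : 0 < Lx) (hy : 0 < Ly) :
    ∑ k ∈ transversal s, c k ^ 2 ≤
      Ly ^ 4 / 1296 * ∑ k ∈ transversal s, waveSq Lx Ly k ^ 2 * c k ^ 2 := by
  rw [Finset.mul_sum]
  refine Finset.sum_le_sum fun k hk => ?_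
  have h := waveSq_ge_of_ne hx hy (transversal_ne hk)
  have h2 : 1296 ≤ (Ly ^ 2 * waveSq Lx Ly k) ^ 2 := by nlinarith
  have : 0 ≤ c k ^ 2 := sq_nonneg _
  nlinarith [mul_le_mul_of_nonneg_right h2 this]

/-- For a weight depending on `x` only, the axial and transversal parts decouple. -/
lemma integral_axis_mul_fieldSq (hx : 0 < Lx) (hy : 0 < Ly) {f : ℝ → ℝ} (hf : Continuous f) :
    ∫ p in rect Lx Ly, f p.1 * fieldSq Lx Ly s c p =
      (∫ p in rect Lx Ly, f p.1 * comp Lx Ly (axial s) c 0 p ^ 2) +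
        ∫ p in rect Lx Ly, f p.1 * fieldSq Lx Ly (transversal s) c p := by
  have hz : ∫ p in rect Lx Ly, (2 * f p.1 *
      axisSum Lx Ly s (fun k => c k * dirCoeff Lx Ly k 0) p.1) *
        comp Lx Ly (transversal s) c 0 p = 0 :=
    integral_axis_mul_modeSum hx hy (f := fun x => 2 * f x *
      axisSum Lx Ly s (fun k => c k * dirCoeff Lx Ly k 0) x) (by fun_prop)
      (fun k hk => transversal_ne hk) _
  have e : ∀ p, f p.1 * fieldSq Lx Ly s c p = (f p.1 * comp Lx Ly (axial s) c 0 p ^ 2 +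
      f p.1 * fieldSq Lx Ly (transversal s) c p) + (2 * f p.1 *
      axisSum Lx Ly s (fun k => c k * dirCoeff Lx Ly k 0) p.1) *
        comp Lx Ly (transversal s) c 0 p := fun p => by
    rw [fieldSq, comp_eq_add 0 p, comp_eq_add 1 p, comp_axial_one, ← comp_axial_zero, fieldSq]
    ring
  simp_rw [e]
  rw [integral_add (integrable_of_continuous (by fun_prop))
    (integrable_of_continuous (by fun_prop)),
    hz, add_zero]
  exact integral_add (integrable_of_continuous (by fun_prop))
    (integrable_of_continuous (by fun_prop))

/-- The cubic term only sees interactions with the transversal part: the purely axial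
contribution is a total derivative, and the terms linear in the transversal part average out. -/
theorem abs_integral_fieldSq_mul_divSum_le (hx : 0 < Lx) (hy : 0 < Ly) (hxy : Ly ≤ Lx)
    (hs : ∀ k ∈ s, k ≠ 0) :
    |∫ p in rect Lx Ly, fieldSq Lx Ly s c p * divSum Lx Ly s c p| ≤
      Ly ^ 2 * √(∑ k ∈ s, c k ^ 2) * ∑ k ∈ transversal s, waveSq Lx Ly k ^ 2 * c k ^ 2 := by
  set S := ∑ k ∈ transversal s, waveSq Lx Ly k ^ 2 * c k ^ 2 with hS
  have hS0 : 0 ≤ S := Finset.sum_nonneg fun k _ => by positivity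
  set Z := √(∑ k ∈ s, c k ^ 2) with hZ
  have hZ0 : 0 ≤ Z := Real.sqrt_nonneg _
  have hZ2 : Z ^ 2 = ∑ k ∈ s, c k ^ 2 := Real.sq_sqrt (Finset.sum_nonneg fun k _ => sq_nonneg _)
  have hst : ∀ k ∈ transversal s, k ≠ 0 := fun k hk => hs k (Finset.mem_filter.1 hk).1
  have hsa : ∀ k ∈ axial s, k ≠ 0 := fun k hk => hs k (Finset.mem_filter.1 hk).1
  -- `v` and `V = ∂v/∂x` are the axial part and its divergence, `w` and `W` the transversal ones
  set v := comp Lx Ly (axial s) c 0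
  set w : Fin 2 → ℝ × ℝ → ℝ := comp Lx Ly (transversal s) c with hw
  set V := divSum Lx Ly (axial s) c
  set W := divSum Lx Ly (transversal s) c with hW
  have hv : IsTest Lx Ly v := isTest_comp hx.ne' hy.ne' 0
  have hwt : ∀ i, IsTest Lx Ly (w i) := fun i => isTest_comp hx.ne' hy.ne' i
  have hvc : Continuous v := continuous_comp 0
  have hwc : ∀ i, Continuous (w i) := fun i => continuous_comp i
  have hVc : Continuous V := continuous_divSum
  have hWc : Continuous W := continuous_divSum
  have hdw : ∀ i, Continuous (pderiv 0 (w i)) := fun i => ((hwt i).pderiv 0).continuous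
  have hV : pderiv 0 v = V := pderiv_comp_axial hx hy hs
  -- bounds for the pieces, pointwise and in `L²`
  have bw : ∀ i p, |w i p| ≤ Ly / 2 * √S := fun i p =>
    abs_modeSum_dirCoeff_le hx hy hxy (fun k hk => transversal_ne hk) c i p
  have hsub : ∀ t ⊆ s, ∑ k ∈ t, c k ^ 2 ≤ Z ^ 2 := fun t ht => by
    rw [hZ2]
    exact Finset.sum_le_sum_of_subset_of_nonneg ht fun k _ _ => sq_nonneg _
  have nv : ∫ p in rect Lx Ly, v p ^ 2 ≤ Z ^ 2 :=
    (integral_comp_sq_le hx hy hsa 0).trans (hsub _ (Finset.filter_subset _ _))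
  have nw : ∀ i, ∫ p in rect Lx Ly, w i p ^ 2 ≤ Z ^ 2 := fun i =>
    (integral_comp_sq_le hx hy hst i).trans (hsub _ (Finset.filter_subset _ _))
  have nW : ∫ p in rect Lx Ly, W p ^ 2 ≤ (Ly / 6 * √S) ^ 2 := by
    rw [hW, integral_divSum_sq hx hy]
    exact sum_waveSq_transversal_le hx hy
  have ndw : ∀ i, ∫ p in rect Lx Ly, pderiv 0 (w i) p ^ 2 ≤ (Ly / 6 * √S) ^ 2 := fun i =>
    (integral_pderiv_comp_sq_le hx hy hst i).trans (sum_waveSq_transversal_le hx hy)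
  have hB : 0 ≤ Ly / 6 * √S := by positivity
  -- the terms without a transversal factor, or with a single one
  have z1 : ∫ p in rect Lx Ly, v p * v p * V p = 0 := by
    have h := (hv.mul hv).integral_mul_pderiv hx.le hy.le hv 0
    simp_rw [hv.pderiv_mul hv, hV] at h
    have e : ∀ p, (V p * v p + v p * V p) * v p = 2 * (v p * v p * V p) := fun p => by ring
    simp_rw [e] at h
    rw [integral_const_mul] at h
    linarith
  have z2 : ∫ p in rect Lx Ly, v p * v p * W p = 0 := by
    have h := integral_axis_mul_negModeSum hx hy
      (f := fun x => axisSum Lx Ly s (fun k => c k * dirCoeff Lx Ly k 0) x ^ 2) (by fun_prop)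
      (s := transversal s) (fun k hk => transversal_ne hk)
      fun k => c k * (√(waveSq Lx Ly k) / √(Lx * Ly))
    rw [← divSum_eq] at h
    rw [← h]
    refine integral_congr_ae (Eventually.of_forall fun p => ?_)
    simp only [v, W, comp_axial_zero]
    ring
  have z3 : ∫ p in rect Lx Ly, v p * V p * w 0 p = 0 := by
    have h := integral_axis_mul_modeSum hx hy
      (f := fun x => axisSum Lx Ly s (fun k => c k * dirCoeff Lx Ly k 0) x *
        divSum Lx Ly (axial s) c (x, 0)) (by fun_prop)
      (s := transversal s) (fun k hk => transversal_ne hk) fun k => c k * dirCoeff Lx Ly k 0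
    rw [← h]
    refine integral_congr_ae (Eventually.of_forall fun p => ?_)
    simp only [v, V, w, ← divSum_axial]
    rw [comp_axial_zero]
    rfl
  -- the remaining terms have two transversal factors: one is bounded pointwise, and the other,
  -- after an integration by parts where necessary, in `L²` with a derivative
  have b1 : |∫ p in rect Lx Ly, w 0 p * v p * W p| ≤ Ly / 2 * √S * (Z * (Ly / 6 * √S)) :=
    abs_integral_mul_mul_le (hwc 0) hvc hWc hZ0 hB (bw 0) nv nW
  have b2 : ∀ i, |∫ p in rect Lx Ly, w i p * w i p * V p| ≤
      2 * (Ly / 2 * √S * (Z * (Ly / 6 * √S))) := by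
    intro i
    have h := ((hwt i).mul (hwt i)).integral_mul_pderiv hx.le hy.le hv 0
    simp_rw [(hwt i).pderiv_mul (hwt i), hV] at h
    have e : ∀ p, (pderiv 0 (w i) p * w i p + w i p * pderiv 0 (w i) p) * v p =
        2 * (w i p * v p * pderiv 0 (w i) p) := fun p => by ring
    simp_rw [e] at h
    rw [h, integral_const_mul, abs_neg, abs_mul, abs_of_pos (by norm_num : (0 : ℝ) < 2)]
    gcongr
    exact abs_integral_mul_mul_le (hwc i) hvc (hdw i) hZ0 hB (bw i) nv (ndw i)
  have b3 : ∀ i, |∫ p in rect Lx Ly, w i p * w i p * W p| ≤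
      Ly / 2 * √S * (Z * (Ly / 6 * √S)) := fun i =>
    abs_integral_mul_mul_le (hwc i) (hwc i) hWc hZ0 hB (bw i) (nw i) nW
  have e : ∀ p, fieldSq Lx Ly s c p * divSum Lx Ly s c p =
      v p * v p * V p + v p * v p * W p + 2 * (v p * V p * w 0 p) + 2 * (w 0 p * v p * W p) +
        w 0 p * w 0 p * V p + w 1 p * w 1 p * V p + w 0 p * w 0 p * W p + w 1 p * w 1 p * W p := by
    intro p
    rw [fieldSq, comp_eq_add 0 p, comp_eq_add 1 p, comp_axial_one, divSum_eq_add]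
    change (((v p + w 0 p) ^ 2) + (0 + w 1 p) ^ 2) * (V p + W p) = _
    ring
  have hi : ∀ f : ℝ × ℝ → ℝ, Continuous f → Integrable f (rectMeasure Lx Ly) := fun f hf =>
    integrable_of_continuous hf
  have h0 := hwc 0
  have h1 := hwc 1
  simp_rw [e]
  rw [integral_add (hi _ (by fun_prop)) (hi _ (by fun_prop)),
    integral_add (hi _ (by fun_prop)) (hi _ (by fun_prop)),
    integral_add (hi _ (by fun_prop)) (hi _ (by fun_prop)),
    integral_add (hi _ (by fun_prop)) (hi _ (by fun_prop)),
    integral_add (hi _ (by fun_prop)) (hi _ (by fun_prop)),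
    integral_add (hi _ (by fun_prop)) (hi _ (by fun_prop)),
    integral_add (hi _ (by fun_prop)) (hi _ (by fun_prop)),
    integral_const_mul, integral_const_mul, z1, z2, z3]
  have e2 : Ly / 2 * √S * (Z * (Ly / 6 * √S)) = Ly ^ 2 * Z * S / 12 := by
    have := Real.mul_self_sqrt hS0
    linear_combination (Ly ^ 2 * Z / 12) * this
  rw [e2] at b1 b2 b3
  have hX : 0 ≤ Ly ^ 2 * Z * S := by positivity
  have b20 := abs_le.1 (b2 0)
  have b21 := abs_le.1 (b2 1)
  have b30 := abs_le.1 (b3 0)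
  have b31 := abs_le.1 (b3 1)
  have b1' := abs_le.1 b1
  rw [abs_le]
  constructor <;> linarith [b20.1, b20.2, b21.1, b21.2, b30.1, b30.2, b31.1, b31.2, b1'.1, b1'.2]

end

section

variable {Lx Ly ℓ b : ℝ} {N : ℕ}

/-! ### The gauge field -/

/-- The nonzero frequencies whose components are at most `N` in absolute value. -/
def box (N : ℕ) : Finset (ℤ × ℤ) :=
  (Finset.Icc (-(N : ℤ)) N ×ˢ Finset.Icc (-(N : ℤ)) N).erase 0

/-- The coefficients, along the gradient modes, of the gauge field centred at `b`. It depends on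
`x` only, and its divergence is the gauge density, translated by `b`, minus its mean. At `k = 0`
the value is `0`, by the convention for division by zero. -/
def gaugeVec (Lx Ly ℓ b : ℝ) (k : ℤ × ℤ) : ℝ :=
  if k.2 = 0 then
    gaugeCoeff Lx ℓ k.1 * (√(Lx * Ly) / √(waveSq Lx Ly k)) * cas (-(wave Lx Ly k 0 * b))
  else 0

/-- The derivative of `gaugeVec` with respect to the centre. -/
def gaugeVecDeriv (Lx Ly ℓ b : ℝ) (k : ℤ × ℤ) : ℝ :=
  if k.2 = 0 then
    gaugeCoeff Lx ℓ k.1 * (√(Lx * Ly) / √(waveSq Lx Ly k)) *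
      (-(wave Lx Ly k 0) * cas (wave Lx Ly k 0 * b))
  else 0

lemma hasDerivAt_gaugeVec (k : ℤ × ℤ) (b : ℝ) :
    HasDerivAt (fun b => gaugeVec Lx Ly ℓ b k) (gaugeVecDeriv Lx Ly ℓ b k) b := by
  unfold gaugeVec gaugeVecDeriv
  split_ifs
  · refine HasDerivAt.const_mul _ ?_
    have h := (hasDerivAt_cas (-(wave Lx Ly k 0 * b))).comp b
      (((hasDerivAt_id b).const_mul (wave Lx Ly k 0)).fun_neg)
    convert! h using 1
    rw [neg_neg]; ring
  · exact hasDerivAt_const _ _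

lemma box_ne_zero : ∀ k ∈ box N, k ≠ 0 := fun _ hk => Finset.ne_of_mem_erase hk

lemma sum_axial_box (F : ℤ × ℤ → ℝ) : ∑ k ∈ axial (box N), F k =
    ∑ m ∈ Finset.Icc (-(N : ℤ)) N, F (m, 0) - F 0 := by
  have e : axial (box N) = ((Finset.Icc (-(N : ℤ)) N).image fun m => ((m, 0) : ℤ × ℤ)).erase 0 := by
    ext ⟨m, n⟩
    simp only [axial, box, Finset.mem_filter, Finset.mem_erase, Finset.mem_product,
      Finset.mem_image, Finset.mem_Icc, Prod.mk.injEq, ne_eq]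
    constructor
    · rintro ⟨⟨h0, h1, -⟩, rfl⟩
      exact ⟨h0, m, h1, rfl, rfl⟩
    · rintro ⟨h0, m', h1, rfl, rfl⟩
      exact ⟨⟨h0, h1, by simp⟩, rfl⟩
  rw [e, Finset.sum_erase_eq_sub, Finset.sum_image]
  · intro m _ m' _ h
    exact (Prod.mk.inj h).1
  · exact Finset.mem_image.2 ⟨0, by simp, rfl⟩

lemma sum_box_eq_axial {F : ℤ × ℤ → ℝ} (hF : ∀ k : ℤ × ℤ, k.2 ≠ 0 → F k = 0) :
    ∑ k ∈ box N, F k = ∑ k ∈ axial (box N), F k := by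
  refine (Finset.sum_subset (Finset.filter_subset _ _) fun k hk hk' => hF k fun h => hk' ?_).symm
  exact Finset.mem_filter.2 ⟨hk, h⟩

lemma sum_Icc_symm (H : ℤ → ℝ) : ∑ m ∈ Finset.Icc (-(N : ℤ)) N, H m =
    ∑ m ∈ Finset.Icc (-(N : ℤ)) N, (H m + H (-m)) / 2 := by
  have h : ∑ m ∈ Finset.Icc (-(N : ℤ)) N, H (-m) = ∑ m ∈ Finset.Icc (-(N : ℤ)) N, H m := by
    refine Finset.sum_equiv (Equiv.neg ℤ) (fun m => ?_) fun m _ => rfl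
    simp only [Equiv.neg_apply, Finset.mem_Icc]
    omega
  rw [← Finset.sum_div, Finset.sum_add_distrib, h]
  ring

lemma gaugeVec_of_ne {k : ℤ × ℤ} (hk : k.2 ≠ 0) : gaugeVec Lx Ly ℓ b k = 0 := if_neg hk

lemma gaugeCoeff_neg (m : ℤ) : gaugeCoeff Lx ℓ (-m) = gaugeCoeff Lx ℓ m := by
  have e : 2 * Real.pi * ((-m : ℤ) : ℝ) / Lx * ℓ = -(2 * Real.pi * m / Lx * ℓ) := by
    push_cast; ring
  rw [gaugeCoeff, e, bumpHat_neg, gaugeCoeff]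

lemma gaugeCoeff_zero : gaugeCoeff Lx ℓ 0 = 4 := by simp [gaugeCoeff, bumpHat_zero]

/-- The divergence of the gauge field is the truncated gauge density, minus its mean. -/
lemma sum_gaugeVec_mul_divMode (hx : 0 < Lx) (hy : 0 < Ly) (p : ℝ × ℝ) :
    ∑ k ∈ box N, gaugeVec Lx Ly ℓ b k * divMode Lx Ly k p = gaugeSum Lx ℓ N (p.1 - b) - 4 := by
  set H : ℤ → ℝ := fun m => gaugeCoeff Lx ℓ m *
    (cas (-(2 * Real.pi * m / Lx * b)) * cas (-(2 * Real.pi * m / Lx * p.1))) with hH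
  have hA : 0 < Lx * Ly := by positivity
  rw [sum_box_eq_axial fun k hk => by rw [gaugeVec_of_ne hk, zero_mul]]
  have h1 : ∑ k ∈ axial (box N), gaugeVec Lx Ly ℓ b k * divMode Lx Ly k p =
      ∑ k ∈ axial (box N), H k.1 := by
    refine Finset.sum_congr rfl fun k hk => ?_
    obtain ⟨hk1, hk2⟩ := Finset.mem_filter.1 hk
    have h1 : √(waveSq Lx Ly k) ≠ 0 :=
      (Real.sqrt_pos.2 (waveSq_pos hx hy (box_ne_zero k hk1))).ne'
    have h2 : √(Lx * Ly) ≠ 0 := (Real.sqrt_pos.2 hA).ne'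
    rw [gaugeVec, if_pos hk2, divMode, mode_neg, wave_one_of_eq hk2, zero_mul, add_zero, hH]
    have : wave Lx Ly k 0 = 2 * Real.pi * k.1 / Lx := by simp [wave]
    beta_reduce
    rw [← this]
    field_simp
  have h2 := sum_axial_box (N := N) fun k => H k.1
  have h0 : H (0 : ℤ × ℤ).1 = 4 := by simp [hH, gaugeCoeff_zero, cas]
  rw [h1, h2, h0, sum_Icc_symm, gaugeSum]
  congr 1
  refine Finset.sum_congr rfl fun m _ => ?_
  have e : ∀ y : ℝ, 2 * Real.pi * ((-m : ℤ) : ℝ) / Lx * y = -(2 * Real.pi * m / Lx * y) :=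
    fun y => by push_cast; ring
  simp only [hH, gaugeCoeff_neg, e, neg_neg]
  rw [mul_sub, Real.cos_sub, cas_neg, cas_neg]
  unfold cas
  ring

lemma waveSq_neg_fst (m : ℤ) : waveSq Lx Ly (-m, 0) = waveSq Lx Ly (m, 0) := by
  simp [waveSq, wave]; ring

/-- The length of the gauge field does not depend on its centre: the modes `k` and `-k` together
contribute `cas ^ 2 + cas (-·) ^ 2 = 2`. -/
lemma sum_gaugeVec_sq (b : ℝ) :
    ∑ k ∈ box N, gaugeVec Lx Ly ℓ b k ^ 2 = ∑ k ∈ box N, gaugeVec Lx Ly ℓ 0 k ^ 2 := by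
  have key : ∀ b, ∑ k ∈ box N, gaugeVec Lx Ly ℓ b k ^ 2 = ∑ m ∈ Finset.Icc (-(N : ℤ)) N,
      (gaugeCoeff Lx ℓ m * (√(Lx * Ly) / √(waveSq Lx Ly (m, 0)))) ^ 2 := by
    intro b
    have h0 : gaugeVec Lx Ly ℓ b 0 = 0 := by simp [gaugeVec, waveSq, wave]
    rw [sum_box_eq_axial fun k hk => by rw [gaugeVec_of_ne hk, zero_pow two_ne_zero],
      sum_axial_box, h0, zero_pow two_ne_zero, sub_zero, sum_Icc_symm]
    refine Finset.sum_congr rfl fun m _ => ?_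
    have e : wave Lx Ly (-m, 0) 0 * b = -(wave Lx Ly (m, 0) 0 * b) := by
      simp [wave]; ring
    simp only [gaugeVec, if_true, gaugeCoeff_neg, waveSq_neg_fst, e, neg_neg]
    have := cas_sq_add_cas_neg_sq (wave Lx Ly (m, 0) 0 * b)
    rw [mul_pow, mul_pow _ (cas (wave Lx Ly (m, 0) 0 * b))]
    linear_combination
      (gaugeCoeff Lx ℓ m * (√(Lx * Ly) / √(waveSq Lx Ly (m, 0)))) ^ 2 / 2 * this
  rw [key b, key 0]

lemma waveSq_of_eq {k : ℤ × ℤ} (hk : k.2 = 0) : waveSq Lx Ly k = (2 * Real.pi * k.1 / Lx) ^ 2 := by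
  simp [waveSq, wave, hk]

lemma gaugeVec_sq_le (hx : 0 < Lx) (hy : 0 < Ly) (k : ℤ × ℤ) :
    gaugeVec Lx Ly ℓ b k ^ 2 ≤ 9 / 4 * (gaugeCoeff Lx ℓ k.1 ^ 2 * (Lx * Ly / waveSq Lx Ly k)) := by
  have hA : 0 < Lx * Ly := by positivity
  unfold gaugeVec
  have h0 := waveSq_nonneg (Lx := Lx) (Ly := Ly) k
  have h1 : 0 ≤ gaugeCoeff Lx ℓ k.1 ^ 2 * (Lx * Ly / waveSq Lx Ly k) := by positivity
  split_ifs with hk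
  · have h2 : cas (-(wave Lx Ly k 0 * b)) ^ 2 ≤ 9 / 4 := by
      have := abs_le.1 (abs_cas_le (-(wave Lx Ly k 0 * b)))
      nlinarith [this.1, this.2]
    rw [mul_pow, mul_pow, div_pow, Real.sq_sqrt hA.le, Real.sq_sqrt h0, mul_comm]
    exact mul_le_mul_of_nonneg_right h2 h1
  · rw [zero_pow two_ne_zero]; positivity

/-- Reduces sums of weighted squares of gauge coefficients to sums over one frequency. -/
lemma sum_axial_box_le {F : ℤ × ℤ → ℝ} {f : ℤ → ℝ} (hf : ∀ m, 0 ≤ f m)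
    (h : ∀ k : ℤ × ℤ, k.2 = 0 → k.1 ≠ 0 → F k ≤ f k.1) :
    ∑ k ∈ axial (box N), F k ≤ ∑ m ∈ Finset.Icc (-(N : ℤ)) N, f m := by
  calc ∑ k ∈ axial (box N), F k ≤ ∑ k ∈ axial (box N), f k.1 := by
        refine Finset.sum_le_sum fun k hk => ?_
        obtain ⟨h1, h2⟩ := Finset.mem_filter.1 hk
        exact h k h2 fun h3 => box_ne_zero k h1 (Prod.ext h3 h2)
    _ = ∑ m ∈ Finset.Icc (-(N : ℤ)) N, f m - f 0 := sum_axial_box fun k => f k.1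
    _ ≤ _ := by linarith [hf 0]

/-- The `L²` norm of the gauge field determines the size of the absorbing ball. The bound does not
depend on the width of the profile. -/
lemma sum_gaugeVec_sq_le (hx : 0 < Lx) (hy : 0 < Ly) :
    ∑ k ∈ box N, gaugeVec Lx Ly ℓ b k ^ 2 ≤ 225 * (Ly * Lx ^ 3) := by
  rw [sum_box_eq_axial fun k hk => by rw [gaugeVec_of_ne hk, zero_pow two_ne_zero]]
  refine (sum_axial_box_le (f := fun m => 225 / 8 * (Ly * Lx ^ 3) * (1 + ((m : ℝ) / 1) ^ 2)⁻¹)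
    (fun m => by positivity) fun k hk hk1 => ?_).trans ?_
  · refine (gaugeVec_sq_le hx hy k).trans ?_
    have hm : (1 : ℝ) ≤ (k.1 : ℝ) ^ 2 := by
      have : (1 : ℤ) ≤ k.1 ^ 2 := by have : 0 < k.1 ^ 2 := by positivity
                                     omega
      exact_mod_cast this
    have hq : gaugeCoeff Lx ℓ k.1 ^ 2 ≤ 225 := by
      have := abs_le.1 (abs_bumpHat_le (2 * Real.pi * k.1 / Lx * ℓ))
      unfold gaugeCoeff
      nlinarith [this.1, this.2]
    have hw : Lx * Ly / waveSq Lx Ly k ≤ Ly * Lx ^ 3 / 36 * (2 * (1 + (k.1 : ℝ) ^ 2)⁻¹) := by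
      have hpi := Real.pi_gt_three
      have hpi2 : 36 ≤ (2 * Real.pi) ^ 2 := by nlinarith
      have e : Lx * Ly / waveSq Lx Ly k = Ly * Lx ^ 3 * ((2 * Real.pi) ^ 2 * (k.1 : ℝ) ^ 2)⁻¹ := by
        rw [waveSq_of_eq hk, div_pow, mul_pow (2 * Real.pi)]
        field_simp
      rw [e, div_mul_eq_mul_div, mul_div_assoc]
      refine mul_le_mul_of_nonneg_left ?_ (by positivity)
      rw [← div_eq_mul_inv, div_div, inv_eq_one_div,
        div_le_div_iff₀ (by positivity) (by positivity)]
      nlinarith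
    have h0 : 0 ≤ Lx * Ly / waveSq Lx Ly k := div_nonneg (by positivity) (waveSq_nonneg k)
    simp only [div_one]
    calc 9 / 4 * (gaugeCoeff Lx ℓ k.1 ^ 2 * (Lx * Ly / waveSq Lx Ly k))
        ≤ 9 / 4 * (225 * (Ly * Lx ^ 3 / 36 * (2 * (1 + (k.1 : ℝ) ^ 2)⁻¹))) := by gcongr
      _ = 225 / 8 * (Ly * Lx ^ 3) * (1 + (k.1 : ℝ) ^ 2)⁻¹ := by ring
  · rw [← Finset.mul_sum]
    have h := sum_inv_one_add_sq_le (r := 1) le_rfl (Finset.Icc (-(N : ℤ)) N)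
    have h0 : 0 ≤ Ly * Lx ^ 3 := by positivity
    nlinarith

/-- The dissipation of the gauge field is of order `Lx ^ 2 * Ly / ℓ ^ 3`. As `ℓ ^ 3` is of order
`1 / Lx`, this is no larger than the bound for the squared norm, up to a constant. -/
lemma sum_waveSq_mul_gaugeVec_sq_le (hx : 0 < Lx) (hy : 0 < Ly) (hℓ : 0 < ℓ)
    (hr : 1 ≤ Lx / (2 * Real.pi * ℓ)) (hLℓ : 64000 * ℓ ^ 3 * Lx = 1) :
    ∑ k ∈ box N, waveSq Lx Ly k ^ 2 * gaugeVec Lx Ly ℓ b k ^ 2 ≤ 5 * 10 ^ 10 * (Ly * Lx ^ 3) := by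
  rw [sum_box_eq_axial fun k hk => by rw [gaugeVec_of_ne hk, zero_pow two_ne_zero, mul_zero]]
  set r := Lx / (2 * Real.pi * ℓ) with hr'
  refine (sum_axial_box_le (f := fun m => 9 / 4 * 496 ^ 2 * (Lx * Ly / ℓ ^ 2) *
    (1 + ((m : ℝ) / r) ^ 2)⁻¹) (fun m => by positivity) fun k hk hk1 => ?_).trans ?_
  · have hw : waveSq Lx Ly k = ((k.1 : ℝ) / r) ^ 2 / ℓ ^ 2 := by
      rw [waveSq_of_eq hk, hr']; field_simp
    have hw0 : 0 < waveSq Lx Ly k := waveSq_pos hx hy fun h => hk1 (by rw [h]; rfl)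
    set θ := (k.1 : ℝ) / r
    have hq : gaugeCoeff Lx ℓ k.1 ^ 2 ≤ (496 * (1 + θ ^ 2)⁻¹) ^ 2 := by
      have := abs_le.1 (abs_gaugeCoeff_le Lx ℓ k.1)
      exact sq_le_sq' this.1 this.2
    calc waveSq Lx Ly k ^ 2 * gaugeVec Lx Ly ℓ b k ^ 2
        ≤ waveSq Lx Ly k ^ 2 *
            (9 / 4 * (gaugeCoeff Lx ℓ k.1 ^ 2 * (Lx * Ly / waveSq Lx Ly k))) := by
          gcongr; exact gaugeVec_sq_le hx hy k
      _ = 9 / 4 * (Lx * Ly) * (gaugeCoeff Lx ℓ k.1 ^ 2 * waveSq Lx Ly k) := by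
          field_simp
      _ ≤ 9 / 4 * (Lx * Ly) * ((496 * (1 + θ ^ 2)⁻¹) ^ 2 * ((1 + θ ^ 2) / ℓ ^ 2)) := by
          rw [hw]
          gcongr
          linarith
      _ = 9 / 4 * 496 ^ 2 * (Lx * Ly / ℓ ^ 2) * (1 + θ ^ 2)⁻¹ := by
          have : 1 + θ ^ 2 ≠ 0 := by positivity
          field_simp
  · rw [← Finset.mul_sum]
    have h := sum_inv_one_add_sq_le hr (Finset.Icc (-(N : ℤ)) N)
    have hr6 : r ≤ Lx / (6 * ℓ) := by
      rw [hr']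
      have := Real.pi_gt_three
      gcongr
      linarith
    calc 9 / 4 * 496 ^ 2 * (Lx * Ly / ℓ ^ 2) *
          ∑ m ∈ Finset.Icc (-(N : ℤ)) N, (1 + ((m : ℝ) / r) ^ 2)⁻¹
        ≤ 9 / 4 * 496 ^ 2 * (Lx * Ly / ℓ ^ 2) * (8 * (Lx / (6 * ℓ))) := by
          gcongr; linarith
      _ = 738048 * (Ly * Lx ^ 2) * (1 / ℓ ^ 3) := by field_simp; norm_num
      _ = 738048 * (Ly * Lx ^ 2) * (64000 * Lx) := by
          congr 1
          rw [div_eq_iff (by positivity)]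
          linarith
      _ ≤ 5 * 10 ^ 10 * (Ly * Lx ^ 3) := by
          have h0 : 0 ≤ Ly * Lx ^ 3 := by positivity
          nlinarith

end

section

variable {Lx Ly ℓ b : ℝ} {N : ℕ} {c : ℤ × ℤ → ℝ}

/-! ### The Lyapunov inequality -/

lemma integral_rect_axis (hx : 0 < Lx) (hy : 0 < Ly) {f : ℝ → ℝ} (hf : Continuous f) :
    ∫ p in rect Lx Ly, f p.1 = Ly * ∫ x in (0 : ℝ)..Lx, f x := by
  rw [integral_rect_swap hx.le hy.le (by fun_prop)]
  simp

lemma integral_bump_mul_cas (a θ : ℝ) :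
    ∫ s in (-1 : ℝ)..1, bump s * cas (a + θ * s) = bumpHat θ * cas a := by
  have e : ∀ s, bump s * cas (a + θ * s) =
      cas a * (bump s * Real.cos (θ * s)) + cas (-a) * (bump s * Real.sin (θ * s)) := fun s => by
    rw [cas_neg]
    unfold cas
    rw [Real.cos_add, Real.sin_add]
    ring
  simp_rw [e]
  rw [intervalIntegral.integral_add (Continuous.intervalIntegrable (by fun_prop) _ _)
    (Continuous.intervalIntegrable (by fun_prop) _ _), intervalIntegral.integral_const_mul,
    intervalIntegral.integral_const_mul, integral_bump_mul_sin, bumpHat]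
  ring

lemma hasDerivAt_axisSum (s : Finset (ℤ × ℤ)) (a : ℤ × ℤ → ℝ) (x : ℝ) :
    HasDerivAt (axisSum Lx Ly s a)
      (∑ k ∈ axial s, a k * wave Lx Ly k 0 * cas (-(wave Lx Ly k 0 * x))) x := by
  unfold axisSum
  refine HasDerivAt.fun_sum fun k _ => ?_
  have h := ((hasDerivAt_cas (wave Lx Ly k 0 * x)).comp x
    ((hasDerivAt_id x).const_mul (wave Lx Ly k 0))).const_mul (a k)
  convert! h using 1
  ring

lemma hasDerivAt_axisSum_deriv (s : Finset (ℤ × ℤ)) (a : ℤ × ℤ → ℝ) (x : ℝ) :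
    HasDerivAt (fun x => ∑ k ∈ axial s, a k * wave Lx Ly k 0 * cas (-(wave Lx Ly k 0 * x)))
      (axisSum Lx Ly s (fun k => -(a k * wave Lx Ly k 0 ^ 2)) x) x := by
  unfold axisSum
  refine HasDerivAt.fun_sum fun k _ => ?_
  have h := ((hasDerivAt_cas (-(wave Lx Ly k 0 * x))).comp x
    ((hasDerivAt_id x).const_mul (wave Lx Ly k 0)).fun_neg).const_mul (a k * wave Lx Ly k 0)
  convert! h using 1
  rw [neg_neg]
  ring

lemma axisSum_periodic (hx : 0 < Lx) (s : Finset (ℤ × ℤ)) (a : ℤ × ℤ → ℝ) :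
    Function.Periodic (axisSum Lx Ly s a) Lx := by
  intro x
  refine Finset.sum_congr rfl fun k _ => ?_
  rw [← cas_add_int_mul_two_pi (wave Lx Ly k 0 * x) k.1]
  congr 2
  simp only [wave, if_true]
  field_simp

/-- When the distance to the gauge field is stationary in the centre, the axial part of the field
has vanishing mean against the profile at that centre. -/
lemma integral_bump_mul_axisSum (hx : 0 < Lx) (hy : 0 < Ly)
    (hstat : ∑ k ∈ box N, c k * gaugeVecDeriv Lx Ly ℓ b k = 0) :
    ∫ s in (-1 : ℝ)..1, bump s *
      axisSum Lx Ly (box N) (fun k => c k * dirCoeff Lx Ly k 0) (b + ℓ * s) = 0 := by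
  have hA : 0 < Lx * Ly := by positivity
  have hcas := continuous_cas
  have h1 : ∫ s in (-1 : ℝ)..1, bump s *
      axisSum Lx Ly (box N) (fun k => c k * dirCoeff Lx Ly k 0) (b + ℓ * s) =
      ∑ k ∈ axial (box N), c k * dirCoeff Lx Ly k 0 *
        (bumpHat (wave Lx Ly k 0 * ℓ) * cas (wave Lx Ly k 0 * b)) := by
    have e : ∀ s, bump s *
        axisSum Lx Ly (box N) (fun k => c k * dirCoeff Lx Ly k 0) (b + ℓ * s) =
        ∑ k ∈ axial (box N), c k * dirCoeff Lx Ly k 0 *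
          (bump s * cas (wave Lx Ly k 0 * b + wave Lx Ly k 0 * ℓ * s)) := fun s => by
      rw [axisSum, Finset.mul_sum]
      refine Finset.sum_congr rfl fun k _ => ?_
      rw [mul_add, mul_assoc (wave Lx Ly k 0) ℓ s]
      ring
    simp_rw [e]
    rw [intervalIntegral.integral_finsetSum fun k _ =>
      Continuous.intervalIntegrable (by fun_prop) _ _]
    refine Finset.sum_congr rfl fun k _ => ?_
    rw [intervalIntegral.integral_const_mul, integral_bump_mul_cas]
  have h2 : ∑ k ∈ box N, c k * gaugeVecDeriv Lx Ly ℓ b k = -(4 * (Lx * Ly)) *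
      ∑ k ∈ axial (box N), c k * dirCoeff Lx Ly k 0 *
        (bumpHat (wave Lx Ly k 0 * ℓ) * cas (wave Lx Ly k 0 * b)) := by
    rw [sum_box_eq_axial fun k hk => by rw [gaugeVecDeriv, if_neg hk, mul_zero], Finset.mul_sum]
    refine Finset.sum_congr rfl fun k hk => ?_
    obtain ⟨hk1, hk2⟩ := Finset.mem_filter.1 hk
    have h1 : √(waveSq Lx Ly k) ≠ 0 :=
      (Real.sqrt_pos.2 (waveSq_pos hx hy (box_ne_zero k hk1))).ne'
    have h2 : √(Lx * Ly) ≠ 0 := (Real.sqrt_pos.2 hA).ne'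
    have h3 : √(Lx * Ly) ^ 2 = Lx * Ly := Real.sq_sqrt hA.le
    have h4 : gaugeCoeff Lx ℓ k.1 = 4 * bumpHat (wave Lx Ly k 0 * ℓ) := by simp [gaugeCoeff, wave]
    rw [gaugeVecDeriv, if_pos hk2, h4, dirCoeff]
    generalize √(Lx * Ly) = A at h2 h3 ⊢
    rw [← h3]
    field_simp
  rw [h1]
  rw [h2] at hstat
  exact (mul_eq_zero.1 hstat).resolve_left (by simp [hx.ne', hy.ne'])

/-- The gauge term is absorbed by the dissipation: its axial part by the one-dimensional inequality
at a stationary centre, and its transversal part because the thin direction makes the dissipation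
large compared with the maximum of the gauge (`162 = 1296 / 8`). -/
lemma integral_gaugeSum_mul_fieldSq_le (hx : 0 < Lx) (hy : 0 < Ly) (hℓ : 0 < ℓ) (hL : ℓ ≤ Lx / 2)
    (hr : 1 ≤ Lx / (2 * Real.pi * ℓ)) (hLℓ : 64000 * ℓ ^ 3 * Lx = 1)
    (hN : ∀ y ∈ Icc (-(Lx / 2)) (Lx / 2), |gaugeSum Lx ℓ N y - gaugeDensity Lx ℓ y| ≤ 1)
    (hthin : 3968 * (Lx / (2 * Real.pi * ℓ)) * Ly ^ 4 ≤ 162)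
    (hstat : ∑ k ∈ box N, c k * gaugeVecDeriv Lx Ly ℓ b k = 0) :
    ∫ p in rect Lx Ly, gaugeSum Lx ℓ N (p.1 - b) * fieldSq Lx Ly (box N) c p ≤
      3 / 8 * (∑ k ∈ box N, waveSq Lx Ly k ^ 2 * c k ^ 2) + ∑ k ∈ box N, c k ^ 2 := by
  have hA : 0 < Lx * Ly := by positivity
  have hsa : ∀ k ∈ axial (box N), k ≠ 0 := fun k hk => box_ne_zero k (Finset.mem_filter.1 hk).1
  have hst : ∀ k ∈ transversal (box N), k ≠ 0 :=
    fun k hk => box_ne_zero k (Finset.mem_filter.1 hk).1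
  rw [integral_axis_mul_fieldSq hx hy (f := fun x => gaugeSum Lx ℓ N (x - b)) (by fun_prop)]
  set a : ℤ × ℤ → ℝ := fun k => c k * dirCoeff Lx Ly k 0 with ha
  have hax : ∫ p in rect Lx Ly, gaugeSum Lx ℓ N (p.1 - b) * comp Lx Ly (axial (box N)) c 0 p ^ 2 ≤
      1 / 4 * (∑ k ∈ axial (box N), waveSq Lx Ly k ^ 2 * c k ^ 2) + ∑ k ∈ box N, c k ^ 2 := by
    have h1 := integral_gaugeSum_mul_sq_le hℓ hL hLℓ hN (hasDerivAt_axisSum (box N) a)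
      (hasDerivAt_axisSum_deriv (box N) a) continuous_axisSum (axisSum_periodic hx _ _)
      (axisSum_periodic hx _ _) (integral_bump_mul_axisSum hx hy hstat)
    have h2 : Ly * ∫ x in (0 : ℝ)..Lx,
        axisSum Lx Ly (box N) (fun k => -(a k * wave Lx Ly k 0 ^ 2)) x ^ 2 ≤
        ∑ k ∈ axial (box N), waveSq Lx Ly k ^ 2 * c k ^ 2 := by
      rw [← integral_rect_axis hx hy (f := fun x =>
        axisSum Lx Ly (box N) (fun k => -(a k * wave Lx Ly k 0 ^ 2)) x ^ 2) (by fun_prop)]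
      simp_rw [← modeSum_axial]
      rw [integral_modeSum_sq hx hy, Finset.mul_sum]
      refine Finset.sum_le_sum fun k hk => ?_
      have h1 := dirCoeff_sq_le hx hy (hsa k hk) 0
      have h2 : waveSq Lx Ly k = wave Lx Ly k 0 ^ 2 := by
        rw [waveSq, wave_one_of_eq (Finset.mem_filter.1 hk).2]; ring
      rw [h2, ha]
      calc Lx * Ly * (-(c k * dirCoeff Lx Ly k 0 * wave Lx Ly k 0 ^ 2)) ^ 2
          = Lx * Ly * dirCoeff Lx Ly k 0 ^ 2 * ((wave Lx Ly k 0 ^ 2) ^ 2 * c k ^ 2) := by ring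
        _ ≤ 1 * ((wave Lx Ly k 0 ^ 2) ^ 2 * c k ^ 2) := by gcongr
        _ = _ := one_mul _
    have h3 : Ly * ∫ x in (0 : ℝ)..Lx, axisSum Lx Ly (box N) a x ^ 2 ≤ ∑ k ∈ box N, c k ^ 2 := by
      rw [← integral_rect_axis hx hy (f := fun x => axisSum Lx Ly (box N) a x ^ 2) (by fun_prop)]
      simp_rw [ha, ← comp_axial_zero]
      exact (integral_comp_sq_le hx hy hsa 0).trans
        (Finset.sum_le_sum_of_subset_of_nonneg (Finset.filter_subset _ _) fun k _ _ => sq_nonneg _)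
    simp_rw [comp_axial_zero]
    rw [integral_rect_axis hx hy (f := fun x => gaugeSum Lx ℓ N (x - b) *
      axisSum Lx Ly (box N) a x ^ 2) (by fun_prop)]
    have := mul_le_mul_of_nonneg_left h1 hy.le
    linarith
  have htr : ∫ p in rect Lx Ly,
      gaugeSum Lx ℓ N (p.1 - b) * fieldSq Lx Ly (transversal (box N)) c p ≤
      1 / 8 * ∑ k ∈ transversal (box N), waveSq Lx Ly k ^ 2 * c k ^ 2 := by
    set M := 3968 * (Lx / (2 * Real.pi * ℓ)) with hM
    have hM0 : 0 ≤ M := by positivity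
    calc ∫ p in rect Lx Ly, gaugeSum Lx ℓ N (p.1 - b) * fieldSq Lx Ly (transversal (box N)) c p
        ≤ ∫ p in rect Lx Ly, M * fieldSq Lx Ly (transversal (box N)) c p := by
          refine integral_mono (integrable_of_continuous (by fun_prop))
            (integrable_of_continuous (by fun_prop)) fun p => ?_
          refine mul_le_mul_of_nonneg_right ?_ (by unfold fieldSq; positivity)
          exact (le_abs_self _).trans (abs_gaugeSum_le hr N _)
      _ = M * ∑ k ∈ transversal (box N), c k ^ 2 := by
          rw [integral_const_mul, integral_fieldSq hx hy hst]
      _ ≤ M * (Ly ^ 4 / 1296 * ∑ k ∈ transversal (box N), waveSq Lx Ly k ^ 2 * c k ^ 2) := by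
          gcongr; exact sum_transversal_le hx hy
      _ = M * Ly ^ 4 / 1296 * ∑ k ∈ transversal (box N), waveSq Lx Ly k ^ 2 * c k ^ 2 := by ring
      _ ≤ 1 / 8 * ∑ k ∈ transversal (box N), waveSq Lx Ly k ^ 2 * c k ^ 2 := by
          refine mul_le_mul_of_nonneg_right ?_ (Finset.sum_nonneg fun k _ => by positivity)
          linarith
  have hE1 : ∑ k ∈ axial (box N), waveSq Lx Ly k ^ 2 * c k ^ 2 ≤
      ∑ k ∈ box N, waveSq Lx Ly k ^ 2 * c k ^ 2 :=
    Finset.sum_le_sum_of_subset_of_nonneg (Finset.filter_subset _ _) fun k _ _ => by positivity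
  have hE2 : ∑ k ∈ transversal (box N), waveSq Lx Ly k ^ 2 * c k ^ 2 ≤
      ∑ k ∈ box N, waveSq Lx Ly k ^ 2 * c k ^ 2 :=
    Finset.sum_le_sum_of_subset_of_nonneg (Finset.filter_subset _ _) fun k _ _ => by positivity
  linarith

/-- The Lyapunov inequality. Along the truncated evolution with the centre held fixed, and at
centres where the distance is stationary, the squared distance to the gauge field decays at
rate `1` up to a bounded source. The damping comes from the mean `4` of the gauge density, which
enters the divergence of the gauge field with a minus sign. -/
theorem sum_sub_gaugeVec_mul_le (hx : 0 < Lx) (hy : 0 < Ly) (hxy : Ly ≤ Lx) (hℓ : 0 < ℓ)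
    (hL : ℓ ≤ Lx / 2) (hr : 1 ≤ Lx / (2 * Real.pi * ℓ)) (hLℓ : 64000 * ℓ ^ 3 * Lx = 1)
    (hN : ∀ y ∈ Icc (-(Lx / 2)) (Lx / 2), |gaugeSum Lx ℓ N y - gaugeDensity Lx ℓ y| ≤ 1)
    (hthin : 3968 * (Lx / (2 * Real.pi * ℓ)) * Ly ^ 4 ≤ 162)
    (hsmall : Ly ^ 2 * √(∑ k ∈ box N, c k ^ 2) ≤ 1 / 8)
    (hstat : ∑ k ∈ box N, c k * gaugeVecDeriv Lx Ly ℓ b k = 0) :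
    2 * ∑ k ∈ box N, (c k - gaugeVec Lx Ly ℓ b k) * (-eigen Lx Ly k * c k -
      ∫ p in rect Lx Ly, fieldSq Lx Ly (box N) c p * divMode Lx Ly k p) ≤
      -∑ k ∈ box N, (c k - gaugeVec Lx Ly ℓ b k) ^ 2 + 4 * 10 ^ 11 * (Ly * Lx ^ 3) := by
  set q := gaugeVec Lx Ly ℓ b
  set E := ∑ k ∈ box N, waveSq Lx Ly k ^ 2 * c k ^ 2 with hE
  have hE0 : 0 ≤ E := Finset.sum_nonneg fun k _ => by positivity
  set Z := ∑ k ∈ box N, c k ^ 2 with hZ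
  have hP4 := sum_waveSq_mul_gaugeVec_sq_le (b := b) (N := N) hx hy hℓ hr hLℓ
  have hP2 := sum_gaugeVec_sq_le (ℓ := ℓ) (b := b) (N := N) hx hy
  set P4 := ∑ k ∈ box N, waveSq Lx Ly k ^ 2 * q k ^ 2 with hP4'
  set P2 := ∑ k ∈ box N, q k ^ 2 with hP2'
  have hcub := abs_integral_fieldSq_mul_divSum_le (c := c) hx hy hxy (box_ne_zero (N := N))
  have hgauge := integral_gaugeSum_mul_fieldSq_le hx hy hℓ hL hr hLℓ hN hthin hstat
  rw [← hE, ← hZ] at hgauge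
  -- the nonlinearity, tested against a trigonometric field, is paired with its divergence
  have test : ∀ a : ℤ × ℤ → ℝ,
      ∑ k ∈ box N, a k * ∫ p in rect Lx Ly, fieldSq Lx Ly (box N) c p * divMode Lx Ly k p =
        ∫ p in rect Lx Ly, fieldSq Lx Ly (box N) c p * divSum Lx Ly (box N) a p := by
    intro a
    simp_rw [divSum, Finset.mul_sum, mul_left_comm _ (a _)]
    rw [integral_finsetSum _ fun k _ => integrable_of_continuous (by fun_prop)]
    simp_rw [integral_const_mul]
  have hq : ∫ p in rect Lx Ly, fieldSq Lx Ly (box N) c p * divSum Lx Ly (box N) q p =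
      (∫ p in rect Lx Ly, gaugeSum Lx ℓ N (p.1 - b) * fieldSq Lx Ly (box N) c p) - 4 * Z := by
    have e : ∀ p, fieldSq Lx Ly (box N) c p * divSum Lx Ly (box N) q p =
        gaugeSum Lx ℓ N (p.1 - b) * fieldSq Lx Ly (box N) c p - 4 * fieldSq Lx Ly (box N) c p :=
      fun p => by rw [divSum, sum_gaugeVec_mul_divMode hx hy]; ring
    simp_rw [e]
    rw [integral_sub (integrable_of_continuous (by fun_prop))
      (integrable_of_continuous (by fun_prop)), integral_const_mul,
      integral_fieldSq hx hy box_ne_zero]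
  have split : ∑ k ∈ box N, (c k - q k) * (-eigen Lx Ly k * c k -
      ∫ p in rect Lx Ly, fieldSq Lx Ly (box N) c p * divMode Lx Ly k p) =
      ∑ k ∈ box N, (-(eigen Lx Ly k * c k ^ 2) + eigen Lx Ly k * q k * c k) -
      (∫ p in rect Lx Ly, fieldSq Lx Ly (box N) c p * divSum Lx Ly (box N) c p) +
      ∫ p in rect Lx Ly, fieldSq Lx Ly (box N) c p * divSum Lx Ly (box N) q p := by
    rw [← test, ← test, ← Finset.sum_sub_distrib, ← Finset.sum_add_distrib]
    exact Finset.sum_congr rfl fun k _ => by ring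
  have lin : ∑ k ∈ box N, (-(eigen Lx Ly k * c k ^ 2) + eigen Lx Ly k * q k * c k) ≤
      -(3 / 4) * E + 9 / 4 * Z + 3 * P4 := by
    rw [hE, hZ, hP4', Finset.mul_sum, Finset.mul_sum, Finset.mul_sum, ← Finset.sum_add_distrib,
      ← Finset.sum_add_distrib]
    refine Finset.sum_le_sum fun k _ => ?_
    unfold eigen
    set w := waveSq Lx Ly k
    -- Young's inequality in each mode
    nlinarith [mul_nonneg (sq_nonneg (w - 4)) (sq_nonneg (c k)),
      sq_nonneg (w * c k - 4 * (w * q k)), sq_nonneg (c k + 2 * (w * q k))]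
  have hS : ∑ k ∈ transversal (box N), waveSq Lx Ly k ^ 2 * c k ^ 2 ≤ E :=
    Finset.sum_le_sum_of_subset_of_nonneg (Finset.filter_subset _ _) fun k _ _ => by positivity
  -- the smallness of the solution absorbs the cubic term
  have hcub' := (abs_le.1 hcub).1
  have hcub2 : Ly ^ 2 * √Z * ∑ k ∈ transversal (box N), waveSq Lx Ly k ^ 2 * c k ^ 2 ≤ 1 / 8 * E :=
    mul_le_mul hsmall hS (Finset.sum_nonneg fun k _ => by positivity) (by norm_num)
  have hdist : ∑ k ∈ box N, (c k - q k) ^ 2 ≤ 3 / 2 * Z + 3 * P2 := by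
    rw [hZ, hP2', Finset.mul_sum, Finset.mul_sum, ← Finset.sum_add_distrib]
    refine Finset.sum_le_sum fun k _ => ?_
    nlinarith [sq_nonneg (c k + 2 * q k)]
  have hX : 0 ≤ Ly * Lx ^ 3 := by positivity
  rw [split, hq]
  linarith

end

section

variable {Lx Ly : ℝ}

/-! ### Galerkin truncations -/

/-- A bounded globally Lipschitz vector field has solutions on every time interval. -/
lemma exists_forall_hasDerivWithinAt_of_lipschitz {E : Type*} [NormedAddCommGroup E]
    [NormedSpace ℝ E] [CompleteSpace E] {f : E → E} {K : NNReal} (hf : LipschitzWith K f) {M : ℝ}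
    (hM : ∀ x, ‖f x‖ ≤ M) (x₀ : E) {T : ℝ} (hT : 0 ≤ T) :
    ∃ α : ℝ → E, α 0 = x₀ ∧ ∀ t ∈ Icc 0 T, HasDerivWithinAt α (f (α t)) (Icc 0 T) t := by
  have hM0 : 0 ≤ M := (norm_nonneg _).trans (hM x₀)
  lift M to NNReal using hM0
  lift T to NNReal using hT
  have h : IsPicardLindelof (fun _ => f) (⟨0, le_rfl, T.2⟩ : Icc 0 (T : ℝ)) x₀ (M * T) 0 M K :=
    { lipschitzOnWith := fun _ _ => hf.lipschitzOnWith
      continuousOn := fun _ _ => continuousOn_const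
      norm_le := fun _ _ x _ => hM x
      mul_max_le := by
        simp }
  exact h.exists_eq_forall_mem_Icc_hasDerivWithinAt₀

/-- A smooth vector field can be cut off outside a ball, so as to be bounded and Lipschitz. -/
lemma exists_cutoff_lipschitz {E F : Type*} [NormedAddCommGroup E] [NormedSpace ℝ E]
    [FiniteDimensional ℝ E] [NormedAddCommGroup F] [NormedSpace ℝ F] {g : E → F}
    (hg : ContDiff ℝ 1 g) {R : ℝ} (hR : 0 ≤ R) : ∃ (χ : E → ℝ) (K : NNReal) (M : ℝ),
      (∀ x, ‖x‖ ≤ R → χ x = 1) ∧ LipschitzWith K (fun x => χ x • g x) ∧ ∀ x, ‖χ x • g x‖ ≤ M := by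
  let χ : ContDiffBump (0 : E) := ⟨R + 1, R + 2, by linarith, by linarith⟩
  have hc : ContDiff ℝ 1 fun x => χ x • g x := χ.contDiff.smul hg
  have hs : HasCompactSupport fun x => χ x • g x := χ.hasCompactSupport.smul_right
  obtain ⟨K, hK⟩ := ContDiff.lipschitzWith_of_hasCompactSupport hs hc one_ne_zero
  obtain ⟨M, hM⟩ := hs.exists_bound_of_continuous hc.continuous
  refine ⟨χ, K, M, fun x hx => χ.one_of_mem_closedBall ?_, hK, hM⟩
  rw [mem_closedBall_zero_iff]
  change ‖x‖ ≤ R + 1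
  linarith

/-- The tested nonlinearity is a quadratic polynomial in the coefficients. -/
lemma integral_fieldSq_mul (s : Finset (ℤ × ℤ)) (c : ℤ × ℤ → ℝ) {d : ℝ × ℝ → ℝ}
    (hd : Continuous d) : ∫ p in rect Lx Ly, fieldSq Lx Ly s c p * d p =
      ∑ k ∈ s, ∑ l ∈ s, c k * c l * ∫ p in rect Lx Ly,
        (dirCoeff Lx Ly k 0 * dirCoeff Lx Ly l 0 + dirCoeff Lx Ly k 1 * dirCoeff Lx Ly l 1) *
          (mode Lx Ly k p * mode Lx Ly l p * d p) := by
  have e : ∀ p, fieldSq Lx Ly s c p * d p = ∑ k ∈ s, ∑ l ∈ s, c k * c l *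
      ((dirCoeff Lx Ly k 0 * dirCoeff Lx Ly l 0 + dirCoeff Lx Ly k 1 * dirCoeff Lx Ly l 1) *
          (mode Lx Ly k p * mode Lx Ly l p * d p)) := by
    intro p
    rw [fieldSq, comp, comp, modeSum, modeSum, sq, sq, Finset.sum_mul_sum, Finset.sum_mul_sum,
      ← Finset.sum_add_distrib, Finset.sum_mul]
    refine Finset.sum_congr rfl fun k _ => ?_
    rw [← Finset.sum_add_distrib, Finset.sum_mul]
    exact Finset.sum_congr rfl fun l _ => by ring
  simp_rw [e]
  rw [integral_finsetSum _ fun k _ => integrable_of_continuous (by fun_prop)]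
  refine Finset.sum_congr rfl fun k _ => ?_
  rw [integral_finsetSum _ fun l _ => integrable_of_continuous (by fun_prop)]
  exact Finset.sum_congr rfl fun l _ => integral_const_mul _ _

/-- The right-hand side of the truncated system, in the direction of the gradient mode `k`. -/
def truncRHS (Lx Ly : ℝ) (s : Finset (ℤ × ℤ)) (c : ℤ × ℤ → ℝ) (k : ℤ × ℤ) : ℝ :=
  -eigen Lx Ly k * c k - ∫ p in rect Lx Ly, fieldSq Lx Ly s c p * divMode Lx Ly k p

/-- The truncated system, multiplied by a factor `χ` which equals one as long as the solution stays
in the ball of radius `R`, is globally solvable. -/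
theorem exists_truncated_flow (s : Finset (ℤ × ℤ)) (c₀ : ℤ × ℤ → ℝ) {R T : ℝ} (hR : 0 ≤ R)
    (hT : 0 ≤ T) : ∃ (c : ℝ → ℤ × ℤ → ℝ) (χ : ℝ → ℝ), (∀ k ∈ s, c 0 k = c₀ k) ∧
      (∀ t k, k ∉ s → c t k = 0) ∧
      (∀ t, ∑ k ∈ s, c t k ^ 2 ≤ R ^ 2 → χ t = 1) ∧
      ∀ k ∈ s, ∀ t ∈ Icc 0 T,
        HasDerivWithinAt (fun t => c t k) (χ t * truncRHS Lx Ly s (c t) k) (Icc 0 T) t := by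
  classical
  -- finite families of coefficients are extended by zero
  let ext : (s → ℝ) → ℤ × ℤ → ℝ := fun x k => if h : k ∈ s then x ⟨k, h⟩ else 0
  have hext : ∀ k, ContDiff ℝ 1 fun x => ext x k := by
    intro k
    by_cases h : k ∈ s
    · simp only [ext, h, dif_pos]
      exact contDiff_apply ℝ ℝ _
    · simp only [ext, h, dif_neg, not_false_eq_true]
      exact contDiff_const
  have hext_mem : ∀ x (k : s), ext x k = x k := fun x k => by simp [ext]
  have hext_not : ∀ x k, k ∉ s → ext x k = 0 := fun x k hk => by simp [ext, hk]
  clear_value ext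
  have hg : ContDiff ℝ 1 fun (x : s → ℝ) (k : s) => truncRHS Lx Ly s (ext x) k := by
    refine contDiff_pi.2 fun k => ?_
    unfold truncRHS
    simp_rw [integral_fieldSq_mul s _ (continuous_divMode (Lx := Lx) (Ly := Ly) k)]
    refine (contDiff_const.mul (hext k)).sub (ContDiff.sum fun l _ => ContDiff.sum fun m _ => ?_)
    exact ((hext l).mul (hext m)).mul contDiff_const
  obtain ⟨χ, K, M, hχ, hK, hM⟩ := exists_cutoff_lipschitz hg hR
  obtain ⟨α, hα0, hα⟩ := exists_forall_hasDerivWithinAt_of_lipschitz hK hM (fun k : s => c₀ k) hT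
  refine ⟨fun t => ext (α t), fun t => χ (α t), fun k hk => ?_, fun t k hk => hext_not _ k hk,
    fun t ht => hχ _ ?_, fun k hk t ht => ?_⟩
  · exact (hext_mem (α 0) ⟨k, hk⟩).trans (congrFun hα0 ⟨k, hk⟩)
  · refine (pi_norm_le_iff_of_nonneg hR).2 fun k => ?_
    have h1 : ext (α t) k ^ 2 ≤ ∑ k ∈ s, ext (α t) k ^ 2 :=
      Finset.single_le_sum (f := fun k => ext (α t) k ^ 2) (fun k _ => sq_nonneg _) k.2
    rw [hext_mem] at h1
    exact abs_le_of_sq_le_sq (h1.trans ht) hR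
  · have h := hasDerivWithinAt_pi.1 (hα t ht) ⟨k, hk⟩
    have e : (fun t => ext (α t) k) = fun t => α t ⟨k, hk⟩ := funext fun t => hext_mem _ ⟨k, hk⟩
    rw [e]
    exact h

/-- The field in `L²` with coefficients `c` along the gradient modes in `s`. -/
def galerkinField (Lx Ly : ℝ) (s : Finset (ℤ × ℤ)) (c : ℤ × ℤ → ℝ) : L2Field Lx Ly :=
  ∑ k ∈ s, c k • gradModeLp Lx Ly k

lemma coeFn_galerkinField (s : Finset (ℤ × ℤ)) (c : ℤ × ℤ → ℝ) :
    ∀ᵐ p ∂rectMeasure Lx Ly, ∀ i, galerkinField Lx Ly s c p i = comp Lx Ly s c i p := by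
  classical
  induction s using Finset.induction_on with
  | empty =>
    simp only [galerkinField, Finset.sum_empty]
    filter_upwards [Lp.coeFn_zero (EuclideanSpace ℝ (Fin 2)) 2 (rectMeasure Lx Ly)] with p hp i
    rw [hp]; simp [comp, modeSum]
  | insert k s hk ih =>
    have e : galerkinField Lx Ly (insert k s) c =
        c k • gradModeLp Lx Ly k + galerkinField Lx Ly s c := Finset.sum_insert hk
    rw [e]
    filter_upwards [ih, Lp.coeFn_add (c k • gradModeLp Lx Ly k) (galerkinField Lx Ly s c),
      Lp.coeFn_smul (c k) (gradModeLp Lx Ly k),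
      coeFn_fieldLp (continuous_gradMode (Lx := Lx) (Ly := Ly) k)] with p h1 h2 h3 h4 i
    have h5 : gradModeLp Lx Ly k p = gradMode Lx Ly k p := h4
    rw [h2, Pi.add_apply, h3, Pi.smul_apply, h5, comp, modeSum, Finset.sum_insert hk,
      PiLp.add_apply, h1, PiLp.smul_apply, smul_eq_mul]
    simp only [gradMode, comp, modeSum]
    ring

variable {s : Finset (ℤ × ℤ)} {c : ℤ × ℤ → ℝ}

lemma normSq_galerkinField (s : Finset (ℤ × ℤ)) (c : ℤ × ℤ → ℝ) :
    (fun p => ‖galerkinField Lx Ly s c p‖ ^ 2) =ᵐ[rectMeasure Lx Ly] fieldSq Lx Ly s c := by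
  filter_upwards [coeFn_galerkinField (Lx := Lx) (Ly := Ly) s c] with p hp
  rw [EuclideanSpace.norm_sq_eq, Fin.sum_univ_two, hp, hp, Real.norm_eq_abs, Real.norm_eq_abs,
    sq_abs, sq_abs, fieldSq]

lemma norm_galerkinField_sq (hx : 0 < Lx) (hy : 0 < Ly) (hs : ∀ k ∈ s, k ≠ 0) :
    ‖galerkinField Lx Ly s c‖ ^ 2 = ∑ k ∈ s, c k ^ 2 := by
  rw [← integral_normSq, integral_congr_ae (normSq_galerkinField s c), integral_fieldSq hx hy hs]

lemma quadCoeff_galerkinField (k : ℤ × ℤ) : quadCoeff k (galerkinField Lx Ly s c) =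
    ∫ p in rect Lx Ly, fieldSq Lx Ly s c p * divMode Lx Ly k p := by
  refine integral_congr_ae ?_
  filter_upwards [normSq_galerkinField (Lx := Lx) (Ly := Ly) s c] with p hp
  rw [hp]

lemma gradCoeff_galerkinField (hx : 0 < Lx) (hy : 0 < Ly) {k : ℤ × ℤ} (hk : k ≠ 0) :
    gradCoeff k (galerkinField Lx Ly s c) = if k ∈ s then c k else 0 := by
  simp only [gradCoeff, galerkinField, inner_sum, inner_smul_right, inner_gradModeLp hx hy hk,
    mul_ite, mul_one, mul_zero, Finset.sum_ite_eq]

lemma galerkinField_mem (hx : 0 < Lx) (hy : 0 < Ly) (hs : ∀ k ∈ s, k ≠ 0) :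
    galerkinField Lx Ly s c ∈ potentialFields Lx Ly :=
  Submodule.sum_mem _ fun k hk => Submodule.smul_mem _ _
    ⟨meanZero_gradModeLp hx hy (hs k hk), curlFree_gradModeLp hx hy k⟩

end

section

variable {Lx Ly ℓ : ℝ} {N : ℕ}

/-! ### The a priori bound -/

/-- The squared distance, within the modes of `box N`, to the gauge field centred at `b`. -/
def gaugeDist (Lx Ly ℓ : ℝ) (N : ℕ) (c : ℤ × ℤ → ℝ) (b : ℝ) : ℝ :=
  ∑ k ∈ box N, (c k - gaugeVec Lx Ly ℓ b k) ^ 2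

lemma gaugeVec_add_period (hx : 0 < Lx) (k : ℤ × ℤ) (b : ℝ) :
    gaugeVec Lx Ly ℓ (b + Lx) k = gaugeVec Lx Ly ℓ b k := by
  have e : -(wave Lx Ly k 0 * (b + Lx)) =
      -(wave Lx Ly k 0 * b) + ((-k.1 : ℤ) : ℝ) * (2 * Real.pi) := by
    simp only [wave, if_true]
    push_cast
    field_simp
    ring
  simp only [gaugeVec]
  rw [e, cas_add_int_mul_two_pi]

/-- Since the gauge fields have a common length, minimising the distance amounts to maximising a
linear pairing with the gauge field. -/
lemma gaugeDist_eq (c : ℤ × ℤ → ℝ) (b : ℝ) : gaugeDist Lx Ly ℓ N c b =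
    ∑ k ∈ box N, c k ^ 2 + ∑ k ∈ box N, gaugeVec Lx Ly ℓ 0 k ^ 2 -
      2 * ∑ k ∈ box N, c k * gaugeVec Lx Ly ℓ b k := by
  rw [← sum_gaugeVec_sq b, gaugeDist, Finset.mul_sum, ← Finset.sum_add_distrib,
    ← Finset.sum_sub_distrib]
  exact Finset.sum_congr rfl fun k _ => by ring

lemma continuous_gaugeDist :
    Continuous fun q : (ℤ × ℤ → ℝ) × ℝ => gaugeDist Lx Ly ℓ N q.1 q.2 := by
  have h : ∀ k, Continuous fun b => gaugeVec Lx Ly ℓ b k := fun k =>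
    continuous_iff_continuousAt.2 fun b => (hasDerivAt_gaugeVec k b).continuousAt
  unfold gaugeDist
  refine continuous_finsetSum _ fun k _ => Continuous.pow (Continuous.sub ?_ ?_) 2
  · exact (continuous_apply k).comp continuous_fst
  · exact (h k).comp continuous_snd

/-- The distance to the gauge fields is attained, at a centre where it is stationary. -/
lemma exists_gaugeDist_min (hx : 0 < Lx) (c : ℤ × ℤ → ℝ) : ∃ b ∈ Icc 0 Lx,
    sInf (gaugeDist Lx Ly ℓ N c '' Icc 0 Lx) = gaugeDist Lx Ly ℓ N c b ∧
      ∑ k ∈ box N, c k * gaugeVecDeriv Lx Ly ℓ b k = 0 := by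
  have hc : Continuous (gaugeDist Lx Ly ℓ N c) :=
    continuous_gaugeDist.comp (Continuous.prodMk_right c)
  obtain ⟨b, hb, h1, h2⟩ := isCompact_Icc.exists_sInf_image_eq_and_le
    (nonempty_Icc.2 hx.le) hc.continuousOn
  refine ⟨b, hb, h1, ?_⟩
  have hmax : IsLocalMax (fun b => ∑ k ∈ box N, c k * gaugeVec Lx Ly ℓ b k) b := by
    refine Eventually.of_forall fun b' => ?_
    have hper : Function.Periodic (gaugeDist Lx Ly ℓ N c) Lx := fun b => by
      refine Finset.sum_congr rfl fun k _ => ?_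
      rw [gaugeVec_add_period hx k b]
    obtain ⟨b'', hb'', e⟩ := hper.exists_mem_Ico₀ hx b'
    have h3 := h2 b'' (Ico_subset_Icc_self hb'')
    rw [← e, gaugeDist_eq, gaugeDist_eq] at h3
    beta_reduce
    linarith
  exact hmax.hasDerivAt_eq_zero
    (HasDerivAt.fun_sum fun k _ => (hasDerivAt_gaugeVec k b).const_mul (c k))

lemma gaugeDist_nonneg (c : ℤ × ℤ → ℝ) (b : ℝ) : 0 ≤ gaugeDist Lx Ly ℓ N c b :=
  Finset.sum_nonneg fun _ _ => sq_nonneg _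

lemma sum_sq_le_gaugeDist (hx : 0 < Lx) (hy : 0 < Ly) (c : ℤ × ℤ → ℝ) (b : ℝ) :
    ∑ k ∈ box N, c k ^ 2 ≤ 2 * gaugeDist Lx Ly ℓ N c b + 450 * (Ly * Lx ^ 3) := by
  have h := sum_gaugeVec_sq_le (ℓ := ℓ) (b := b) (N := N) hx hy
  have : ∑ k ∈ box N, c k ^ 2 ≤ 2 * gaugeDist Lx Ly ℓ N c b +
      2 * ∑ k ∈ box N, gaugeVec Lx Ly ℓ b k ^ 2 := by
    rw [gaugeDist, Finset.mul_sum, Finset.mul_sum, ← Finset.sum_add_distrib]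
    exact Finset.sum_le_sum fun k _ => by nlinarith [sq_nonneg (c k - 2 * gaugeVec Lx Ly ℓ b k)]
  linarith

lemma gaugeDist_le_sum_sq (hx : 0 < Lx) (hy : 0 < Ly) (c : ℤ × ℤ → ℝ) (b : ℝ) :
    gaugeDist Lx Ly ℓ N c b ≤ 2 * ∑ k ∈ box N, c k ^ 2 + 450 * (Ly * Lx ^ 3) := by
  have h := sum_gaugeVec_sq_le (ℓ := ℓ) (b := b) (N := N) hx hy
  have : gaugeDist Lx Ly ℓ N c b ≤ 2 * ∑ k ∈ box N, c k ^ 2 +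
      2 * ∑ k ∈ box N, gaugeVec Lx Ly ℓ b k ^ 2 := by
    rw [gaugeDist, Finset.mul_sum, Finset.mul_sum, ← Finset.sum_add_distrib]
    exact Finset.sum_le_sum fun k _ => by nlinarith [sq_nonneg (c k + gaugeVec Lx Ly ℓ b k)]
  linarith

/-- The a priori bound: the distance to the family of gauge fields stays below a barrier which
decays exponentially to the size of the absorbing ball. At a contact point the solution is small
enough for the Lyapunov inequality to apply, with the centre frozen at its optimal value. -/
theorem sum_sq_le_of_flow (hx : 0 < Lx) (hy : 0 < Ly) (hxy : Ly ≤ Lx) (hℓ : 0 < ℓ)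
    (hL : ℓ ≤ Lx / 2) (hr : 1 ≤ Lx / (2 * Real.pi * ℓ)) (hLℓ : 64000 * ℓ ^ 3 * Lx = 1)
    (hN : ∀ y ∈ Icc (-(Lx / 2)) (Lx / 2), |gaugeSum Lx ℓ N y - gaugeDensity Lx ℓ y| ≤ 1)
    (hthin : 3968 * (Lx / (2 * Real.pi * ℓ)) * Ly ^ 4 ≤ 162) {R T : ℝ} (hR : 0 ≤ R)
    (hRsmall : Ly ^ 2 * R ≤ 1 / 8) {c : ℝ → ℤ × ℤ → ℝ} {χ : ℝ → ℝ}
    (hzero : ∀ t k, k ∉ box N → c t k = 0)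
    (hχ : ∀ t, ∑ k ∈ box N, c t k ^ 2 ≤ R ^ 2 → χ t = 1)
    (hd : ∀ k ∈ box N, ∀ t ∈ Icc 0 T,
      HasDerivWithinAt (fun t => c t k) (χ t * truncRHS Lx Ly (box N) (c t) k) (Icc 0 T) t)
    (h0 : 10 ^ 12 * (Ly * Lx ^ 3) + (4 * ∑ k ∈ box N, c 0 k ^ 2 + 900 * (Ly * Lx ^ 3)) ≤ R ^ 2)
    {t : ℝ} (ht : t ∈ Icc 0 T) :
    ∑ k ∈ box N, c t k ^ 2 ≤ 10 ^ 12 * (Ly * Lx ^ 3) +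
      (4 * ∑ k ∈ box N, c 0 k ^ 2 + 900 * (Ly * Lx ^ 3)) * Real.exp (-t) := by
  set X := Ly * Lx ^ 3 with hX
  have hX0 : 0 < X := by positivity
  set Z := ∑ k ∈ box N, c 0 k ^ 2 with hZ
  have hZ0 : 0 ≤ Z := Finset.sum_nonneg fun k _ => sq_nonneg _
  set D := gaugeDist Lx Ly ℓ N with hD
  -- `F` is the distance to the family of gauge fields, `B` the barrier, `β` an optimal centre;
  -- `F` is not differentiable in general, and only its upper right derivative is estimated
  set F : ℝ → ℝ := fun t => sInf (D (c t) '' Icc 0 Lx) with hF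
  set B : ℝ → ℝ := fun t => (4 * 10 ^ 11 + 1) * X + (2 * Z + 450 * X) * Real.exp (-t) with hB
  choose β hβmem hβ hβstat using fun t => exists_gaugeDist_min (Ly := Ly) (ℓ := ℓ) (N := N) hx (c t)
  have hFβ : ∀ t, F t = D (c t) (β t) := hβ
  have hFle : ∀ t, ∀ b ∈ Icc 0 Lx, F t ≤ D (c t) b := fun t b hb =>
    csInf_le ⟨0, by rintro _ ⟨b, -, rfl⟩; exact gaugeDist_nonneg _ _⟩ (mem_image_of_mem _ hb)
  have hcc : ContinuousOn c (Icc 0 T) := by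
    refine continuousOn_pi.2 fun k => ?_
    by_cases hk : k ∈ box N
    · exact fun t ht => (hd k hk t ht).continuousWithinAt
    · simp only [hzero _ k hk]
      exact continuousOn_const
  have hFc : ContinuousOn F (Icc 0 T) := by
    have : Continuous fun x : ℤ × ℤ → ℝ => sInf (D x '' Icc 0 Lx) :=
      isCompact_Icc.continuous_sInf continuous_gaugeDist
    exact this.comp_continuousOn hcc
  have hexp : ∀ t : ℝ, HasDerivAt (fun t => Real.exp (-t)) (-Real.exp (-t)) t := fun t => by
    simpa using (hasDerivAt_neg t).exp
  have hBd : ∀ t, HasDerivAt B (-((2 * Z + 450 * X) * Real.exp (-t))) t := fun t => by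
    have := ((hexp t).const_mul (2 * Z + 450 * X)).const_add ((4 * 10 ^ 11 + 1) * X)
    rwa [mul_neg] at this
  have key := image_le_of_liminf_slope_right_lt_deriv_boundary' (f := F)
    (f' := fun t => 2 * ∑ k ∈ box N, (c t k - gaugeVec Lx Ly ℓ (β t) k) *
      (χ t * truncRHS Lx Ly (box N) (c t) k)) hFc (fun t ht r hr => ?_) (B := B)
    (B' := fun t => -((2 * Z + 450 * X) * Real.exp (-t))) ?_
    (fun t _ => (hBd t).continuousAt.continuousWithinAt) (fun t _ => (hBd t).hasDerivWithinAt)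
    (fun t ht hFB => ?_) ht
  · -- from the distance back to the norm
    have h1 := sum_sq_le_gaugeDist (ℓ := ℓ) (N := N) hx hy (c t) (β t)
    rw [← hD, ← hFβ, ← hX] at h1
    simp only [hB] at key
    nlinarith [Real.exp_pos (-t)]
  · -- freezing the centre gives an upper bound for the distance which touches at `t`
    have hder : HasDerivWithinAt (fun z => D (c z) (β t))
        (2 * ∑ k ∈ box N, (c t k - gaugeVec Lx Ly ℓ (β t) k) *
          (χ t * truncRHS Lx Ly (box N) (c t) k)) (Ici t) t := by
      have h : HasDerivWithinAt (fun z => D (c z) (β t))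
          (2 * ∑ k ∈ box N, (c t k - gaugeVec Lx Ly ℓ (β t) k) *
            (χ t * truncRHS Lx Ly (box N) (c t) k)) (Icc 0 T) t := by
        rw [Finset.mul_sum]
        refine HasDerivWithinAt.fun_sum fun k hk => ?_
        have h := ((hd k hk t (Ico_subset_Icc_self ht)).sub_const
          (gaugeVec Lx Ly ℓ (β t) k)).fun_pow 2
        convert! h using 1
        push_cast
        ring
      exact (h.mono (Icc_subset_Icc_left ht.1)).mono_of_mem_nhdsWithin (Icc_mem_nhdsGE ht.2)
    have hslope := (hasDerivWithinAt_iff_tendsto_slope' (lt_irrefl t)).1 hder.Ioi_of_Ici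
    have hev : ∀ᶠ z in nhdsWithin t (Ioi t), slope (fun z => D (c z) (β t)) t z < r ∧ z ∈ Ioi t :=
      (hslope.eventually (gt_mem_nhds hr)).and self_mem_nhdsWithin
    refine hev.frequently.mono fun z hz => lt_of_le_of_lt ?_ hz.1
    have hzt : 0 < z - t := sub_pos.2 hz.2
    rw [slope_def_field, slope_def_field]
    have h1 := hFle z (β t) (hβmem t)
    have h2 := hFβ t
    gcongr
    exact h2.ge
  · -- the barrier lies above the distance initially
    have h1 := hFle 0 0 ⟨le_rfl, hx.le⟩
    have h2 := gaugeDist_le_sum_sq (ℓ := ℓ) (N := N) hx hy (c 0) 0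
    simp only [hB, neg_zero, Real.exp_zero, mul_one]
    rw [← hD, ← hX, ← hZ] at h2
    nlinarith
  · -- at a contact point the cut-off is inactive, and the Lyapunov inequality gives a derivative
    -- below that of the barrier; the excess `1` in the first constant makes this strict
    have he1 : Real.exp (-t) ≤ 1 := Real.exp_le_one_iff.2 (by linarith [ht.1])
    have he0 := Real.exp_pos (-t)
    have h1 := sum_sq_le_gaugeDist (ℓ := ℓ) (N := N) hx hy (c t) (β t)
    rw [← hD, ← hFβ, ← hX, hFB] at h1
    have hle : ∑ k ∈ box N, c t k ^ 2 ≤ R ^ 2 := by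
      refine le_trans ?_ h0
      simp only [hB] at h1
      nlinarith
    have hsmall : Ly ^ 2 * √(∑ k ∈ box N, c t k ^ 2) ≤ 1 / 8 := by
      refine le_trans ?_ hRsmall
      gcongr
      exact Real.sqrt_le_iff.2 ⟨hR, hle⟩
    have hstat := sum_sub_gaugeVec_mul_le hx hy hxy hℓ hL hr hLℓ hN hthin hsmall (hβstat t)
    rw [hχ t hle]
    simp only [one_mul]
    have e : D (c t) (β t) = ∑ k ∈ box N, (c t k - gaugeVec Lx Ly ℓ (β t) k) ^ 2 := rfl
    rw [← e, ← hFβ, hFB, ← hX] at hstat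
    simp only [hB] at hstat
    unfold truncRHS
    linarith

end

section

variable {Lx Ly ℓ : ℝ} {N : ℕ}

/-! ### The absorbed solution -/

lemma mem_box {k : ℤ × ℤ} : k ∈ box N ↔
    k ≠ 0 ∧ (-(N : ℤ) ≤ k.1 ∧ k.1 ≤ N) ∧ (-(N : ℤ) ≤ k.2 ∧ k.2 ≤ N) := by
  simp [box, Finset.mem_erase, Finset.mem_product, Finset.mem_Icc]

lemma box_mono : Monotone box := fun N M h k hk => by
  have h' : (N : ℤ) ≤ M := by exact_mod_cast h
  rw [mem_box] at hk ⊢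
  exact ⟨hk.1, ⟨by linarith [hk.2.1.1], hk.2.1.2.trans h'⟩, by linarith [hk.2.2.1],
    hk.2.2.2.trans h'⟩

lemma eventually_mem_box {k : ℤ × ℤ} (hk : k ≠ 0) : ∀ᶠ N in atTop, k ∈ box N := by
  filter_upwards [eventually_ge_atTop (max k.1.natAbs k.2.natAbs)] with N hN
  rw [mem_box]
  have h1 := (le_max_left _ _).trans hN
  have h2 := (le_max_right _ _).trans hN
  exact ⟨hk, by omega, by omega⟩

lemma sum_gradCoeff_sq_le (hx : 0 < Lx) (hy : 0 < Ly) {u : L2Field Lx Ly}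
    (hu : u ∈ potentialFields Lx Ly) : ∑ k ∈ box N, gradCoeff k u ^ 2 ≤ ‖u‖ ^ 2 := by
  classical
  rw [← Finset.sum_subtype_of_mem (fun k => gradCoeff k u ^ 2) (box_ne_zero (N := N))]
  exact sum_le_hasSum _ (fun _ _ => sq_nonneg _) (hasSum_gradCoeff_sq hx hy hu)

/-- While the cut-off is inactive, the truncated flow satisfies the integrated equations. -/
lemma coeffEq_of_flow (hx : 0 < Lx) (hy : 0 < Ly) {T : ℝ} {c : ℝ → ℤ × ℤ → ℝ} {χ : ℝ → ℝ}
    {u₀ : L2Field Lx Ly} (h0 : ∀ k ∈ box N, c 0 k = gradCoeff k u₀)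
    (hc : ContinuousOn (fun t => galerkinField Lx Ly (box N) (c t)) (Icc 0 T))
    (hd : ∀ k ∈ box N, ∀ t ∈ Icc 0 T,
      HasDerivWithinAt (fun t => c t k) (χ t * truncRHS Lx Ly (box N) (c t) k) (Icc 0 T) t)
    (hχ : ∀ t ∈ Icc 0 T, χ t = 1) {k : ℤ × ℤ} (hk : k ∈ box N) :
    CoeffEq T u₀ (fun t => galerkinField Lx Ly (box N) (c t)) k := by
  intro t ht
  have hg : ∀ s, gradCoeff k (galerkinField Lx Ly (box N) (c s)) = c s k := fun s => by
    rw [gradCoeff_galerkinField hx hy (box_ne_zero k hk), if_pos hk]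
  have hsub : Icc 0 t ⊆ Icc 0 T := Icc_subset_Icc_right ht.2
  have hcont : ContinuousOn (fun s => -eigen Lx Ly k * c s k -
      quadCoeff k (galerkinField Lx Ly (box N) (c s))) (Icc 0 t) :=
    (continuousOn_const.mul fun s hs => (hd k hk s (hsub hs)).continuousWithinAt.mono hsub).sub
      ((continuous_quadCoeff k).comp_continuousOn (hc.mono hsub))
  have h := intervalIntegral.integral_eq_sub_of_hasDerivAt_of_le ht.1
    (f := fun s => c s k) (f' := fun s => -eigen Lx Ly k * c s k -
      quadCoeff k (galerkinField Lx Ly (box N) (c s)))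
    (fun s hs => (hd k hk s (hsub hs)).continuousWithinAt.mono hsub)
    (fun s hs => by
      have hsT : s ∈ Icc 0 T := hsub (Ioo_subset_Icc_self hs)
      have h := (hd k hk s hsT).hasDerivAt (Icc_mem_nhds hs.1 (hs.2.trans_le ht.2))
      rw [hχ s hsT, one_mul] at h
      rw [quadCoeff_galerkinField]
      exact h) (hcont.intervalIntegrable_of_Icc ht.1)
  simp only [hg]
  rw [h, h0 k hk]
  ring

/-- In a thin rectangle, small data lead to a global weak solution which decays exponentially to
the size of the gauge field. The `N`-th Galerkin approximation solves the system truncated to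
`box N` on `[0, N]`. -/
theorem exists_absorbed_solution (hx : 1 ≤ Lx) (hy : 0 < Ly) (hthin : Lx * Ly ≤ 1 / 1000)
    {u₀ : L2Field Lx Ly} (hu₀ : u₀ ∈ potentialFields Lx Ly) (hsmall : Ly ^ 2 * ‖u₀‖ ≤ 1 / 1000) :
    ∃ u : ℝ → L2Field Lx Ly, IsWeakSolution (Ici 0) u₀ u ∧ ∀ t, 0 ≤ t →
      ‖u t‖ ^ 2 ≤ 10 ^ 12 * (Ly * Lx ^ 3) +
        (4 * ‖u₀‖ ^ 2 + 900 * (Ly * Lx ^ 3)) * Real.exp (-t) := by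
  have hx0 : 0 < Lx := by linarith
  have hLy : Ly ≤ 1 / 1000 := by nlinarith
  have hxy : Ly ≤ Lx := by linarith
  set X := Ly * Lx ^ 3 with hX
  have hX0 : 0 < X := by positivity
  -- the width `ℓ = 1 / (40 * Lx ^ (1 / 3))` of the gauge profile
  obtain ⟨a, ha1, ha3⟩ : ∃ a : ℝ, 1 ≤ a ∧ a ^ 3 = Lx := by
    refine ⟨Lx ^ (1 / 3 : ℝ), Real.one_le_rpow hx (by norm_num), ?_⟩
    rw [← Real.rpow_natCast, ← Real.rpow_mul hx0.le]
    norm_num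
  have ha0 : 0 < a := by linarith
  set ℓ := (40 * a)⁻¹ with hℓ'
  have hℓ : 0 < ℓ := by positivity
  have hℓ1 : ℓ ≤ 1 / 40 := by
    rw [hℓ', inv_eq_one_div]; gcongr; linarith
  have hL : ℓ ≤ Lx / 2 := by linarith
  have hpi := Real.pi_gt_three
  have hpi' := Real.pi_lt_four
  have hr : 1 ≤ Lx / (2 * Real.pi * ℓ) := by
    rw [one_le_div (by positivity)]
    nlinarith
  have hLℓ : 64000 * ℓ ^ 3 * Lx = 1 := by
    rw [← ha3, hℓ']; field_simp; norm_num
  have hLy4 : (Lx * Ly) ^ 4 ≤ (1 / 1000) ^ 4 := by gcongr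
  have hLy5 : (Lx * Ly) ^ 5 ≤ (1 / 1000) ^ 5 := by gcongr
  have hgt : 3968 * (Lx / (2 * Real.pi * ℓ)) * Ly ^ 4 ≤ 162 := by
    have h1 : Lx / (2 * Real.pi * ℓ) ≤ Lx / (6 * ℓ) := by gcongr; linarith
    have h2 : Lx / (6 * ℓ) = 20 / 3 * a ^ 4 := by
      rw [← ha3, hℓ']; field_simp; norm_num
    have h3 : a ^ 4 ≤ Lx ^ 4 := by
      have : a ≤ Lx := by rw [← ha3]; nlinarith [mul_nonneg ha0.le ha0.le]
      gcongr
    calc 3968 * (Lx / (2 * Real.pi * ℓ)) * Ly ^ 4 ≤ 3968 * (20 / 3 * Lx ^ 4) * Ly ^ 4 := by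
          gcongr; linarith
      _ = 3968 * (20 / 3) * (Lx * Ly) ^ 4 := by ring
      _ ≤ 3968 * (20 / 3) * (1 / 1000) ^ 4 := by gcongr
      _ ≤ 162 := by norm_num
  -- the radius up to which the cubic term is absorbed
  set R := 1 / (8 * Ly ^ 2) with hR'
  have hR : 0 ≤ R := by positivity
  have hRsmall : Ly ^ 2 * R ≤ 1 / 8 := by rw [hR']; field_simp; norm_num
  have hinit : 10 ^ 12 * X + (4 * ‖u₀‖ ^ 2 + 900 * X) ≤ R ^ 2 := by
    have e : R ^ 2 = 1 / 64 / Ly ^ 4 := by rw [hR']; field_simp; norm_num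
    rw [e, le_div_iff₀ (by positivity)]
    have h1 : X * Ly ^ 4 ≤ (1 / 1000) ^ 5 := by
      refine le_trans ?_ hLy5
      have : Lx ^ 3 ≤ Lx ^ 5 := pow_le_pow_right₀ hx (by norm_num)
      calc X * Ly ^ 4 = Lx ^ 3 * Ly ^ 5 := by rw [hX]; ring
        _ ≤ Lx ^ 5 * Ly ^ 5 := by gcongr
        _ = _ := by ring
    have h2 : (Ly ^ 2 * ‖u₀‖) ^ 2 ≤ (1 / 1000) ^ 2 := by gcongr
    nlinarith
  obtain ⟨N₀, hN₀⟩ := eventually_atTop.1 (eventually_abs_gaugeSum_sub_le hℓ hL hr)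
  choose c χ hc0 hczero hχ hcd using fun N : ℕ =>
    exists_truncated_flow (Lx := Lx) (Ly := Ly) (box N) (fun k => gradCoeff k u₀) hR N.cast_nonneg
  have hS : ∀ N, ∑ k ∈ box N, c N 0 k ^ 2 ≤ ‖u₀‖ ^ 2 := fun N => by
    refine le_trans (le_of_eq ?_) (sum_gradCoeff_sq_le (N := N) hx0 hy hu₀)
    exact Finset.sum_congr rfl fun k hk => by rw [hc0 N k hk]
  have hbound : ∀ N ≥ N₀, ∀ t ∈ Icc (0 : ℝ) N, ∑ k ∈ box N, c N t k ^ 2 ≤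
      10 ^ 12 * X + (4 * ‖u₀‖ ^ 2 + 900 * X) * Real.exp (-t) := fun N hN t ht => by
    have h := sum_sq_le_of_flow hx0 hy hxy hℓ hL hr hLℓ (hN₀ N hN) hgt hR hRsmall (hczero N)
      (hχ N) (hcd N) (by have := hS N; linarith) ht
    have := mul_le_mul_of_nonneg_right (hS N) (Real.exp_pos (-t)).le
    linarith
  have hboundR : ∀ N ≥ N₀, ∀ t ∈ Icc (0 : ℝ) N, ∑ k ∈ box N, c N t k ^ 2 ≤ R ^ 2 :=
    fun N hN t ht => by
      have h := hbound N hN t ht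
      have he : Real.exp (-t) ≤ 1 := Real.exp_le_one_iff.2 (by linarith [ht.1])
      have : (4 * ‖u₀‖ ^ 2 + 900 * X) * Real.exp (-t) ≤ 4 * ‖u₀‖ ^ 2 + 900 * X :=
        mul_le_of_le_one_right (by positivity) he
      linarith
  have hcont : ∀ N, ContinuousOn (fun t => galerkinField Lx Ly (box N) (c N t)) (Icc 0 N) := by
    intro N
    unfold galerkinField
    refine continuousOn_finsetSum _ fun k hk => ?_
    have h : ContinuousOn (fun t => c N t k) (Icc 0 N) := fun t ht =>
      (hcd N k hk t ht).continuousWithinAt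
    exact h.smul continuousOn_const
  have hnorm : ∀ N t, ‖galerkinField Lx Ly (box N) (c N t)‖ ^ 2 = ∑ k ∈ box N, c N t k ^ 2 :=
    fun N t => norm_galerkinField_sq hx0 hy box_ne_zero
  have hin : ∀ N (k : ℤ × ℤ), k ∈ insert 0 (box N : Set (ℤ × ℤ)) → k ≠ 0 → k ∈ box N :=
    fun N k hk hk0 => (mem_insert_iff.1 hk).resolve_left hk0
  -- the frequency `0`, at which there is no equation, is added to the truncations so that they
  -- exhaust the lattice
  obtain ⟨u, hu, hlim⟩ := exists_weakSolution_of_truncations (R := R) (N₀ := N₀)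
    (U := fun N t => galerkinField Lx Ly (box N) (c N t))
    (K := fun N => insert 0 (box N : Set (ℤ × ℤ))) hx0 hy hu₀
    (fun k => by
      by_cases hk : k = 0
      · exact Eventually.of_forall fun N => Or.inl hk
      · exact (eventually_mem_box hk).mono fun N hN => Or.inr hN)
    (fun N M h => insert_subset_insert (Finset.coe_subset.2 (box_mono h)))
    (fun N _ => hcont N) (fun N _ t _ => galerkinField_mem hx0 hy box_ne_zero)
    (fun N hN t ht => by
      refine (sq_le_sq₀ (norm_nonneg _) hR).1 ?_
      rw [hnorm]
      exact hboundR N hN t ht)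
    (fun N hN k hk hk0 => coeffEq_of_flow hx0 hy (hc0 N) (hcont N) (hcd N)
      (fun t ht => hχ N t (hboundR N hN t ht)) (hin N k hk hk0))
    (fun N _ k hk hk0 t _ => by
      rw [gradCoeff_galerkinField hx0 hy hk0, if_neg (fun h : k ∈ box N => hk (Or.inr h))])
  refine ⟨u, hu, fun t ht => ?_⟩
  refine le_of_tendsto ((hlim t ht).norm.pow 2) ?_
  filter_upwards [eventually_ge_atTop N₀, tendsto_natCast_atTop_atTop.eventually_ge_atTop t]
    with N hN hNt
  rw [hnorm]
  exact hbound N hN t ⟨ht, hNt⟩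

lemma IsWeakSolution.mono {I J : Set ℝ} {u₀ : L2Field Lx Ly} {u : ℝ → L2Field Lx Ly}
    (h : IsWeakSolution J u₀ u) (hIJ : I ⊆ J) : IsWeakSolution I u₀ u :=
  ⟨h.continuousOn.mono hIJ, h.initial, fun t ht => h.curlFree t (hIJ ht),
    fun t ht => h.weak t (hIJ ht)⟩

end

end ThinKS

end

theorem mainTheorem3 :
    ∃ c : ℝ, 0 < c ∧ ∃ C : ℝ, 0 < C ∧
      ∀ Lx Ly : ℝ, 1 ≤ Lx → 0 < Ly → Ly ≤ c * Lx ^ (-(13 / 7) : ℝ) →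
        ∀ u₀ : ThinKS.L2Field Lx Ly, ThinKS.MeanZero u₀ → ThinKS.CurlFree u₀ →
          ‖u₀‖ ≤ c * Ly ^ (-2 : ℝ) →
          ∃ u : ℝ → ThinKS.L2Field Lx Ly,
            ThinKS.IsWeakSolution (Set.Ici 0) u₀ u ∧
            (∀ T : ℝ, 0 < T → ∀ v : ℝ → ThinKS.L2Field Lx Ly,
              ThinKS.IsWeakSolution (Set.Icc 0 T) u₀ v → Set.EqOn v u (Set.Icc 0 T)) ∧
            (∃ B : ℝ, ∀ t : ℝ, 0 ≤ t → ‖u t‖ ≤ B) ∧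
            Filter.limsup (fun t : ℝ => ‖u t‖) Filter.atTop
              ≤ C * Lx ^ (3 / 2 : ℝ) * Ly ^ (1 / 2 : ℝ) := by
  refine ⟨1 / 1000, by norm_num, 2 * 10 ^ 6, by norm_num, fun Lx Ly hx hy hLy u₀ hm hcurl hu₀ => ?_⟩
  have hx0 : 0 < Lx := by linarith
  -- only the consequence `Lx * Ly ≤ c` of the thinness is needed, since `Lx ≥ 1`
  have hthin : Lx * Ly ≤ 1 / 1000 := by
    have h1 : Lx ^ (-(13 / 7) : ℝ) ≤ Lx ^ (-1 : ℝ) :=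
      Real.rpow_le_rpow_of_exponent_le hx (by norm_num)
    rw [Real.rpow_neg_one] at h1
    calc Lx * Ly ≤ Lx * (1 / 1000 * Lx⁻¹) :=
          mul_le_mul_of_nonneg_left (hLy.trans (mul_le_mul_of_nonneg_left h1 (by norm_num))) hx0.le
      _ = 1 / 1000 := by field_simp
  have hsmall : Ly ^ 2 * ‖u₀‖ ≤ 1 / 1000 := by
    have e : Ly ^ (-2 : ℝ) = (Ly ^ 2)⁻¹ := by
      rw [Real.rpow_neg hy.le, Real.rpow_two]
    rw [e] at hu₀
    calc Ly ^ 2 * ‖u₀‖ ≤ Ly ^ 2 * (1 / 1000 * (Ly ^ 2)⁻¹) := by gcongr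
      _ = 1 / 1000 := by field_simp
  obtain ⟨u, hu, hbound⟩ := ThinKS.exists_absorbed_solution hx hy hthin ⟨hm, hcurl⟩ hsmall
  set X := Ly * Lx ^ 3 with hX
  have hX0 : 0 < X := by positivity
  set A := 4 * ‖u₀‖ ^ 2 + 900 * X
  have hA : 0 ≤ A := by positivity
  refine ⟨u, hu, fun T _ v hv => hv.eqOn hx0 hy hm (hu.mono Icc_subset_Ici_self),
    ⟨√(10 ^ 12 * X + A), fun t ht => Real.le_sqrt_of_sq_le ((hbound t ht).trans ?_)⟩, ?_⟩
  · have he : Real.exp (-t) ≤ 1 := Real.exp_le_one_iff.2 (by linarith)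
    linarith [mul_le_of_le_one_right hA he]
  · -- `10 ^ 12 * X` is the limiting bound for the squared norm; the constant `4 * 10 ^ 12` leaves
    -- room for the transient
    have e : 2 * 10 ^ 6 * Lx ^ (3 / 2 : ℝ) * Ly ^ (1 / 2 : ℝ) = √(4 * 10 ^ 12 * X) := by
      have e1 : √(4 * 10 ^ 12 * X) = 2 * 10 ^ 6 * √X := by
        rw [Real.sqrt_mul (by norm_num), show (4 * 10 ^ 12 : ℝ) = (2 * 10 ^ 6) ^ 2 by norm_num,
          Real.sqrt_sq (by norm_num)]
      have e2 : √X = Lx ^ (3 / 2 : ℝ) * Ly ^ (1 / 2 : ℝ) := by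
        rw [hX, Real.sqrt_mul hy.le, Real.sqrt_eq_rpow, Real.sqrt_eq_rpow, ← Real.rpow_natCast,
          ← Real.rpow_mul hx0.le, mul_comm]
        norm_num
      rw [e1, e2]; ring
    rw [e]
    have hexp : Filter.Tendsto (fun t : ℝ => A * Real.exp (-t)) Filter.atTop (nhds 0) := by
      simpa using Real.tendsto_exp_neg_atTop_nhds_zero.const_mul A
    refine Filter.limsup_le_of_le
      (Filter.isCoboundedUnder_le_of_le Filter.atTop fun t => norm_nonneg (u t)) ?_
    filter_upwards [Filter.eventually_ge_atTop 0,
      hexp.eventually (ge_mem_nhds (show (0 : ℝ) < 3 * 10 ^ 12 * X by positivity))] with t ht htA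
    refine Real.le_sqrt_of_sq_le ((hbound t ht).trans ?_)
    linarith
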